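/- **Definitions.** An *abstract tropical curve* is a finite connected graph (loops and multiple edges are allowed) with a length in $(0,\infty]$ on each edge, where every edge of infinite length has an endpoint of degree $1$, called an *infinite vertex*. A *tropical modification* of a curve is any curve obtained from it by a finite sequence of subdivisions of edges, reverse subdivisions, and additions of an infinite edge at a finite vertex. A *nodal tropical curve* in $\mathbb R^2$ is a union of finitely many segments and rays which near each of its points is equal, up to a translation and a change of coordinates in $GL_2(\mathbb Z)$, either to a line (the rays generated by $e_1$ and $-e_1$), or to the union of the three rays generated by $e_1$, $e_2$ and $-e_1-e_2$, or to the union of two distinct lines of rational slope through the origin (a *node*). A node whose lines are parallel to the primitive integral vectors $v$ and $u$ has multiplicity $|\det(v,u)|$. Separating the two lines at each node, and giving a segment from $p$ to $p+\alpha v$ ($v$ a primitive integral vector, $\alpha>0$) the length $\alpha$ and rays infinite length, turns a nodal tropical curve into a graph with edge lengths. An *immersion* of an abstract tropical curve $\Gamma$ is a nodal tropical curve $C\subset\mathbb R^2$ for which this graph is isometric to a tropical modification of $\Gamma$. The *tropical crossing number* of $\Gamma$ is the minimal number of nodes, counted with multiplicity, of an immersion of $\Gamma$ in $\mathbb R^2$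 (and $\infty$ if there is none). **Proposition.** Let $n>9$ be an integer. Call an abstract tropical curve a *sun curve with $n$ rays* if its underlying graph is a cycle with $n$ vertices together with $n$ further edges of infinite length, one attached at each vertex of the cycle; the (finite) lengths of the edges of the cycle are arbitrary. Then every sun curve $\Gamma$ with $n$ rays has tropical crossing number at least $\lceil n/2\rceil-4$. Moreover, this bound is sharp: for every $n>9$ there are edge lengths for which the sun curve with $n$ rays has tropical crossing number exactly $\lceil n/2\rceil-4$. -/

import Mathlib

namespace Tropical

/-! ### Abstract tropical curves -/

/-- A finite connected graph, possibly with loops and multiple edges: every edge carries the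
unordered pair of its endpoints. -/
structure Multigraph where
  V : Type
  E : Type
  finiteV : Finite V
  finiteE : Finite E
  ends : E → Sym2 V
  connected : (SimpleGraph.fromEdgeSet (Set.range ends)).Connected

/-- The degree of a vertex: the number of incident edges, a loop being counted twice. -/
noncomputable def Multigraph.degree (G : Multigraph) (v : G.V) : ℕ :=
  {e : G.E | v ∈ G.ends e}.ncard + {e : G.E | G.ends e = s(v, v)}.ncard

/-- An abstract tropical curve: a finite connected graph with a length in `(0, ∞]` on each edge,
and a set of vertices of degree one, the infinite vertices, such that an edge has infinite length
if and only if one of its endpoints is infinite. -/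
structure TropicalCurve extends Multigraph where
  length : E → ENNReal
  length_pos : ∀ e, 0 < length e
  /-- the infinite vertices, i.e. the points at infinity of the curve -/
  IsInfinite : V → Prop
  infinite_degree : ∀ v, IsInfinite v → toMultigraph.degree v = 1
  length_eq_top_iff : ∀ e, length e = ⊤ ↔ ∃ v ∈ ends e, IsInfinite v

/-- `Γ'` is (a copy of) the curve obtained from `Γ` by subdividing an edge `e₀` with endpoints
`u` and `w`: the edge is replaced by two consecutive edges whose lengths add up to the length
of `e₀`. In `Option Γ.V` and `Option Γ.E`, the element `none` is the new vertex and the second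
of the two new edges. -/
def IsSubdivision (Γ Γ' : TropicalCurve) : Prop :=
  ∃ (e₀ : Γ.E) (u w : Γ.V) (f : Option Γ.V ≃ Γ'.V) (g : Option Γ.E ≃ Γ'.E),
    Γ.ends e₀ = s(u, w) ∧
    Γ'.ends (g (some e₀)) = s(f (some u), f none) ∧
    Γ'.ends (g none) = s(f none, f (some w)) ∧
    Γ'.length (g (some e₀)) + Γ'.length (g none) = Γ.length e₀ ∧
    (∀ e, e ≠ e₀ → Γ'.ends (g (some e)) = (Γ.ends e).map (fun v => f (some v)) ∧
      Γ'.length (g (some e)) = Γ.length e) ∧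
    (∀ v, Γ'.IsInfinite (f (some v)) ↔ Γ.IsInfinite v) ∧
    ¬ Γ'.IsInfinite (f none)

/-- `Γ'` is (a copy of) the curve obtained from `Γ` by adding an infinite edge at a finite
vertex `u`. -/
def IsElementaryModification (Γ Γ' : TropicalCurve) : Prop :=
  ∃ (u : Γ.V) (f : Option Γ.V ≃ Γ'.V) (g : Option Γ.E ≃ Γ'.E),
    ¬ Γ.IsInfinite u ∧
    Γ'.ends (g none) = s(f (some u), f none) ∧
    Γ'.length (g none) = ⊤ ∧
    (∀ e, Γ'.ends (g (some e)) = (Γ.ends e).map (fun v => f (some v)) ∧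
      Γ'.length (g (some e)) = Γ.length e) ∧
    (∀ v, Γ'.IsInfinite (f (some v)) ↔ Γ.IsInfinite v) ∧
    Γ'.IsInfinite (f none)

/-- `Γ'` is a tropical modification of `Γ`: it arises from `Γ` by a finite sequence of
elementary modifications, subdivisions and reverse subdivisions. -/
def IsModification : TropicalCurve → TropicalCurve → Prop :=
  Relation.ReflTransGen fun Γ Γ' =>
    IsElementaryModification Γ Γ' ∨ IsSubdivision Γ Γ' ∨ IsSubdivision Γ' Γ

/-! ### Nodal tropical curves in the plane -/

/-- The plane `ℝ²`. -/
abbrev Plane := Fin 2 → ℝ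

/-- An integral vector, as a vector of the plane. -/
def toReal (v : Fin 2 → ℤ) : Plane := fun i => (v i : ℝ)

/-- The ray from `p` in direction `v`. -/
def ray (p v : Plane) : Set Plane := {x | ∃ t : ℝ, 0 ≤ t ∧ x = p + t • v}

/-- The standard smooth model of valence `d` in the plane (`d = 2, 3`): the union of the rays
generated by the first `d - 1` coordinate vectors and by minus their sum. -/
def smoothModel (d : ℕ) : Set Plane :=
  (⋃ i ∈ {i : Fin 2 | i.val + 1 < d}, ray 0 (Pi.single i 1)) ∪
    ray 0 (-∑ i with i.val + 1 < d, Pi.single i 1)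

/-- Near `p`, the set `C` is equal to a standard smooth model, up to a translation and a change of
coordinates in `GL₂(ℤ)`. -/
def IsSmoothAt (C : Set Plane) (p : Plane) : Prop :=
  ∃ (d : ℕ) (A : Matrix.GeneralLinearGroup (Fin 2) ℤ), 2 ≤ d ∧ d ≤ 3 ∧
    ∀ᶠ x in nhds p,
      (x ∈ C ↔ ∃ y ∈ smoothModel d, x = p + (A.val.map (Int.cast : ℤ → ℝ)).mulVec y)

/-- An integral vector whose entries have no common divisor. -/
def IsPrimitive (v : Fin 2 → ℤ) : Prop := Int.gcd (v 0) (v 1) = 1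

/-- The determinant of the matrix with columns `v` and `u`. -/
def det₂ (v u : Fin 2 → ℤ) : ℤ := v 0 * u 1 - u 0 * v 1

/-- Near `p`, the set `C` is the union of the two distinct lines through `p` that are parallel to
the primitive integral vectors `v` and `u`. -/
def IsNodeWith (C : Set Plane) (p : Plane) (v u : Fin 2 → ℤ) : Prop :=
  IsPrimitive v ∧ IsPrimitive u ∧ det₂ v u ≠ 0 ∧
    ∀ᶠ x in nhds p, (x ∈ C ↔ ∃ t : ℝ, x = p + t • toReal v ∨ x = p + t • toReal u)

/-- `p` is a node of `C`. -/
def IsNode (C : Set Plane) (p : Plane) : Prop := ∃ v u, IsNodeWith C p v u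

/-- A nodal tropical curve: a union of finitely many segments and rays that is, locally at each of
its points, a standard smooth model or a node. -/
def IsNodalTropicalCurve (C : Set Plane) : Prop :=
  (∃ S R : Finset (Plane × Plane),
    C = (⋃ s ∈ S, segment ℝ s.1 s.2) ∪ ⋃ r ∈ R, ray r.1 r.2) ∧
  ∀ p ∈ C, IsSmoothAt C p ∨ IsNode C p

/-- The multiplicity of `C` at `p`: it is `|det (v, u)|` if `p` is a node with directions `v`, `u`
(which are unique up to signs and order, so that the set below has one element), and `0` if `p` is
not a node. -/
noncomputable def nodeMultiplicity (C : Set Plane) (p : Plane) : ℕ :=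
  sSup {m | ∃ v u, IsNodeWith C p v u ∧ m = (det₂ v u).natAbs}

/-- The number of nodes of `C`, counted with multiplicities: the sum of the multiplicities over
all points of the plane, in `ℕ ∪ {∞}`. -/
noncomputable def nodeCount (C : Set Plane) : ℕ∞ :=
  ⨆ s : Finset Plane, ∑ p ∈ s, (nodeMultiplicity C p : ℕ∞)

/-! ### The multiplicity of a node does not depend on the choice of its directions -/

theorem eq_or_neg_of_det {v w : Fin 2 → ℤ} (hv : IsPrimitive v) (hw : IsPrimitive w)
    (h : det₂ v w = 0) : w = v ∨ w = -v := by
  unfold det₂ at h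
  unfold IsPrimitive at hv hw
  have h' : v 0 * w 1 = w 0 * v 1 := by linarith
  have c1 : IsCoprime (v 0) (v 1) := Int.isCoprime_iff_gcd_eq_one.2 hv
  have c2 : IsCoprime (w 0) (w 1) := Int.isCoprime_iff_gcd_eq_one.2 hw
  obtain ⟨k, hk⟩ : v 0 ∣ w 0 := c1.dvd_of_dvd_mul_right ⟨w 1, h'.symm⟩
  obtain ⟨a, b, hab⟩ := c1
  have e0 : w 0 = (a * w 0 + b * w 1) * v 0 := by
    have : w 0 * (a * v 0 + b * v 1) = w 0 := by rw [hab, mul_one]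
    linear_combination (-1) * this - b * h'
  have e1 : w 1 = (a * w 0 + b * w 1) * v 1 := by
    have : w 1 * (a * v 0 + b * v 1) = w 1 := by rw [hab, mul_one]
    linear_combination (-1) * this + a * h'
  set m := a * w 0 + b * w 1
  have hm : IsUnit m := by
    obtain ⟨x, y, hxy⟩ := c2
    refine IsUnit.of_mul_eq_one (x * v 0 + y * v 1) ?_
    rw [e0, e1] at hxy
    linarith
  rcases Int.isUnit_iff.1 hm with h1 | h1
  · left; funext i; fin_cases i
    · simpa [h1] using e0
    · simpa [h1] using e1
  · right; funext i; fin_cases i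
    · simpa [h1] using e0
    · simpa [h1] using e1

theorem det_zero_of_smul {v w : Fin 2 → ℤ} {s t : ℝ} (hs : s ≠ 0)
    (h : s • toReal w = t • toReal v) : det₂ v w = 0 := by
  have h0 := congrFun h 0
  have h1 := congrFun h 1
  simp only [toReal, Pi.smul_apply, smul_eq_mul] at h0 h1
  have : s * ((v 0 : ℝ) * w 1 - w 0 * v 1) = 0 := by
    linear_combination (v 0 : ℝ) * h1 - (v 1 : ℝ) * h0
  have := (mul_eq_zero.1 this).resolve_left hs
  unfold det₂
  exact_mod_cast this

theorem IsNodeWith.direction {C : Set Plane} {p : Plane} {v u v' u' : Fin 2 → ℤ}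
    (h : IsNodeWith C p v u) (h' : IsNodeWith C p v' u') :
    (v' = v ∨ v' = -v) ∨ (v' = u ∨ v' = -u) := by
  obtain ⟨hv, hu, -, hC⟩ := h
  obtain ⟨hv', -, -, hC'⟩ := h'
  have hev := hC.and hC'
  have hlim : Filter.Tendsto (fun s : ℝ => p + s • toReal v') (nhdsWithin 0 (Set.Ioi 0))
      (nhds p) := by
    have : Continuous fun s : ℝ => p + s • toReal v' := by fun_prop
    have h := this.tendsto 0
    simp only [zero_smul, add_zero] at h
    exact h.mono_left nhdsWithin_le_nhds
  obtain ⟨s, ⟨hs1, hs2⟩, hs⟩ :=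
    ((hlim.eventually hev).and self_mem_nhdsWithin).exists
  obtain ⟨t, ht | ht⟩ := hs1.1 (hs2.2 ⟨s, Or.inl rfl⟩)
  · exact Or.inl (eq_or_neg_of_det hv hv' (det_zero_of_smul hs.ne' (add_left_cancel ht)))
  · exact Or.inr (eq_or_neg_of_det hu hv' (det_zero_of_smul hs.ne' (add_left_cancel ht)))

theorem IsNodeWith.swap {C : Set Plane} {p : Plane} {v u : Fin 2 → ℤ}
    (h : IsNodeWith C p v u) : IsNodeWith C p u v := by
  obtain ⟨hv, hu, hd, hC⟩ := h
  refine ⟨hu, hv, fun h => hd ?_, ?_⟩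
  · unfold det₂ at *; linarith
  · filter_upwards [hC] with x hx
    rw [hx]
    exact exists_congr fun t => or_comm

/-- The multiplicity of a node is `|det (v, u)|`, where `v` and `u` are its directions. -/
theorem IsNodeWith.nodeMultiplicity_eq {C : Set Plane} {p : Plane} {v u : Fin 2 → ℤ}
    (h : IsNodeWith C p v u) : nodeMultiplicity C p = (det₂ v u).natAbs := by
  have : {m | ∃ v u, IsNodeWith C p v u ∧ m = (det₂ v u).natAbs} = {(det₂ v u).natAbs} := by
    ext m
    constructor
    · rintro ⟨v', u', h', rfl⟩
      have a := h.direction h'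
      have b := h.direction h'.swap
      have hd := h'.2.2.1
      rcases a with (rfl | rfl) | (rfl | rfl) <;> rcases b with (rfl | rfl) | (rfl | rfl) <;>
        simp only [det₂, Pi.neg_apply, Set.mem_singleton_iff] at hd ⊢ <;>
        first
          | (exfalso; apply hd; ring1)
          | rw [Int.natAbs_eq_natAbs_iff]
      all_goals first
        | (left; ring1)
        | (right; ring1)
    · rintro rfl
      exact ⟨v, u, h, rfl⟩
  rw [nodeMultiplicity, this, csSup_singleton]

theorem nodeMultiplicity_eq_zero {C : Set Plane} {p : Plane} (h : ¬ IsNode C p) :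
    nodeMultiplicity C p = 0 := by
  have : {m | ∃ v u, IsNodeWith C p v u ∧ m = (det₂ v u).natAbs} = ∅ := by
    ext m
    rw [Set.mem_empty_iff_false, iff_false]
    rintro ⟨v, u, h', -⟩
    exact h ⟨v, u, h'⟩
  rw [nodeMultiplicity, this, csSup_empty, bot_eq_zero']


/-! ### Resolution of the nodes, immersions and the crossing number -/

/-- A map of an abstract tropical curve (without its infinite vertices) to the plane that sends
every edge to a segment or a ray in a primitive integral direction, the length of a segment being
its lattice length. Every edge is parametrized from a finite endpoint `base e`. -/
structure PlaneMap (Γ : TropicalCurve) where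
  /-- the position of a vertex, of no importance if the vertex is infinite -/
  pos : Γ.V → Plane
  base : Γ.E → Γ.V
  tip : Γ.E → Γ.V
  dir : Γ.E → Fin 2 → ℤ
  ends_eq : ∀ e, Γ.ends e = s(base e, tip e)
  base_finite : ∀ e, ¬ Γ.IsInfinite (base e)
  primitive : ∀ e, IsPrimitive (dir e)
  pos_tip : ∀ e, Γ.length e ≠ ⊤ →
    pos (tip e) = pos (base e) + (Γ.length e).toReal • toReal (dir e)

/-- The points of an abstract tropical curve, without its infinite vertices: the finite vertices
and the interior points of the edges, given by their distance `t` from the endpoint at which the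
parametrization of the edge starts. -/
inductive TropicalCurve.Point (Γ : TropicalCurve) : Type
  | vertex (v : Γ.V) (hv : ¬ Γ.IsInfinite v)
  | edge (e : Γ.E) (t : ℝ) (ht : 0 < t) (hte : ENNReal.ofReal t < Γ.length e)

/-- The image of a point of the curve in the plane. -/
noncomputable def PlaneMap.image {Γ : TropicalCurve} (φ : PlaneMap Γ) : Γ.Point → Plane
  | .vertex v _ => φ.pos v
  | .edge e t _ _ => φ.pos (φ.base e) + t • toReal (φ.dir e)

/-- All edges of the curve at the point `x` are mapped to lines parallel to `v`. -/
def PlaneMap.ParallelAt {Γ : TropicalCurve} (φ : PlaneMap Γ) (v : Fin 2 → ℤ) : Γ.Point → Prop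
  | .vertex w _ => ∀ e, w ∈ Γ.ends e → φ.dir e = v ∨ φ.dir e = -v
  | .edge e _ _ _ => φ.dir e = v ∨ φ.dir e = -v

/-- `φ` presents `Γ` as the abstract tropical curve of the nodal tropical curve `C`: the map `φ`
is onto `C`, it is injective away from the nodes, and over a node there are exactly two points
of `Γ`, one for each of the two lines of the node. (The points over a node may be vertices
of degree two or interior points of edges; this makes no difference up to subdivision.) -/
structure IsResolution (C : Set Plane) {Γ : TropicalCurve} (φ : PlaneMap Γ) : Prop where
  range_image : Set.range φ.image = C
  eq_or_isNode : ∀ x y, φ.image x = φ.image y → x = y ∨ IsNode C (φ.image x)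
  node : ∀ p v u, IsNodeWith C p v u → ∃ x y, x ≠ y ∧ φ.image ⁻¹' {p} = {x, y} ∧
    φ.ParallelAt v x ∧ φ.ParallelAt u y

/-- `C` is an immersion of `Γ`: a nodal tropical curve whose abstract tropical curve is isometric
to a tropical modification of `Γ`. -/
def IsImmersion (Γ : TropicalCurve) (C : Set Plane) : Prop :=
  IsNodalTropicalCurve C ∧
    ∃ Γ', IsModification Γ Γ' ∧ ∃ φ : PlaneMap Γ', IsResolution C φ

/-- The tropical crossing number: the least number of nodes, counted with multiplicities, of an
immersion in the plane (`∞` if there is no immersion). -/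
noncomputable def crossingNumber (Γ : TropicalCurve) : ℕ∞ :=
  ⨅ (C : Set Plane) (_ : IsImmersion Γ C), nodeCount C

/-! ### Sun curves -/

/-- `Γ` is a sun curve with `n` rays: its underlying graph is a cycle with vertices
`c (inl i)`, `i ∈ ℤ/n`, and at each vertex `c (inl i)` of the cycle an edge `d (inr i)` of infinite
length is attached, whose other endpoint is `c (inr i)`. The lengths of the edges `d (inl i)` of the
cycle are arbitrary. -/
def IsSun (n : ℕ) (Γ : TropicalCurve) : Prop :=
  ∃ (c : ZMod n ⊕ ZMod n ≃ Γ.V) (d : ZMod n ⊕ ZMod n ≃ Γ.E), ∀ i : ZMod n,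
    Γ.ends (d (.inl i)) = s(c (.inl i), c (.inl (i + 1))) ∧
    Γ.ends (d (.inr i)) = s(c (.inl i), c (.inr i)) ∧
    Γ.length (d (.inr i)) = ⊤

end Tropical

namespace Tropical
open Filter Topology

/-! ### Integral vectors -/

/-! Lower bound. Let `C` be an immersion with `r ≥ n` rays. The ray directions are primitive and sum
to zero; turned by a right angle they are the unit steps along the boundary of a lattice polygon
with `r` boundary lattice points. The curve is dual to a subdivision of this polygon in which a
trivalent point gives a triangle of area 1/2 and a node a parallelogram whose area is its
multiplicity. In genus one there are as many trivalent points as rays (`IsResolution.card_tri`), so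
twice the area of the polygon is `W = r + 2δ`, where `δ` counts the nodes
(`IsResolution.rayArea_add`). By Pick's formula there are `δ + 1` interior lattice points, and `r ≤
2δ + 8` is Scott's inequality. Its only exception, a triangle with nine boundary points and one
interior point, is excluded by `n > 9`. Passing to a modification keeps the number of edges equal to
the number of vertices and never loses a ray (`IsModification.card`), which is all the argument
needs.

Neither the polygon nor its subdivision is constructed. A line parallel to a generic `l` sweeps the
plane, and `PlaneMap.sweep` adds up the determinants of the pairs of edges it crosses, signed by
their order on the line. By balancing this sum jumps only at trivalent points and nodes, by an
amount depending on the point alone, while far away it depends only on the rays. Comparing the two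
ends gives the area formula `PlaneMap.sum_jump`. Scott's inequality is then proved for balanced
families of primitive vectors (`scott_inequality`), by bounding the area below by trapezoids and
quadrilaterals inscribed along a direction of minimal lattice width.

Sharpness. For `m ≥ 1` a closed polygon shaped like a figure eight crosses itself once, at the
origin, with determinant `m`. Each lobe is a chain of smooth corners with unimodular turns, and from
each corner the third direction leaves as a ray. The lobes can carry `2m + 7` or `2m + 8` corners in
total before rays start to meet. Injectivity away from the node is checked by a function on the
plane that reads off the stratum containing a point (`eightLabel_image`). -/

@[simp] theorem toReal_apply (v : Fin 2 → ℤ) (i : Fin 2) : toReal v i = (v i : ℝ) := rfl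

@[simp] theorem toReal_neg (v : Fin 2 → ℤ) : toReal (-v) = -toReal v := by
  funext i; simp

@[simp] theorem toReal_add (v w : Fin 2 → ℤ) : toReal (v + w) = toReal v + toReal w := by
  funext i; simp

theorem toReal_injective : Function.Injective toReal := fun v w h => by
  funext i
  have := congrFun h i
  simpa using this

theorem IsPrimitive.ne_zero {v : Fin 2 → ℤ} (h : IsPrimitive v) : v ≠ 0 := by
  rintro rfl
  simp [IsPrimitive] at h

theorem IsPrimitive.toReal_ne_zero {v : Fin 2 → ℤ} (h : IsPrimitive v) : toReal v ≠ 0 := fun h0 =>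
  h.ne_zero (toReal_injective (by rw [h0]; funext i; simp))

theorem IsPrimitive.neg {v : Fin 2 → ℤ} (h : IsPrimitive v) : IsPrimitive (-v) := by
  simpa [IsPrimitive] using h

theorem IsPrimitive.ne_neg {v : Fin 2 → ℤ} (h : IsPrimitive v) : v ≠ -v := fun h0 =>
  h.ne_zero (by
    funext i
    have := congrFun h0 i
    simp only [Pi.neg_apply, Pi.zero_apply] at this ⊢
    omega)

theorem isPrimitive_of_det_eq {a b : Fin 2 → ℤ} (h : det₂ a b = 1 ∨ det₂ a b = -1) :
    IsPrimitive a := by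
  rw [IsPrimitive, ← Int.isCoprime_iff_gcd_eq_one]
  unfold det₂ at h
  rcases h with h | h
  · exact ⟨b 1, -b 0, by linarith⟩
  · exact ⟨-b 1, b 0, by linarith⟩

/-- Positively proportional primitive vectors are equal. -/
theorem eq_of_smul_eq {v w : Fin 2 → ℤ} (hv : IsPrimitive v) (hw : IsPrimitive w) {s t : ℝ}
    (hs : 0 < s) (ht : 0 ≤ t) (h : s • toReal v = t • toReal w) : v = w := by
  rcases eq_or_neg_of_det hw hv (det_zero_of_smul hs.ne' h) with h' | h'
  · exact h'
  · subst h'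
    exfalso
    rw [toReal_neg, smul_neg, ← neg_smul] at h
    have := smul_left_injective ℝ hw.toReal_ne_zero h
    linarith

theorem det₂_neg_left (v u : Fin 2 → ℤ) : det₂ (-v) u = -det₂ v u := by
  simp only [det₂, Pi.neg_apply]; ring

theorem det₂_neg_right (v u : Fin 2 → ℤ) : det₂ v (-u) = -det₂ v u := by
  simp only [det₂, Pi.neg_apply]; ring

theorem det₂_swap (v u : Fin 2 → ℤ) : det₂ v u = -det₂ u v := by
  simp only [det₂]; ring

theorem det₂_self (v : Fin 2 → ℤ) : det₂ v v = 0 := by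
  simp only [det₂]; ring

theorem det₂_add_left (v w u : Fin 2 → ℤ) : det₂ (v + w) u = det₂ v u + det₂ w u := by
  simp only [det₂, Pi.add_apply]; ring

theorem det₂_add_right (u v w : Fin 2 → ℤ) : det₂ u (v + w) = det₂ u v + det₂ u w := by
  simp only [det₂, Pi.add_apply]; ring

theorem det₂_sum_right {ι : Type*} (s : Finset ι) (u : Fin 2 → ℤ) (f : ι → Fin 2 → ℤ) :
    det₂ u (∑ i ∈ s, f i) = ∑ i ∈ s, det₂ u (f i) := by
  simp only [det₂, Finset.sum_apply, Finset.mul_sum, Finset.sum_mul, Finset.sum_sub_distrib]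

theorem det₂_sum_left {ι : Type*} (s : Finset ι) (u : Fin 2 → ℤ) (f : ι → Fin 2 → ℤ) :
    det₂ (∑ i ∈ s, f i) u = ∑ i ∈ s, det₂ (f i) u := by
  simp only [det₂, Finset.sum_apply, Finset.mul_sum, Finset.sum_mul, Finset.sum_sub_distrib]

/-! ### Half-edges of a plane map at a point of the plane -/

section
variable {Γ : TropicalCurve} (φ : PlaneMap Γ)

/-- The point with parameter `t` on the line spanned by an edge. -/
noncomputable def PlaneMap.pt (e : Γ.E) (t : ℝ) : Plane := φ.pos (φ.base e) + t • toReal (φ.dir e)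

/-- The image of an edge with its finite endpoints. -/
def PlaneMap.closedEdge (e : Γ.E) : Set Plane :=
  {q | ∃ t, 0 ≤ t ∧ ENNReal.ofReal t ≤ Γ.length e ∧ φ.pt e t = q}

/-- The direction of a half-edge; the half-edge `(e, true)` points from the base to the tip. -/
def PlaneMap.gdir (g : Γ.E × Bool) : Fin 2 → ℤ := if g.2 then φ.dir g.1 else -φ.dir g.1

/-- The edge `g.1` leaves the point `P` in the direction `φ.gdir g`. -/
def PlaneMap.Germ (P : Plane) (g : Γ.E × Bool) : Prop :=
  -- The inequalities are half-open: at the base only the forward half-edge leaves, at a finite tip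
  -- only the backward one, at an interior point both.
  ∃ t, φ.pt g.1 t = P ∧ if g.2 then 0 ≤ t ∧ ENNReal.ofReal t < Γ.length g.1
    else 0 < t ∧ ENNReal.ofReal t ≤ Γ.length g.1

theorem PlaneMap.pt_injective (e : Γ.E) : Function.Injective (φ.pt e) := fun s t h => by
  unfold PlaneMap.pt at h
  exact smul_left_injective ℝ (φ.primitive e).toReal_ne_zero (add_left_cancel h)

theorem PlaneMap.pt_add (e : Γ.E) (s t : ℝ) :
    φ.pt e (s + t) = φ.pt e s + t • toReal (φ.dir e) := by
  simp [PlaneMap.pt, add_smul, add_assoc]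

@[simp] theorem PlaneMap.pt_zero (e : Γ.E) : φ.pt e 0 = φ.pos (φ.base e) := by
  simp [PlaneMap.pt]

theorem PlaneMap.pt_length {e : Γ.E} (h : Γ.length e ≠ ⊤) :
    φ.pt e (Γ.length e).toReal = φ.pos (φ.tip e) := (φ.pos_tip e h).symm

theorem PlaneMap.tip_finite {e : Γ.E} (h : Γ.length e ≠ ⊤) : ¬ Γ.IsInfinite (φ.tip e) := fun h' =>
  h ((Γ.length_eq_top_iff e).2 ⟨_, by rw [φ.ends_eq]; simp, h'⟩)

theorem PlaneMap.tip_infinite {e : Γ.E} (h : Γ.length e = ⊤) : Γ.IsInfinite (φ.tip e) := by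
  obtain ⟨v, hv, hi⟩ := (Γ.length_eq_top_iff e).1 h
  rw [φ.ends_eq, Sym2.mem_iff] at hv
  rcases hv with rfl | rfl
  · exact absurd hi (φ.base_finite e)
  · exact hi

theorem PlaneMap.primitive_gdir (g : Γ.E × Bool) : IsPrimitive (φ.gdir g) := by
  unfold PlaneMap.gdir
  split_ifs
  · exact φ.primitive _
  · exact (φ.primitive _).neg

theorem PlaneMap.isClosed_closedEdge (e : Γ.E) : IsClosed (φ.closedEdge e) := by
  have hc : IsClosed {t : ℝ | 0 ≤ t ∧ ENNReal.ofReal t ≤ Γ.length e} :=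
    (isClosed_le continuous_const continuous_id).inter
      (isClosed_le ENNReal.continuous_ofReal continuous_const)
  have he : IsClosedEmbedding (φ.pt e) := by
    have h1 : IsClosedEmbedding fun t : ℝ => t • toReal (φ.dir e) :=
      isClosedEmbedding_smul_left (φ.primitive e).toReal_ne_zero
    exact (Homeomorph.addLeft (φ.pos (φ.base e))).isClosedEmbedding.comp h1
  convert he.isClosedMap _ hc using 1
  ext q
  simp only [PlaneMap.closedEdge, Set.mem_ofPred_eq, Set.mem_image, and_assoc]

theorem PlaneMap.closedEdge_subset (e : Γ.E) : φ.closedEdge e ⊆ Set.range φ.image := by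
  rintro q ⟨t, ht, hte, rfl⟩
  rcases ht.eq_or_lt with rfl | ht
  · exact ⟨.vertex _ (φ.base_finite e), by simp [PlaneMap.image]⟩
  rcases hte.eq_or_lt with he | hte
  · have hl : Γ.length e ≠ ⊤ := by rw [← he]; exact ENNReal.ofReal_ne_top
    refine ⟨.vertex _ (φ.tip_finite hl), ?_⟩
    rw [PlaneMap.image, ← φ.pt_length hl, ← he, ENNReal.toReal_ofReal ht.le]
  · exact ⟨.edge e t ht hte, rfl⟩

/-- The positions of the vertices are listed separately because a finite vertex without incident
edges lies on no closed edge. -/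
theorem PlaneMap.range_subset : Set.range φ.image ⊆
    (⋃ e, φ.closedEdge e) ∪ ⋃ w : Γ.V, {φ.pos w} := by
  rintro q ⟨x, rfl⟩
  cases x with
  | vertex v hv => exact Or.inr (Set.mem_iUnion.2 ⟨v, rfl⟩)
  | edge e t ht hte => exact Or.inl (Set.mem_iUnion.2 ⟨e, t, ht.le, hte.le, rfl⟩)

variable {φ} in
theorem PlaneMap.Germ.mem_closedEdge {P : Plane} {g : Γ.E × Bool} (h : φ.Germ P g) :
    P ∈ φ.closedEdge g.1 := by
  obtain ⟨t, ht, h⟩ := h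
  split_ifs at h
  · exact ⟨t, h.1, h.2.le, ht⟩
  · exact ⟨t, h.1.le, h.2, ht⟩

variable {φ} in
-- The nearby points are reached at interior parameters of the edge. They are therefore honest
-- points of the curve, to which the injectivity clause of a resolution applies.
theorem PlaneMap.Germ.eventually {P : Plane} {g : Γ.E × Bool} (h : φ.Germ P g) :
    ∃ δ : ℝ, 0 < δ ∧ ∀ s : ℝ, 0 < s → s < δ → ∃ t, 0 < t ∧ ENNReal.ofReal t < Γ.length g.1 ∧
      φ.pt g.1 t = P + s • toReal (φ.gdir g) := by
  obtain ⟨t, ht, h⟩ := h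
  obtain ⟨e, σ⟩ := g
  cases σ
  · simp only [Bool.false_eq_true, if_false] at h ht
    refine ⟨t, h.1, fun s hs hst => ⟨t - s, by linarith, lt_of_lt_of_le ?_ h.2, ?_⟩⟩
    · exact (ENNReal.ofReal_lt_ofReal_iff h.1).2 (by linarith)
    · rw [sub_eq_add_neg, φ.pt_add, ht]
      simp [PlaneMap.gdir]
  · simp only [if_true] at h ht
    have : ∃ δ : ℝ, 0 < δ ∧ ENNReal.ofReal (t + δ) ≤ Γ.length e := by
      rcases eq_or_ne (Γ.length e) ⊤ with hl | hl
      · exact ⟨1, one_pos, by rw [hl]; exact le_top⟩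
      · have h2 : t < (Γ.length e).toReal := (ENNReal.ofReal_lt_iff_lt_toReal h.1 hl).1 h.2
        refine ⟨(Γ.length e).toReal - t, by linarith, ?_⟩
        rw [add_sub_cancel, ENNReal.ofReal_toReal hl]
    obtain ⟨δ, hδ, hl⟩ := this
    refine ⟨δ, hδ, fun s hs hsd => ⟨t + s, by linarith [h.1], lt_of_lt_of_le ?_ hl, ?_⟩⟩
    · exact (ENNReal.ofReal_lt_ofReal_iff (by linarith [h.1])).2 (by linarith)
    · rw [φ.pt_add, ht]
      simp [PlaneMap.gdir]

variable {φ} in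
theorem PlaneMap.Germ.eventually_mem {P : Plane} {g : Γ.E × Bool} (h : φ.Germ P g) :
    ∀ᶠ s in 𝓝[>] (0 : ℝ), P + s • toReal (φ.gdir g) ∈ Set.range φ.image := by
  obtain ⟨δ, hδ, h⟩ := h.eventually
  filter_upwards [Ioo_mem_nhdsGT hδ] with s hs
  obtain ⟨t, ht, hte, he⟩ := h s hs.1 hs.2
  exact ⟨.edge _ t ht hte, he⟩

/-- Two common points determine the direction of a line. Together with the pigeonhole principle
below, this turns "some edge meets the ray arbitrarily close to its origin" into parallelism. -/
theorem frequently_two {p : ℝ → Prop} (h : ∃ᶠ s in 𝓝[>] (0 : ℝ), p s) :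
    ∃ s t, 0 < s ∧ s < t ∧ p s ∧ p t := by
  obtain ⟨t, ht, ht0⟩ := (h.and_eventually self_mem_nhdsWithin).exists
  obtain ⟨s, hs, hs0⟩ := (h.and_eventually (Ioo_mem_nhdsGT ht0)).exists
  exact ⟨s, t, hs0.1, hs0.2, hs, ht⟩

theorem frequently_exists_finite {ι α : Type*} [Finite ι] {f : Filter α} {p : ι → α → Prop}
    (h : ∃ᶠ x in f, ∃ i, p i x) : ∃ i, ∃ᶠ x in f, p i x := by
  by_contra hn
  simp only [not_exists, Filter.not_frequently] at hn
  exact h ((Filter.eventually_all.2 hn).mono fun x hx ⟨i, hi⟩ => hx i hi)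

/-- A direction in which the image leaves `P` is the direction of a half-edge at `P`. -/
theorem PlaneMap.exists_germ {P : Plane} {v : Fin 2 → ℤ} (hv : IsPrimitive v)
    (h : ∃ᶠ s in 𝓝[>] (0 : ℝ), P + s • toReal v ∈ Set.range φ.image) :
    ∃ g, φ.Germ P g ∧ φ.gdir g = v := by
  have := Γ.finiteV
  have := Γ.finiteE
  have h1 : ∃ᶠ s in 𝓝[>] (0 : ℝ), ∃ i : Γ.E ⊕ Γ.V,
      P + s • toReal v ∈ Sum.elim (fun e => φ.closedEdge e) (fun w => {φ.pos w}) i := by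
    refine h.mono fun s hs => ?_
    rcases φ.range_subset hs with h | h
    · obtain ⟨e, he⟩ := Set.mem_iUnion.1 h
      exact ⟨.inl e, he⟩
    · obtain ⟨e, he⟩ := Set.mem_iUnion.1 h
      exact ⟨.inr e, he⟩
  obtain ⟨e | w, h2⟩ := frequently_exists_finite h1
  · simp only [Sum.elim_inl] at h2
    -- A closed edge contains the limit of its points, so `P` itself has a parameter on `e`; the
    -- side on which the nearby parameters lie then decides the orientation of the half-edge.
    have hP : P ∈ φ.closedEdge e := by
      have hlim : Tendsto (fun s : ℝ => P + s • toReal v) (𝓝[>] 0) (𝓝 P) := by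
        have : Continuous fun s : ℝ => P + s • toReal v := by fun_prop
        have h := this.tendsto 0
        simp only [zero_smul, add_zero] at h
        exact h.mono_left nhdsWithin_le_nhds
      exact (φ.isClosed_closedEdge e).mem_of_frequently_of_tendsto h2 hlim
    obtain ⟨t₀, h0, hl, rfl⟩ := hP
    obtain ⟨s, s', hs, -, ⟨t, h0', hl', ht⟩, -⟩ := frequently_two h2
    have hst : s • toReal v = (t - t₀) • toReal (φ.dir e) := by
      have : t = t₀ + (t - t₀) := by ring
      rw [this, φ.pt_add] at ht
      exact (add_left_cancel ht).symm
    rcases le_total t₀ t with hle | hle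
    · have hve := eq_of_smul_eq hv (φ.primitive e) hs (by linarith) hst
      refine ⟨(e, true), ⟨t₀, rfl, ?_⟩, by simp [PlaneMap.gdir, hve]⟩
      rcases hle.eq_or_lt with rfl | hlt
      · simp only [sub_self, zero_smul, smul_eq_zero, hs.ne', hv.toReal_ne_zero, or_self] at hst
      exact ⟨h0, lt_of_lt_of_le ((ENNReal.ofReal_lt_ofReal_iff (by linarith)).2 hlt) hl'⟩
    · have hst' : s • toReal v = (t₀ - t) • toReal (-φ.dir e) := by
        rw [hst, toReal_neg, smul_neg, ← neg_smul, neg_sub]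
      have hve := eq_of_smul_eq hv (φ.primitive e).neg hs (by linarith) hst'
      refine ⟨(e, false), ⟨t₀, rfl, ?_⟩, by simp [PlaneMap.gdir, hve]⟩
      rcases hle.eq_or_lt with rfl | hlt
      · simp only [sub_self, zero_smul, smul_eq_zero, hs.ne', hv.toReal_ne_zero, or_self] at hst
      exact ⟨by linarith, hl⟩
  · simp only [Sum.elim_inr, Set.mem_singleton_iff] at h2
    obtain ⟨s, t, -, hst, h3, h4⟩ := frequently_two h2
    have := smul_left_injective ℝ hv.toReal_ne_zero (add_left_cancel (h3.trans h4.symm))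
    exact absurd this hst.ne

end

/-! ### Local directions of a plane set -/

/-- Near `P`, the set `C` is the union of the rays generated by the vectors of `D`. -/
def LocalCone (C : Set Plane) (P : Plane) (D : Finset (Fin 2 → ℤ)) : Prop :=
  ∀ᶠ x in 𝓝 P, (x ∈ C ↔ ∃ d ∈ D, x ∈ ray P (toReal d))

/-- If `C` is locally a union of rays, these rays are the directions in which `C` leaves `P`. -/
theorem LocalCone.mem_iff {C : Set Plane} {P : Plane} {D : Finset (Fin 2 → ℤ)}
    (h : LocalCone C P D) (hD : ∀ d ∈ D, IsPrimitive d) {v : Fin 2 → ℤ} (hv : IsPrimitive v) :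
    v ∈ D ↔ ∃ᶠ s in 𝓝[>] (0 : ℝ), P + s • toReal v ∈ C := by
  have hlim : Tendsto (fun s : ℝ => P + s • toReal v) (𝓝[>] 0) (𝓝 P) := by
    have : Continuous fun s : ℝ => P + s • toReal v := by fun_prop
    have h := this.tendsto 0
    simp only [zero_smul, add_zero] at h
    exact h.mono_left nhdsWithin_le_nhds
  have hev := hlim.eventually h
  constructor
  · intro hvD
    refine Eventually.frequently ?_
    filter_upwards [hev, self_mem_nhdsWithin] with s hs hs0
    exact hs.2 ⟨v, hvD, s, (Set.mem_Ioi.1 hs0).le, rfl⟩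
  · intro hf
    obtain ⟨s, ⟨hs, hs1⟩, hs0⟩ := ((hf.and_eventually hev).and_eventually self_mem_nhdsWithin).exists
    obtain ⟨d, hd, t, ht, he⟩ := hs1.1 hs
    rwa [eq_of_smul_eq hv (hD d hd) hs0 ht (add_left_cancel he)]

theorem mem_smoothModel_two {y : Plane} :
    y ∈ smoothModel 2 ↔ ∃ t : ℝ, 0 ≤ t ∧ (y = t • ![1, 0] ∨ y = t • ![-1, 0]) := by
  have h1 : (-∑ i : Fin 2 with i.val + 1 < 2, Pi.single i (1 : ℝ) : Plane) = ![-1, 0] := by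
    funext i; fin_cases i <;> simp [Finset.sum_filter]
  have h2 : (Pi.single 0 1 : Plane) = ![1, 0] := by
    funext i; fin_cases i <;> simp
  rw [smoothModel, h1]
  simp only [Set.mem_union, Set.mem_iUnion, Set.mem_ofPred_eq, Fin.exists_fin_two, ray, zero_add, h2]
  constructor
  · rintro ((⟨-, t, ht, rfl⟩ | ⟨h, -⟩) | ⟨t, ht, rfl⟩)
    · exact ⟨t, ht, Or.inl rfl⟩
    · simp at h
    · exact ⟨t, ht, Or.inr rfl⟩
  · rintro ⟨t, ht, rfl | rfl⟩
    · exact Or.inl (Or.inl ⟨by simp, t, ht, rfl⟩)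
    · exact Or.inr ⟨t, ht, rfl⟩

theorem mem_smoothModel_three {y : Plane} : y ∈ smoothModel 3 ↔
    ∃ t : ℝ, 0 ≤ t ∧ (y = t • ![1, 0] ∨ y = t • ![0, 1] ∨ y = t • ![-1, -1]) := by
  have h1 : (-∑ i : Fin 2 with i.val + 1 < 3, Pi.single i (1 : ℝ) : Plane) = ![-1, -1] := by
    funext i; fin_cases i <;> simp [Finset.sum_filter]
  have h2 : (Pi.single 0 1 : Plane) = ![1, 0] := by
    funext i; fin_cases i <;> simp
  have h3 : (Pi.single 1 1 : Plane) = ![0, 1] := by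
    funext i; fin_cases i <;> simp
  rw [smoothModel, h1]
  simp only [Set.mem_union, Set.mem_iUnion, Set.mem_ofPred_eq, Fin.exists_fin_two, ray, zero_add, h2,
    h3]
  constructor
  · rintro ((⟨-, t, ht, rfl⟩ | ⟨-, t, ht, rfl⟩) | ⟨t, ht, rfl⟩)
    · exact ⟨t, ht, Or.inl rfl⟩
    · exact ⟨t, ht, Or.inr (Or.inl rfl)⟩
    · exact ⟨t, ht, Or.inr (Or.inr rfl)⟩
  · rintro ⟨t, ht, rfl | rfl | rfl⟩
    · exact Or.inl (Or.inl ⟨by simp, t, ht, rfl⟩)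
    · exact Or.inl (Or.inr ⟨by simp, t, ht, rfl⟩)
    · exact Or.inr ⟨t, ht, rfl⟩

theorem smoothModel_two_image (A : Matrix (Fin 2) (Fin 2) ℤ) {a : Fin 2 → ℤ}
    (ha : ∀ i, A i 0 = a i) (P x : Plane) :
    (∃ y ∈ smoothModel 2, x = P + (A.map (Int.cast : ℤ → ℝ)).mulVec y) ↔
      ∃ d ∈ ({a, -a} : Finset (Fin 2 → ℤ)), x ∈ ray P (toReal d) := by
  have e1 : ∀ t : ℝ, (A.map (Int.cast : ℤ → ℝ)).mulVec (t • ![1, 0]) = t • toReal a := fun t => by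
    funext i
    simp [Matrix.mulVec, dotProduct, Fin.sum_univ_two, ha, mul_comm]
  have e2 : ∀ t : ℝ, (A.map (Int.cast : ℤ → ℝ)).mulVec (t • ![-1, 0]) = t • toReal (-a) :=
      fun t => by
    funext i
    simp [Matrix.mulVec, dotProduct, Fin.sum_univ_two, ha, mul_comm]
  simp only [mem_smoothModel_two, Finset.mem_insert, Finset.mem_singleton, exists_eq_or_imp,
    exists_eq_left, ray, Set.mem_ofPred_eq]
  constructor
  · rintro ⟨y, ⟨t, ht, rfl | rfl⟩, rfl⟩
    · exact Or.inl ⟨t, ht, by rw [e1]⟩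
    · exact Or.inr ⟨t, ht, by rw [e2]⟩
  · rintro (⟨t, ht, rfl⟩ | ⟨t, ht, rfl⟩)
    · exact ⟨_, ⟨t, ht, Or.inl rfl⟩, by rw [e1]⟩
    · exact ⟨_, ⟨t, ht, Or.inr rfl⟩, by rw [e2]⟩

theorem smoothModel_three_image (A : Matrix (Fin 2) (Fin 2) ℤ) {a b : Fin 2 → ℤ}
    (ha : ∀ i, A i 0 = a i) (hb : ∀ i, A i 1 = b i) (P x : Plane) :
    (∃ y ∈ smoothModel 3, x = P + (A.map (Int.cast : ℤ → ℝ)).mulVec y) ↔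
      ∃ d ∈ ({a, b, -(a + b)} : Finset (Fin 2 → ℤ)), x ∈ ray P (toReal d) := by
  have e1 : ∀ t : ℝ, (A.map (Int.cast : ℤ → ℝ)).mulVec (t • ![1, 0]) = t • toReal a := fun t => by
    funext i
    simp [Matrix.mulVec, dotProduct, Fin.sum_univ_two, ha, mul_comm]
  have e2 : ∀ t : ℝ, (A.map (Int.cast : ℤ → ℝ)).mulVec (t • ![0, 1]) = t • toReal b :=
      fun t => by
    funext i
    simp [Matrix.mulVec, dotProduct, Fin.sum_univ_two, hb, mul_comm]
  have e3 : ∀ t : ℝ, (A.map (Int.cast : ℤ → ℝ)).mulVec (t • ![-1, -1]) = t • toReal (-(a + b)) :=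
      fun t => by
    funext i
    simp [Matrix.mulVec, dotProduct, Fin.sum_univ_two, ha, hb]
    ring
  simp only [mem_smoothModel_three, Finset.mem_insert, Finset.mem_singleton, exists_eq_or_imp,
    exists_eq_left, ray, Set.mem_ofPred_eq]
  constructor
  · rintro ⟨y, ⟨t, ht, rfl | rfl | rfl⟩, rfl⟩
    · exact Or.inl ⟨t, ht, by rw [e1]⟩
    · exact Or.inr (Or.inl ⟨t, ht, by rw [e2]⟩)
    · exact Or.inr (Or.inr ⟨t, ht, by rw [e3]⟩)
  · rintro (⟨t, ht, rfl⟩ | ⟨t, ht, rfl⟩ | ⟨t, ht, rfl⟩)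
    · exact ⟨_, ⟨t, ht, Or.inl rfl⟩, by rw [e1]⟩
    · exact ⟨_, ⟨t, ht, Or.inr (Or.inl rfl)⟩, by rw [e2]⟩
    · exact ⟨_, ⟨t, ht, Or.inr (Or.inr rfl)⟩, by rw [e3]⟩

theorem mem_lines_iff (v u : Fin 2 → ℤ) (P x : Plane) :
    (∃ t : ℝ, x = P + t • toReal v ∨ x = P + t • toReal u) ↔
      ∃ d ∈ ({v, -v, u, -u} : Finset (Fin 2 → ℤ)), x ∈ ray P (toReal d) := by
  simp only [Finset.mem_insert, Finset.mem_singleton, exists_eq_or_imp, exists_eq_left, ray,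
    Set.mem_ofPred_eq, toReal_neg, smul_neg]
  constructor
  · rintro ⟨t, rfl | rfl⟩ <;> rcases le_total 0 t with ht | ht
    · exact Or.inl ⟨t, ht, rfl⟩
    · exact Or.inr (Or.inl ⟨-t, by linarith, by simp⟩)
    · exact Or.inr (Or.inr (Or.inl ⟨t, ht, rfl⟩))
    · exact Or.inr (Or.inr (Or.inr ⟨-t, by linarith, by simp⟩))
  · rintro (⟨t, -, rfl⟩ | ⟨t, -, rfl⟩ | ⟨t, -, rfl⟩ | ⟨t, -, rfl⟩)
    · exact ⟨t, Or.inl rfl⟩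
    · exact ⟨-t, Or.inl (by simp)⟩
    · exact ⟨t, Or.inr rfl⟩
    · exact ⟨-t, Or.inr (by simp)⟩

theorem IsNodeWith.localCone {C : Set Plane} {P : Plane} {v u : Fin 2 → ℤ}
    (h : IsNodeWith C P v u) : LocalCone C P {v, -v, u, -u} := by
  filter_upwards [h.2.2.2] with x hx
  rw [hx, mem_lines_iff]

theorem isNodeWith_of_localCone {C : Set Plane} {P : Plane} {v u : Fin 2 → ℤ} (hv : IsPrimitive v)
    (hu : IsPrimitive u) (hd : det₂ v u ≠ 0) (h : LocalCone C P {v, -v, u, -u}) :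
    IsNodeWith C P v u := by
  refine ⟨hv, hu, hd, ?_⟩
  filter_upwards [h] with x hx
  rw [hx, mem_lines_iff]

theorem IsSmoothAt.localCone {C : Set Plane} {P : Plane} (h : IsSmoothAt C P) :
    (∃ a, IsPrimitive a ∧ LocalCone C P {a, -a}) ∨
      ∃ a b, (det₂ a b = 1 ∨ det₂ a b = -1) ∧ LocalCone C P {a, b, -(a + b)} := by
  obtain ⟨d, A, h2, h3, h⟩ := h
  have hdet : det₂ (fun i => A.val i 0) (fun i => A.val i 1) = A.val.det := by
    rw [Matrix.det_fin_two, det₂]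
  have hu : det₂ (fun i => A.val i 0) (fun i => A.val i 1) = 1 ∨
      det₂ (fun i => A.val i 0) (fun i => A.val i 1) = -1 := by
    rw [hdet]
    exact Int.isUnit_iff.1 ((Matrix.isUnit_iff_isUnit_det _).1 A.isUnit)
  obtain rfl | rfl : d = 2 ∨ d = 3 := by omega
  · refine Or.inl ⟨_, isPrimitive_of_det_eq hu, ?_⟩
    filter_upwards [h] with x hx
    rw [hx, smoothModel_two_image _ fun i => rfl]
  · refine Or.inr ⟨_, _, hu, ?_⟩
    filter_upwards [h] with x hx
    rw [hx, smoothModel_three_image A.val (fun i => rfl) fun i => rfl]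

theorem isSmoothAt_of_localCone_three {C : Set Plane} {P : Plane} {a b : Fin 2 → ℤ}
    (hd : det₂ a b = 1 ∨ det₂ a b = -1) (h : LocalCone C P {a, b, -(a + b)}) :
    IsSmoothAt C P := by
  let M : Matrix (Fin 2) (Fin 2) ℤ := !![a 0, b 0; a 1, b 1]
  have hM : IsUnit M.det := by
    rw [Matrix.det_fin_two, Int.isUnit_iff]
    exact hd
  refine ⟨3, Matrix.GeneralLinearGroup.mk'' M hM, by norm_num, le_rfl, ?_⟩
  filter_upwards [h] with x hx
  rw [hx, ← smoothModel_three_image M (fun i => by fin_cases i <;> rfl)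
    fun i => by fin_cases i <;> rfl]
  rfl

theorem exists_det_eq_one {a : Fin 2 → ℤ} (ha : IsPrimitive a) : ∃ b, det₂ a b = 1 := by
  obtain ⟨x, y, h⟩ := Int.isCoprime_iff_gcd_eq_one.2 ha
  exact ⟨![-y, x], by simp [det₂]; linarith⟩

theorem isSmoothAt_of_localCone_two {C : Set Plane} {P : Plane} {a : Fin 2 → ℤ}
    (ha : IsPrimitive a) (h : LocalCone C P {a, -a}) : IsSmoothAt C P := by
  obtain ⟨b, hb⟩ := exists_det_eq_one ha
  let M : Matrix (Fin 2) (Fin 2) ℤ := !![a 0, b 0; a 1, b 1]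
  have hM : IsUnit M.det := by
    rw [Matrix.det_fin_two, Int.isUnit_iff]
    exact Or.inl hb
  refine ⟨2, Matrix.GeneralLinearGroup.mk'' M hM, le_rfl, by norm_num, ?_⟩
  filter_upwards [h] with x hx
  rw [hx, ← smoothModel_two_image M (fun i => by fin_cases i <;> rfl)]
  rfl

/-! ### The half-edges of a resolution -/

section
variable {C : Set Plane} {Γ : TropicalCurve} {φ : PlaneMap Γ}

/-- Through a node of the image, there passes an edge that is not parallel to a given vector. -/
theorem IsNode.exists_transversal {P : Plane} (h : IsNode (Set.range φ.image) P)
    {v : Fin 2 → ℤ} (hv : IsPrimitive v) : ∃ e, det₂ v (φ.dir e) ≠ 0 ∧ P ∈ φ.closedEdge e := by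
  obtain ⟨a, b, hab⟩ := h
  obtain ⟨x, hx, hxv, hxp⟩ : ∃ x, x ∈ ({a, -a, b, -b} : Finset (Fin 2 → ℤ)) ∧ det₂ v x ≠ 0 ∧
      IsPrimitive x := by
    by_contra! hc
    have h1 : det₂ v a = 0 := by
      by_contra h0
      exact hc a (by simp) h0 hab.1
    have h2 : det₂ v b = 0 := by
      by_contra h0
      exact hc b (by simp) h0 hab.2.1
    rcases eq_or_neg_of_det hv hab.1 h1 with rfl | rfl
    · exact hab.2.2.1 h2
    · exact hab.2.2.1 (by rw [det₂_neg_left, h2, neg_zero])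
  have hprim : ∀ d ∈ ({a, -a, b, -b} : Finset (Fin 2 → ℤ)), IsPrimitive d := by
    simp only [Finset.mem_insert, Finset.mem_singleton]
    rintro d (rfl | rfl | rfl | rfl)
    exacts [hab.1, hab.1.neg, hab.2.1, hab.2.1.neg]
  obtain ⟨g, hg, hgx⟩ := φ.exists_germ hxp ((hab.localCone.mem_iff hprim hxp).1 hx)
  refine ⟨g.1, ?_, hg.mem_closedEdge⟩
  subst hgx
  unfold PlaneMap.gdir at hxv
  split_ifs at hxv
  · exact hxv
  · rw [det₂_neg_right] at hxv
    exact fun h0 => hxv (by rw [h0, neg_zero])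

/-- In a resolution, a half-edge at a point is determined by its direction. -/
theorem IsResolution.germ_unique (h : IsResolution C φ) {P : Plane} {g g' : Γ.E × Bool}
    (hg : φ.Germ P g) (hg' : φ.Germ P g') (he : φ.gdir g = φ.gdir g') : g = g' := by
  have := Γ.finiteE
  by_contra hne
  have hfst : g.1 ≠ g'.1 := by
    intro h1
    obtain ⟨e, σ⟩ := g
    obtain ⟨e', σ'⟩ := g'
    obtain rfl : e = e' := h1
    have := (φ.primitive e).ne_neg
    cases σ <;> cases σ' <;> simp [PlaneMap.gdir] at he hne
    · exact this he.symm
    · exact this he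
  obtain ⟨δ, hδ, h1⟩ := hg.eventually
  obtain ⟨δ', hδ', h2⟩ := hg'.eventually
  have hv := φ.primitive_gdir g
  -- Two different edges leaving in the same direction would overlap along a segment, all of whose
  -- points would be nodes. Each of them would lie on an edge transversal to the segment; as there
  -- are finitely many edges, one of them would meet the segment twice, which is absurd.
  have hnode : ∀ᶠ s in 𝓝[>] (0 : ℝ), ∃ e, det₂ (φ.gdir g) (φ.dir e) ≠ 0 ∧
      P + s • toReal (φ.gdir g) ∈ φ.closedEdge e := by
    filter_upwards [Ioo_mem_nhdsGT (lt_min hδ hδ')] with s hs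
    obtain ⟨t, ht, hte, hp⟩ := h1 s hs.1 (hs.2.trans_le (min_le_left _ _))
    obtain ⟨t', ht', hte', hp'⟩ := h2 s hs.1 (hs.2.trans_le (min_le_right _ _))
    rw [← he, ← hp] at hp'
    rcases h.eq_or_isNode (.edge _ t ht hte) (.edge _ t' ht' hte') hp'.symm with h3 | h3
    · simp only [TropicalCurve.Point.edge.injEq] at h3
      exact absurd h3.1 hfst
    · rw [← h.range_image] at h3
      rw [← hp]
      exact h3.exists_transversal hv
  obtain ⟨e, h3⟩ := frequently_exists_finite hnode.frequently
  obtain ⟨s, s', -, hss, ⟨hd, t, -, -, ht⟩, -, t', -, -, ht'⟩ := frequently_two h3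
  apply hd
  have h4 : (s' - s) • toReal (φ.gdir g) = (t' - t) • toReal (φ.dir e) := by
    have h5 : φ.pt e t' = φ.pt e t + (t' - t) • toReal (φ.dir e) := by
      rw [← φ.pt_add, add_sub_cancel]
    rw [ht, ht', add_assoc, sub_smul] at h5
    have := add_left_cancel h5
    rw [sub_smul, sub_smul, this]; abel
  rw [det₂_swap, det_zero_of_smul (sub_pos.2 hss).ne' h4, neg_zero]

/-- The finite set of half-edges at a point of the plane. -/
noncomputable def PlaneMap.germs (φ : PlaneMap Γ) (P : Plane) : Finset (Γ.E × Bool) :=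
  have := Γ.finiteE
  (Set.toFinite {g | φ.Germ P g}).toFinset

theorem PlaneMap.mem_germs {P : Plane} {g : Γ.E × Bool} : g ∈ φ.germs P ↔ φ.Germ P g := by
  simp [PlaneMap.germs]

theorem IsResolution.gdir_injOn (h : IsResolution C φ) (P : Plane) :
    Set.InjOn φ.gdir (φ.germs P) := fun _ hg _ hg' he =>
  h.germ_unique (PlaneMap.mem_germs.1 hg) (PlaneMap.mem_germs.1 hg') he

theorem IsResolution.image_germs (h : IsResolution C φ) {P : Plane} {D : Finset (Fin 2 → ℤ)}
    (hc : LocalCone C P D) (hD : ∀ d ∈ D, IsPrimitive d) :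
    (φ.germs P).image φ.gdir = D := by
  ext v
  simp only [Finset.mem_image, PlaneMap.mem_germs]
  constructor
  · rintro ⟨g, hg, rfl⟩
    rw [hc.mem_iff hD (φ.primitive_gdir g), ← h.range_image]
    exact hg.eventually_mem.frequently
  · intro hv
    have := (hc.mem_iff hD (hD v hv)).1 hv
    rw [← h.range_image] at this
    exact φ.exists_germ (hD v hv) this

/-- Half-edges at `P` correspond one to one to the local directions of `C`, so counting, balancing
and area at `P` all become sums over an explicit list of vectors. -/
theorem IsResolution.sum_germs (h : IsResolution C φ) {P : Plane} {D : Finset (Fin 2 → ℤ)}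
    (hc : LocalCone C P D) (hD : ∀ d ∈ D, IsPrimitive d) {M : Type*} [AddCommMonoid M]
    (f : (Fin 2 → ℤ) → M) : ∑ g ∈ φ.germs P, f (φ.gdir g) = ∑ d ∈ D, f d := by
  rw [← h.image_germs hc hD, Finset.sum_image (h.gdir_injOn P)]

end

/-! ### The vertices of a resolution -/

/-- `P` is a trivalent point of `C`. -/
def IsTri (C : Set Plane) (P : Plane) : Prop :=
  ∃ a b, (det₂ a b = 1 ∨ det₂ a b = -1) ∧ LocalCone C P {a, b, -(a + b)}

/-- Near `P`, the set `C` is a line. -/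
def IsStraight (C : Set Plane) (P : Plane) : Prop :=
  ∃ a, IsPrimitive a ∧ LocalCone C P {a, -a}

theorem IsNodalTropicalCurve.cases {C : Set Plane} (h : IsNodalTropicalCurve C) {P : Plane}
    (hP : P ∈ C) : IsStraight C P ∨ IsTri C P ∨ IsNode C P := by
  rcases h.2 P hP with h | h
  · rcases h.localCone with h | h
    · exact Or.inl h
    · exact Or.inr (Or.inl h)
  · exact Or.inr (Or.inr h)

section sums
variable {M : Type*} [AddCommMonoid M] (f : (Fin 2 → ℤ) → M)

theorem primitive_of_mem_pair {a : Fin 2 → ℤ} (ha : IsPrimitive a) :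
    ∀ d ∈ ({a, -a} : Finset (Fin 2 → ℤ)), IsPrimitive d := by
  simp only [Finset.mem_insert, Finset.mem_singleton]
  rintro d (rfl | rfl)
  exacts [ha, ha.neg]

theorem sum_pair_neg {a : Fin 2 → ℤ} (ha : IsPrimitive a) :
    ∑ d ∈ ({a, -a} : Finset (Fin 2 → ℤ)), f d = f a + f (-a) :=
  Finset.sum_pair ha.ne_neg

theorem primitive_of_mem_triple {a b : Fin 2 → ℤ} (h : det₂ a b = 1 ∨ det₂ a b = -1) :
    ∀ d ∈ ({a, b, -(a + b)} : Finset (Fin 2 → ℤ)), IsPrimitive d := by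
  simp only [Finset.mem_insert, Finset.mem_singleton]
  have h1 := det₂_swap a b
  have h2 : det₂ (-(a + b)) b = -det₂ a b := by
    rw [det₂_neg_left, det₂_add_left, det₂_self, add_zero]
  rintro d (rfl | rfl | rfl)
  · exact isPrimitive_of_det_eq h
  · exact isPrimitive_of_det_eq (b := a) (by omega)
  · exact isPrimitive_of_det_eq (b := b) (by omega)

theorem sum_triple {a b : Fin 2 → ℤ} (h : det₂ a b = 1 ∨ det₂ a b = -1) :
    ∑ d ∈ ({a, b, -(a + b)} : Finset (Fin 2 → ℤ)), f d = f a + f b + f (-(a + b)) := by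
  have h2 : det₂ (-(a + b)) b = -det₂ a b := by
    rw [det₂_neg_left, det₂_add_left, det₂_self, add_zero]
  have h3 : det₂ a (-(a + b)) = -det₂ a b := by
    rw [det₂_neg_right, det₂_add_right, det₂_self, zero_add]
  have n1 : a ≠ b := by
    rintro rfl
    rw [det₂_self] at h
    omega
  have n2 : a ≠ -(a + b) := fun h0 => by
    rw [← h0, det₂_self] at h3
    omega
  have n3 : b ≠ -(a + b) := fun h0 => by
    rw [← h0, det₂_self] at h2
    omega
  rw [Finset.sum_insert
    (by simp only [Finset.mem_insert, Finset.mem_singleton, not_or]; exact ⟨n1, n2⟩),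
    Finset.sum_pair n3, add_assoc]

theorem primitive_of_mem_cross {a b : Fin 2 → ℤ} (ha : IsPrimitive a) (hb : IsPrimitive b) :
    ∀ d ∈ ({a, -a, b, -b} : Finset (Fin 2 → ℤ)), IsPrimitive d := by
  simp only [Finset.mem_insert, Finset.mem_singleton]
  rintro d (rfl | rfl | rfl | rfl)
  exacts [ha, ha.neg, hb, hb.neg]

theorem ne_of_det_ne_zero {a b : Fin 2 → ℤ} (h : det₂ a b ≠ 0) :
    a ≠ b ∧ a ≠ -b ∧ -a ≠ b ∧ -a ≠ -b := by
  refine ⟨?_, ?_, ?_, ?_⟩ <;> intro h0 <;> apply h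
  · rw [h0, det₂_self]
  · rw [h0, det₂_neg_left, det₂_self, neg_zero]
  · rw [← h0, det₂_neg_right, det₂_self, neg_zero]
  · rw [neg_injective h0, det₂_self]

theorem sum_cross {a b : Fin 2 → ℤ} (ha : IsPrimitive a) (hb : IsPrimitive b) (h : det₂ a b ≠ 0) :
    ∑ d ∈ ({a, -a, b, -b} : Finset (Fin 2 → ℤ)), f d = f a + f (-a) + f b + f (-b) := by
  obtain ⟨h1, h2, h3, h4⟩ := ne_of_det_ne_zero h
  rw [Finset.sum_insert (by simp [h1, h2, ha.ne_neg]), Finset.sum_insert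
    (by simp only [Finset.mem_insert, Finset.mem_singleton, not_or]; exact ⟨h3, h4⟩),
    Finset.sum_pair hb.ne_neg, add_assoc, add_assoc]

end sums

/-! ### Stars of vertices, balancing and counting -/

section
variable {C : Set Plane} {Γ : TropicalCurve} {φ : PlaneMap Γ}

/-- The vertex at which a half-edge starts. -/
def PlaneMap.src (φ : PlaneMap Γ) (g : Γ.E × Bool) : Γ.V := if g.2 then φ.base g.1 else φ.tip g.1

/-- The half-edges that start at a vertex. -/
noncomputable def PlaneMap.halfEdges (φ : PlaneMap Γ) (w : Γ.V) : Finset (Γ.E × Bool) :=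
  have := Γ.finiteE
  (Set.toFinite {g | φ.src g = w}).toFinset

theorem PlaneMap.mem_halfEdges {w : Γ.V} {g : Γ.E × Bool} :
    g ∈ φ.halfEdges w ↔ φ.src g = w := by
  simp [PlaneMap.halfEdges]

theorem PlaneMap.germ_of_src {w : Γ.V} (hw : ¬ Γ.IsInfinite w) {g : Γ.E × Bool}
    (h : φ.src g = w) : φ.Germ (φ.pos w) g := by
  obtain ⟨e, σ⟩ := g
  cases σ <;> simp only [PlaneMap.src, Bool.false_eq_true, if_true, if_false] at h <;> subst h
  · have hl : Γ.length e ≠ ⊤ := fun hl => hw (φ.tip_infinite hl)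
    refine ⟨(Γ.length e).toReal, φ.pt_length hl, ENNReal.toReal_pos (Γ.length_pos e).ne' hl, ?_⟩
    rw [ENNReal.ofReal_toReal hl]
  · exact ⟨0, φ.pt_zero e, le_rfl, by simpa using Γ.length_pos e⟩

theorem PlaneMap.halfEdges_subset_germs {w : Γ.V} (hw : ¬ Γ.IsInfinite w) :
    φ.halfEdges w ⊆ φ.germs (φ.pos w) := fun _ hg =>
  PlaneMap.mem_germs.2 (PlaneMap.germ_of_src hw (PlaneMap.mem_halfEdges.1 hg))

theorem PlaneMap.Germ.cases {P : Plane} {g : Γ.E × Bool} (h : φ.Germ P g) :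
    (∃ w, ¬ Γ.IsInfinite w ∧ φ.pos w = P ∧ φ.src g = w) ∨
      ∃ t ht hte, φ.image (.edge g.1 t ht hte) = P := by
  obtain ⟨e, σ⟩ := g
  obtain ⟨t, hP, h⟩ := h
  cases σ
  · simp only [Bool.false_eq_true, if_false] at h
    rcases h.2.eq_or_lt with hl | hl
    · left
      have hl' : Γ.length e ≠ ⊤ := by rw [← hl]; exact ENNReal.ofReal_ne_top
      refine ⟨_, φ.tip_finite hl', ?_, rfl⟩
      rw [← φ.pt_length hl', ← hl, ENNReal.toReal_ofReal h.1.le, hP]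
    · exact Or.inr ⟨t, h.1, hl, hP⟩
  · simp only [if_true] at h
    rcases h.1.eq_or_lt with rfl | hl
    · exact Or.inl ⟨_, φ.base_finite e, by rw [← hP, φ.pt_zero], rfl⟩
    · exact Or.inr ⟨t, hl, h.2, hP⟩

theorem IsResolution.pos_mem (h : IsResolution C φ) {w : Γ.V} (hw : ¬ Γ.IsInfinite w) :
    φ.pos w ∈ C := by
  rw [← h.range_image]
  exact ⟨.vertex w hw, rfl⟩

/-- Away from the nodes the vertex is the only point of the curve over its image, so no other edge
can pass there. -/
theorem IsResolution.halfEdges_eq_germs (h : IsResolution C φ) {w : Γ.V}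
    (hw : ¬ Γ.IsInfinite w) (hn : ¬ IsNode C (φ.pos w)) :
    φ.halfEdges w = φ.germs (φ.pos w) := by
  refine (PlaneMap.halfEdges_subset_germs hw).antisymm fun g hg => ?_
  rcases (PlaneMap.mem_germs.1 hg).cases with ⟨w', hw', hp, hs⟩ | ⟨t, ht, hte, hp⟩
  · rcases h.eq_or_isNode (.vertex w' hw') (.vertex w hw) hp with h1 | h1
    · rw [PlaneMap.mem_halfEdges, hs]
      simpa using h1
    · exact absurd (hp ▸ h1) hn
  · rcases h.eq_or_isNode (.vertex w hw) (.edge _ t ht hte) hp.symm with h1 | h1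
    · simp at h1
    · exact absurd h1 hn

/-- The number of half-edges is 2 at a straight point, 3 at a trivalent point and 4 at a node. This
separates trivalent points from the other two types without comparing the local models. -/
theorem IsResolution.card_germs (h : IsResolution C φ) {P : Plane} {D : Finset (Fin 2 → ℤ)}
    (hc : LocalCone C P D) (hD : ∀ d ∈ D, IsPrimitive d) : (φ.germs P).card = D.card := by
  rw [Finset.card_eq_sum_ones, Finset.card_eq_sum_ones]
  exact h.sum_germs hc hD fun _ => 1

theorem IsResolution.card_germs_of_isTri (h : IsResolution C φ) {P : Plane} (hP : IsTri C P) :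
    (φ.germs P).card = 3 := by
  obtain ⟨a, b, hab, hc⟩ := hP
  rw [h.card_germs hc (primitive_of_mem_triple hab), Finset.card_eq_sum_ones, sum_triple _ hab]

theorem IsResolution.card_germs_of_isStraight (h : IsResolution C φ) {P : Plane}
    (hP : IsStraight C P) : (φ.germs P).card = 2 := by
  obtain ⟨a, ha, hc⟩ := hP
  rw [h.card_germs hc (primitive_of_mem_pair ha), Finset.card_eq_sum_ones, sum_pair_neg _ ha]

theorem IsResolution.card_germs_of_isNode (h : IsResolution C φ) {P : Plane}
    (hP : IsNode C P) : (φ.germs P).card = 4 := by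
  obtain ⟨a, b, hab⟩ := hP
  rw [h.card_germs hab.localCone (primitive_of_mem_cross hab.1 hab.2.1), Finset.card_eq_sum_ones,
    sum_cross _ hab.1 hab.2.1 hab.2.2.1]

theorem IsResolution.not_isTri_of_isNode (h : IsResolution C φ) {P : Plane} (hP : IsNode C P) :
    ¬ IsTri C P := fun h' => by
  have h1 := h.card_germs_of_isNode hP
  have h2 := h.card_germs_of_isTri h'
  omega

theorem IsResolution.not_isTri_of_isStraight (h : IsResolution C φ) {P : Plane}
    (hP : IsStraight C P) : ¬ IsTri C P := fun h' => by
  have h1 := h.card_germs_of_isStraight hP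
  have h2 := h.card_germs_of_isTri h'
  omega

theorem PlaneMap.src_mem_ends (φ : PlaneMap Γ) (g : Γ.E × Bool) : φ.src g ∈ Γ.ends g.1 := by
  rw [φ.ends_eq, PlaneMap.src]
  split_ifs <;> simp

theorem PlaneMap.gdir_eq_or (φ : PlaneMap Γ) {g : Γ.E × Bool} {v : Fin 2 → ℤ}
    (h : φ.dir g.1 = v ∨ φ.dir g.1 = -v) : φ.gdir g = v ∨ φ.gdir g = -v := by
  unfold PlaneMap.gdir
  split_ifs
  · exact h
  · rcases h with h | h <;> simp [h]

/-- The node has four local directions. Those parallel to `v` cannot come from `y`, whose edges are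
all parallel to `u`, so they start at `w`, the only other point of the fibre. -/
theorem IsNodeWith.image_halfEdges (h : IsResolution C φ) {w : Γ.V} (hw : ¬ Γ.IsInfinite w)
    {v u : Fin 2 → ℤ} (hn : IsNodeWith C (φ.pos w) v u) {y : Γ.Point}
    (hf : φ.image ⁻¹' {φ.pos w} = {.vertex w hw, y}) (hv : φ.ParallelAt v (.vertex w hw))
    (hy : φ.ParallelAt u y) : (φ.halfEdges w).image φ.gdir = {v, -v} := by
  have himg := h.image_germs hn.localCone (primitive_of_mem_cross hn.1 hn.2.1)
  obtain ⟨n1, n2, n3, n4⟩ := ne_of_det_ne_zero hn.2.2.1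
  ext d
  constructor
  · intro hd
    obtain ⟨g, hg, rfl⟩ := Finset.mem_image.1 hd
    rw [PlaneMap.mem_halfEdges] at hg
    have := φ.gdir_eq_or (hv g.1 (hg ▸ φ.src_mem_ends g))
    simpa using this
  · intro hd
    have hd' : d ∈ ({v, -v, u, -u} : Finset (Fin 2 → ℤ)) := by
      simp only [Finset.mem_insert, Finset.mem_singleton] at hd ⊢
      tauto
    rw [← himg] at hd'
    obtain ⟨g, hg, rfl⟩ := Finset.mem_image.1 hd'
    refine Finset.mem_image.2 ⟨g, ?_, rfl⟩
    have hnot : ¬ (φ.dir g.1 = u ∨ φ.dir g.1 = -u) := fun h0 => by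
      have h1 := φ.gdir_eq_or h0
      simp only [Finset.mem_insert, Finset.mem_singleton] at hd
      rcases hd with hd | hd <;> rw [hd] at h1 <;> tauto
    rcases (PlaneMap.mem_germs.1 hg).cases with ⟨w', hw', hp, hs⟩ | ⟨t, ht, hte, hp⟩
    · have hm : TropicalCurve.Point.vertex w' hw' ∈ φ.image ⁻¹' {φ.pos w} := hp
      rw [hf] at hm
      rcases hm with hm | hm
      · rw [PlaneMap.mem_halfEdges, hs]
        simpa using hm
      · rw [Set.mem_singleton_iff] at hm
        subst hm
        exact absurd (hy g.1 (hs ▸ φ.src_mem_ends g)) hnot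
    · have hm : TropicalCurve.Point.edge g.1 t ht hte ∈ φ.image ⁻¹' {φ.pos w} := hp
      rw [hf] at hm
      rcases hm with hm | hm
      · simp at hm
      · rw [Set.mem_singleton_iff] at hm
        subst hm
        exact absurd hy hnot

/-- The star of a finite vertex in a resolution of a nodal tropical curve. -/
theorem IsResolution.vertex_cases (hC : IsNodalTropicalCurve C) (h : IsResolution C φ) {w : Γ.V}
    (hw : ¬ Γ.IsInfinite w) :
    (¬ IsTri C (φ.pos w) ∧ ∃ a, IsPrimitive a ∧ (φ.halfEdges w).image φ.gdir = {a, -a}) ∨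
      (IsTri C (φ.pos w) ∧ ∃ a b, (det₂ a b = 1 ∨ det₂ a b = -1) ∧
        (φ.halfEdges w).image φ.gdir = {a, b, -(a + b)}) := by
  by_cases hn : IsNode C (φ.pos w)
  · refine Or.inl ⟨h.not_isTri_of_isNode hn, ?_⟩
    obtain ⟨v, u, hvu⟩ := hn
    obtain ⟨x, y, -, hf, hx, hy⟩ := h.node _ v u hvu
    have hm : TropicalCurve.Point.vertex w hw ∈ φ.image ⁻¹' {φ.pos w} := rfl
    rw [hf] at hm
    rcases hm with hm | hm
    · subst hm
      exact ⟨v, hvu.1, hvu.image_halfEdges h hw hf hx hy⟩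
    · rw [Set.mem_singleton_iff] at hm
      subst hm
      rw [Set.pair_comm] at hf
      exact ⟨u, hvu.2.1, hvu.swap.image_halfEdges h hw hf hy hx⟩
  · rw [h.halfEdges_eq_germs hw hn]
    rcases hC.cases (h.pos_mem hw) with h1 | h1 | h1
    · refine Or.inl ⟨h.not_isTri_of_isStraight h1, ?_⟩
      obtain ⟨a, ha, hc⟩ := h1
      exact ⟨a, ha, h.image_germs hc (primitive_of_mem_pair ha)⟩
    · refine Or.inr ⟨h1, ?_⟩
      obtain ⟨a, b, hab, hc⟩ := h1
      exact ⟨a, b, hab, h.image_germs hc (primitive_of_mem_triple hab)⟩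
    · exact absurd h1 hn

theorem IsResolution.gdir_injOn_halfEdges (h : IsResolution C φ) {w : Γ.V}
    (hw : ¬ Γ.IsInfinite w) : Set.InjOn φ.gdir (φ.halfEdges w) :=
  (h.gdir_injOn (φ.pos w)).mono (PlaneMap.halfEdges_subset_germs hw)

open Classical in
theorem IsResolution.card_halfEdges (hC : IsNodalTropicalCurve C) (h : IsResolution C φ) {w : Γ.V}
    (hw : ¬ Γ.IsInfinite w) :
    (φ.halfEdges w).card = 2 + if IsTri C (φ.pos w) then 1 else 0 := by
  rw [← Finset.card_image_of_injOn (h.gdir_injOn_halfEdges hw), Finset.card_eq_sum_ones]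
  rcases h.vertex_cases hC hw with ⟨h1, a, ha, he⟩ | ⟨h1, a, b, hab, he⟩
  · rw [he, sum_pair_neg _ ha, if_neg h1]
  · rw [he, sum_triple _ hab, if_pos h1]

/-- The balancing condition. -/
theorem IsResolution.sum_halfEdges (hC : IsNodalTropicalCurve C) (h : IsResolution C φ) {w : Γ.V}
    (hw : ¬ Γ.IsInfinite w) : ∑ g ∈ φ.halfEdges w, φ.gdir g = 0 := by
  rw [← Finset.sum_image (f := fun d => d) (h.gdir_injOn_halfEdges hw)]
  rcases h.vertex_cases hC hw with ⟨h1, a, ha, he⟩ | ⟨h1, a, b, hab, he⟩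
  · rw [he, sum_pair_neg _ ha, add_neg_cancel]
  · rw [he, sum_triple _ hab, add_neg_cancel]

theorem PlaneMap.card_halfEdges_infinite (φ : PlaneMap Γ) {w : Γ.V} (hw : Γ.IsInfinite w) :
    (φ.halfEdges w).card = 1 := by
  have := Γ.finiteE
  have h1 := Γ.infinite_degree w hw
  have hb : ∀ e, φ.base e ≠ w := fun e he => φ.base_finite e (he ▸ hw)
  have h2 : {e : Γ.E | Γ.ends e = s(w, w)} = ∅ := by
    ext e
    simp only [Set.mem_ofPred_eq, Set.mem_empty_iff_false, iff_false, φ.ends_eq]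
    intro h0
    have : φ.base e ∈ s(w, w) := h0 ▸ Sym2.mem_mk_left _ _
    simp only [Sym2.mem_iff, or_self] at this
    exact hb e this
  rw [Multigraph.degree, h2, Set.ncard_empty, add_zero] at h1
  have h3 : (φ.halfEdges w : Set (Γ.E × Bool)) = (fun e => (e, false)) '' {e | w ∈ Γ.ends e} := by
    ext ⟨e, σ⟩
    simp only [Finset.mem_coe, PlaneMap.mem_halfEdges, PlaneMap.src, Set.mem_image,
      Set.mem_ofPred_eq, Prod.mk.injEq, φ.ends_eq, Sym2.mem_iff]
    constructor
    · cases σ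
      · exact fun h0 => ⟨e, Or.inr h0.symm, rfl, rfl⟩
      · exact fun h0 => absurd h0 (hb e)
    · rintro ⟨e', h0 | h0, rfl, rfl⟩
      · exact absurd h0.symm (hb _)
      · exact h0.symm
  rw [← Set.ncard_coe_finset, h3, Set.ncard_image_of_injective _ fun a b hab => by simpa using hab,
    h1]

/-- Otherwise all half-edges at `P` would leave from one and the same interior point of an edge, and
there would be at most two of them instead of three. -/
theorem IsResolution.exists_vertex_of_isTri (h : IsResolution C φ)
    {P : Plane} (hP : IsTri C P) : ∃ w, ¬ Γ.IsInfinite w ∧ φ.pos w = P := by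
  classical
  by_contra! hno
  have hn : ¬ IsNode C P := fun hn => h.not_isTri_of_isNode hn hP
  have hcard := h.card_germs_of_isTri hP
  have hall : ∀ g ∈ φ.germs P, ∃ t ht hte, φ.image (.edge g.1 t ht hte) = P := fun g hg => by
    rcases (PlaneMap.mem_germs.1 hg).cases with ⟨w, hw, hp, -⟩ | h1
    · exact absurd hp (hno w hw)
    · exact h1
  obtain ⟨g₀, hg₀⟩ : (φ.germs P).Nonempty := Finset.card_pos.1 (by omega)
  obtain ⟨t₀, ht₀, hte₀, hp₀⟩ := hall g₀ hg₀
  have hsub : φ.germs P ⊆ {(g₀.1, true), (g₀.1, false)} := fun g hg => by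
    obtain ⟨t, ht, hte, hp⟩ := hall g hg
    rcases h.eq_or_isNode _ _ (hp.trans hp₀.symm) with h1 | h1
    · simp only [TropicalCurve.Point.edge.injEq] at h1
      obtain ⟨e, σ⟩ := g
      obtain rfl : e = g₀.1 := h1.1
      cases σ <;> simp
    · exact absurd (hp ▸ h1) hn
  have := (Finset.card_le_card hsub).trans Finset.card_le_two
  omega

variable [Fintype Γ.E] [Fintype Γ.V]

theorem PlaneMap.sum_eq_sum_halfEdges (φ : PlaneMap Γ) {M : Type*} [AddCommMonoid M]
    (f : Γ.E × Bool → M) : ∑ g, f g = ∑ w, ∑ g ∈ φ.halfEdges w, f g := by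
  classical
  rw [← Finset.sum_fiberwise Finset.univ φ.src f]
  refine Finset.sum_congr rfl fun w _ => Finset.sum_congr ?_ fun _ _ => rfl
  ext g
  simp [PlaneMap.mem_halfEdges]

open Classical in
theorem PlaneMap.sum_infinite (φ : PlaneMap Γ) {M : Type*} [AddCommMonoid M]
    (f : Γ.E × Bool → M) :
    ∑ w with Γ.IsInfinite w, ∑ g ∈ φ.halfEdges w, f g =
      ∑ e with Γ.length e = ⊤, f (e, false) := by
  have h1 : ∀ w, φ.halfEdges w = Finset.univ.filter (φ.src · = w) := fun w => by
    ext g; simp [PlaneMap.mem_halfEdges]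
  simp_rw [h1]
  have h2 : ∀ w ∈ Finset.univ.filter (Γ.IsInfinite ·), ∑ g with φ.src g = w, f g =
      ∑ g ∈ (Finset.univ.filter fun g => Γ.IsInfinite (φ.src g)) with φ.src g = w, f g := by
    intro w hw
    refine Finset.sum_congr ?_ fun _ _ => rfl
    ext g
    simp only [Finset.mem_filter, Finset.mem_univ, true_and] at hw ⊢
    exact ⟨fun h => ⟨h ▸ hw, h⟩, fun h => h.2⟩
  rw [Finset.sum_congr rfl h2, Finset.sum_fiberwise_of_maps_to (g := φ.src) (fun g hg => by simpa using hg)]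
  refine (Finset.sum_bij (fun e _ => (e, false)) ?_ ?_ ?_ fun _ _ => rfl).symm
  · intro e he
    simp only [Finset.mem_filter, Finset.mem_univ, true_and] at he ⊢
    exact φ.tip_infinite he
  · intro e _ e' _ h
    simpa using h
  · rintro ⟨e, σ⟩ hg
    simp only [Finset.mem_filter, Finset.mem_univ, true_and] at hg
    cases σ
    · refine ⟨e, ?_, rfl⟩
      simp only [Finset.mem_filter, Finset.mem_univ, true_and]
      by_contra hl
      exact φ.tip_finite hl hg
    · exact absurd hg (φ.base_finite e)

open Classical in
theorem PlaneMap.card_infinite_edges (φ : PlaneMap Γ) :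
    (Finset.univ.filter fun e => Γ.length e = ⊤).card =
      (Finset.univ.filter fun w => Γ.IsInfinite w).card := by
  rw [Finset.card_eq_sum_ones, Finset.card_eq_sum_ones, ← φ.sum_infinite fun _ => 1]
  refine Finset.sum_congr rfl fun w hw => ?_
  rw [← Finset.card_eq_sum_ones, φ.card_halfEdges_infinite (by simpa using hw)]

-- Global balancing: the two orientations of every edge cancel, finite vertices contribute zero, and
-- what remains is the sum over the reversed rays.
open Classical in
theorem IsResolution.sum_rays (hC : IsNodalTropicalCurve C) (h : IsResolution C φ) :
    ∑ e with Γ.length e = ⊤, φ.dir e = 0 := by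
  have h1 := φ.sum_eq_sum_halfEdges φ.gdir
  rw [← Finset.sum_filter_add_sum_filter_not Finset.univ (fun w => Γ.IsInfinite w),
    φ.sum_infinite, Finset.sum_eq_zero (s := Finset.univ.filter fun w => ¬ Γ.IsInfinite w)
    fun w hw => h.sum_halfEdges hC (by simpa using hw), Fintype.sum_prod_type] at h1
  simpa [PlaneMap.gdir] using h1.symm

open Classical in
/-- In genus one, there are as many trivalent vertices as rays. -/
theorem IsResolution.card_tri (hC : IsNodalTropicalCurve C) (h : IsResolution C φ)
    (hEV : Fintype.card Γ.E = Fintype.card Γ.V) :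
    (Finset.univ.filter fun w => ¬ Γ.IsInfinite w ∧ IsTri C (φ.pos w)).card =
      (Finset.univ.filter fun w => Γ.IsInfinite w).card := by
  -- Counting half-edges by their starting vertices gives `2|E| = r + 2(|V| - r) + T` with `r`
  -- infinite and `T` trivalent vertices; for `|E| = |V|` this says `T = r`.
  have h1 := φ.sum_eq_sum_halfEdges fun _ => 1
  simp_rw [← Finset.card_eq_sum_ones] at h1
  rw [← Finset.sum_filter_add_sum_filter_not Finset.univ (fun w => Γ.IsInfinite w),
    Finset.sum_congr rfl fun w hw => φ.card_halfEdges_infinite (by simpa using hw),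
    Finset.sum_congr (s₁ := Finset.univ.filter fun w => ¬ Γ.IsInfinite w) rfl
    fun w hw => h.card_halfEdges hC (by simpa using hw), Finset.sum_add_distrib,
    ← Finset.sum_filter, Finset.filter_filter, ← Finset.card_eq_sum_ones,
    ← Finset.card_eq_sum_ones, Finset.sum_const, smul_eq_mul, Finset.card_univ,
    Fintype.card_prod, Fintype.card_bool, hEV] at h1
  have h2 := Finset.card_filter_add_card_filter_not (s := (Finset.univ : Finset Γ.V))
    (fun w => Γ.IsInfinite w)
  rw [Finset.card_univ] at h2
  omega

open Classical in
/-- The trivalent points are as many as the rays. -/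
theorem IsResolution.exists_tri_finset (hC : IsNodalTropicalCurve C) (h : IsResolution C φ)
    (hEV : Fintype.card Γ.E = Fintype.card Γ.V) :
    ∃ Q : Finset Plane, (∀ P, P ∈ Q ↔ IsTri C P) ∧
      Q.card = (Finset.univ.filter fun w => Γ.IsInfinite w).card := by
  refine ⟨(Finset.univ.filter fun w => ¬ Γ.IsInfinite w ∧ IsTri C (φ.pos w)).image φ.pos,
    fun P => ?_, ?_⟩
  · simp only [Finset.mem_image, Finset.mem_filter, Finset.mem_univ, true_and]
    constructor
    · rintro ⟨w, ⟨-, h1⟩, rfl⟩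
      exact h1
    · intro hP
      obtain ⟨w, hw, rfl⟩ := h.exists_vertex_of_isTri hP
      exact ⟨w, ⟨hw, hP⟩, rfl⟩
  · rw [← h.card_tri hC hEV, Finset.card_image_of_injOn]
    intro w hw w' hw' he
    simp only [Finset.coe_filter, Finset.mem_univ, true_and, Set.mem_ofPred_eq] at hw hw'
    rcases h.eq_or_isNode (.vertex w hw.1) (.vertex w' hw'.1) he with h1 | h1
    · simpa using h1
    · exact absurd hw.2 (h.not_isTri_of_isNode h1)

end

/-! ### Sweeping the plane by parallel lines -/

/-- If a function is constant on a punctured neighbourhood of each point, then its limits at `-∞`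
and at `∞` agree. -/
theorem eq_of_eventually_const {α : Type*} {F : ℝ → α}
    (h : ∀ c, ∃ k, ∀ᶠ x in 𝓝[≠] c, F x = k) {A B : α} (hA : ∀ᶠ x in atTop, F x = A)
    (hB : ∀ᶠ x in atBot, F x = B) : A = B := by
  -- The punctured limit `k` is a locally constant function on the connected line, hence constant;
  -- the values of `F` at individual points play no role.
  choose k hk using h
  have hloc : IsLocallyConstant k := by
    rw [IsLocallyConstant.iff_eventually_eq]
    intro c
    have h1 := eventually_eventually_nhdsWithin.2 (hk c)
    rw [eventually_nhdsWithin_iff] at h1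
    filter_upwards [h1] with y hy
    by_cases hyc : y = c
    · rw [hyc]
    · have h2 := hy hyc
      rw [IsOpen.nhdsWithin_eq isOpen_compl_singleton hyc] at h2
      obtain ⟨x, h3, h4⟩ := ((h2.filter_mono nhdsWithin_le_nhds).and (hk y)).exists
      rw [← h3, ← h4]
  have : Nonempty α := ⟨A⟩
  obtain ⟨a, hka⟩ := hloc.exists_eq_const
  have key : ∀ c D, (∀ᶠ x in 𝓝 c, F x = D) → D = a := fun c D hD => by
    obtain ⟨x, h3, h4⟩ := ((hD.filter_mono nhdsWithin_le_nhds).and (hk c)).exists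
    rw [← h3, h4, hka, Function.const_apply]
  obtain ⟨x, hx⟩ := eventually_atTop.1 hA
  obtain ⟨y, hy⟩ := eventually_atBot.1 hB
  rw [key (x + 1) A ((eventually_gt_nhds (lt_add_one x)).mono fun z hz => hx z hz.le),
    key (y - 1) B ((eventually_lt_nhds (sub_one_lt y)).mono fun z hz => hy z hz.le)]

/-- The level of a point with respect to the lines parallel to `l`. -/
def lev (l : Fin 2 → ℤ) (x : Plane) : ℝ := l 0 * x 1 - l 1 * x 0

/-- A coordinate on the lines parallel to `l`. -/
def hgt (l : Fin 2 → ℤ) (x : Plane) : ℝ := -(l 0 * x 0 + l 1 * x 1)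

/-- The sign of a real number, as an integer. -/
noncomputable def sgn (x : ℝ) : ℤ := (SignType.sign x : ℤ)

theorem sgn_pos {x : ℝ} (h : 0 < x) : sgn x = 1 := by simp [sgn, sign_pos h]
theorem sgn_neg {x : ℝ} (h : x < 0) : sgn x = -1 := by simp [sgn, sign_neg h]
@[simp] theorem sgn_zero : sgn 0 = 0 := by simp [sgn]
theorem sgn_neg_eq (x : ℝ) : sgn (-x) = -sgn x := by
  rcases lt_trichotomy x 0 with h | rfl | h
  · rw [sgn_neg h, sgn_pos (neg_pos.2 h), neg_neg]
  · simp
  · rw [sgn_pos h, sgn_neg (neg_neg_iff_pos.2 h)]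

theorem sgn_mul_of_pos {a x : ℝ} (ha : 0 < a) : sgn (a * x) = sgn x := by
  rcases lt_trichotomy x 0 with h | rfl | h
  · rw [sgn_neg h, sgn_neg (mul_neg_of_pos_of_neg ha h)]
  · simp
  · rw [sgn_pos h, sgn_pos (mul_pos ha h)]

theorem sgn_intCast_mul (d : ℤ) : sgn d * d = |d| := by
  rcases lt_trichotomy d 0 with h | rfl | h
  · rw [sgn_neg (by exact_mod_cast h), abs_of_neg h]; ring
  · simp
  · rw [sgn_pos (by exact_mod_cast h), abs_of_pos h]; ring

theorem eventually_sgn_eq {f : ℝ → ℝ} {c : ℝ} (hf : ContinuousAt f c) (h : f c ≠ 0) :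
    ∀ᶠ x in 𝓝 c, sgn (f x) = sgn (f c) := by
  rcases h.lt_or_gt with h | h
  · filter_upwards [hf.eventually_lt_const h] with x hx
    rw [sgn_neg h, sgn_neg hx]
  · filter_upwards [hf.eventually_const_lt h] with x hx
    rw [sgn_pos h, sgn_pos hx]

theorem lev_neg (l : Fin 2 → ℤ) (x : Plane) : lev (-l) x = -lev l x := by
  simp only [lev, Pi.neg_apply]; push_cast; ring

theorem hgt_neg (l : Fin 2 → ℤ) (x : Plane) : hgt (-l) x = -hgt l x := by
  simp only [hgt, Pi.neg_apply]; push_cast; ring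

theorem lev_toReal (l v : Fin 2 → ℤ) : lev l (toReal v) = det₂ l v := by
  simp only [lev, toReal_apply, det₂]; push_cast; ring

theorem lev_add_smul (l : Fin 2 → ℤ) (x y : Plane) (t : ℝ) :
    lev l (x + t • y) = lev l x + t * lev l y := by
  simp only [lev, Pi.add_apply, Pi.smul_apply, smul_eq_mul]; ring

theorem hgt_add_smul (l : Fin 2 → ℤ) (x y : Plane) (t : ℝ) :
    hgt l (x + t • y) = hgt l x + t * hgt l y := by
  simp only [hgt, Pi.add_apply, Pi.smul_apply, smul_eq_mul]; ring

theorem sq_add_sq_pos {l : Fin 2 → ℤ} (hl : l ≠ 0) : (0 : ℝ) < l 0 ^ 2 + l 1 ^ 2 := by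
  by_contra h
  apply hl
  have h0 : (l 0 : ℝ) = 0 := by nlinarith [sq_nonneg (l 0 : ℝ), sq_nonneg (l 1 : ℝ)]
  have h1 : (l 1 : ℝ) = 0 := by nlinarith [sq_nonneg (l 0 : ℝ), sq_nonneg (l 1 : ℝ)]
  funext i
  fin_cases i
  · exact_mod_cast h0
  · exact_mod_cast h1

theorem eq_of_lev_hgt {l : Fin 2 → ℤ} (hl : l ≠ 0) {x y : Plane} (h1 : lev l x = lev l y)
    (h2 : hgt l x = hgt l y) : x = y := by
  have h := (sq_add_sq_pos hl).ne'
  simp only [lev, hgt] at h1 h2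
  funext i
  fin_cases i
  · refine mul_left_cancel₀ h ?_
    simp only [Fin.zero_eta]
    linear_combination -(l 0 : ℝ) * h2 - (l 1 : ℝ) * h1
  · refine mul_left_cancel₀ h ?_
    simp only [Fin.mk_one]
    linear_combination -(l 1 : ℝ) * h2 + (l 0 : ℝ) * h1

/-! ### Crossings of the edges with a moving line -/

section
variable {Γ : TropicalCurve} (φ : PlaneMap Γ) (l : Fin 2 → ℤ)

/-- The parameter at which an edge crosses the line of level `c`. -/
noncomputable def PlaneMap.tm (c : ℝ) (e : Γ.E) : ℝ :=
  (c - lev l (φ.pos (φ.base e))) / det₂ l (φ.dir e)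

/-- The point at which an edge crosses the line of level `c`. -/
noncomputable def PlaneMap.xp (c : ℝ) (e : Γ.E) : Plane := φ.pt e (φ.tm l c e)

/-- The half-edge `g` points upwards and the interior of its edge meets the line of level `c`. -/
def PlaneMap.Active (c : ℝ) (g : Γ.E × Bool) : Prop :=
  0 < det₂ l (φ.gdir g) ∧ 0 < φ.tm l c g.1 ∧ ENNReal.ofReal (φ.tm l c g.1) < Γ.length g.1

/-- The half-edge `g` points upwards and leaves the line of level `c`. -/
def PlaneMap.RightActive (c : ℝ) (g : Γ.E × Bool) : Prop :=
  0 < det₂ l (φ.gdir g) ∧ φ.Germ (φ.xp l c g.1) g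

/-- The contribution of a pair of half-edges to the sweep sum. -/
noncomputable def PlaneMap.term (c : ℝ) (g g' : Γ.E × Bool) : ℤ :=
  sgn (hgt l (φ.xp l c g'.1) - hgt l (φ.xp l c g.1)) * det₂ (φ.gdir g) (φ.gdir g')

/-- The reversed half-edge. -/
def rev {E : Type*} (g : E × Bool) : E × Bool := (g.1, !g.2)

theorem PlaneMap.gdir_rev (g : Γ.E × Bool) : φ.gdir (rev g) = -φ.gdir g := by
  obtain ⟨e, σ⟩ := g
  cases σ <;> simp [rev, PlaneMap.gdir]

/-- The pairs `(l, c)` and `(-l, -c)` describe the same line swept in opposite directions. Upward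
half-edges are exchanged with their reversals and the sweep sum changes sign, so that left limits
reduce to right limits. -/
theorem PlaneMap.tm_neg (c : ℝ) (e : Γ.E) : φ.tm (-l) (-c) e = φ.tm l c e := by
  unfold PlaneMap.tm
  rw [lev_neg, det₂_neg_left, Int.cast_neg, ← neg_sub', neg_div_neg_eq]

theorem PlaneMap.xp_neg (c : ℝ) (e : Γ.E) : φ.xp (-l) (-c) e = φ.xp l c e := by
  unfold PlaneMap.xp
  rw [φ.tm_neg]

theorem PlaneMap.active_neg (c : ℝ) (g : Γ.E × Bool) :
    φ.Active (-l) (-c) (rev g) ↔ φ.Active l c g := by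
  unfold PlaneMap.Active
  rw [φ.gdir_rev, det₂_neg_left, det₂_neg_right, neg_neg, rev, φ.tm_neg]

theorem PlaneMap.term_neg (c : ℝ) (g g' : Γ.E × Bool) :
    φ.term (-l) (-c) (rev g) (rev g') = -φ.term l c g g' := by
  unfold PlaneMap.term
  rw [φ.gdir_rev, φ.gdir_rev, det₂_neg_left, det₂_neg_right, neg_neg, rev, rev, φ.xp_neg, φ.xp_neg,
    hgt_neg, hgt_neg, ← neg_sub', sgn_neg_eq, neg_mul]

variable {l}

theorem PlaneMap.det_ne_zero {g : Γ.E × Bool} (h : 0 < det₂ l (φ.gdir g)) :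
    (det₂ l (φ.dir g.1) : ℝ) ≠ 0 := by
  unfold PlaneMap.gdir at h
  rw [Int.cast_ne_zero]
  split_ifs at h
  · exact h.ne'
  · rw [det₂_neg_right] at h
    omega

theorem PlaneMap.lev_pt (e : Γ.E) (t : ℝ) :
    lev l (φ.pt e t) = lev l (φ.pos (φ.base e)) + t * det₂ l (φ.dir e) := by
  rw [PlaneMap.pt, lev_add_smul, lev_toReal]

theorem PlaneMap.lev_xp {e : Γ.E} (h : (det₂ l (φ.dir e) : ℝ) ≠ 0) (c : ℝ) :
    lev l (φ.xp l c e) = c := by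
  rw [PlaneMap.xp, φ.lev_pt, PlaneMap.tm, div_mul_cancel₀ _ h]
  ring

theorem PlaneMap.xp_of_pt {e : Γ.E} (h : (det₂ l (φ.dir e) : ℝ) ≠ 0) {t : ℝ} {P : Plane}
    (hP : φ.pt e t = P) : φ.xp l (lev l P) e = P := by
  rw [← hP, φ.lev_pt, PlaneMap.xp, PlaneMap.tm, add_sub_cancel_left, mul_div_cancel_right₀ _ h]

theorem PlaneMap.continuous_tm (e : Γ.E) : Continuous fun c => φ.tm l c e := by
  unfold PlaneMap.tm; fun_prop

theorem PlaneMap.germ_xp (c : ℝ) (e : Γ.E) (σ : Bool) : φ.Germ (φ.xp l c e) (e, σ) ↔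
    if σ then 0 ≤ φ.tm l c e ∧ ENNReal.ofReal (φ.tm l c e) < Γ.length e
    else 0 < φ.tm l c e ∧ ENNReal.ofReal (φ.tm l c e) ≤ Γ.length e := by
  constructor
  · rintro ⟨t, ht, h⟩
    obtain rfl := φ.pt_injective e ht
    exact h
  · exact fun h => ⟨_, rfl, h⟩

/-- The crossing parameter is strictly monotone in the level, increasing for forward and decreasing
for backward upward half-edges. Just above `c`, the strict inequalities for an interior point
therefore amount to the half-open ones for a half-edge leaving level `c`. -/
theorem PlaneMap.eventually_active (c : ℝ) (g : Γ.E × Bool) :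
    ∀ᶠ x in 𝓝[>] c, φ.Active l x g ↔ φ.RightActive l c g := by
  unfold PlaneMap.Active PlaneMap.RightActive
  by_cases hd : 0 < det₂ l (φ.gdir g)
  swap
  · exact Eventually.of_forall fun x => by simp [hd]
  simp only [hd, true_and]
  obtain ⟨e, σ⟩ := g
  rw [φ.germ_xp]
  have hc : Tendsto (fun x => φ.tm l x e) (𝓝[>] c) (𝓝 (φ.tm l c e)) :=
    ((φ.continuous_tm e).tendsto c).mono_left nhdsWithin_le_nhds
  have hc' := (ENNReal.continuous_ofReal.tendsto _).comp hc
  cases σ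
  · have hneg : (det₂ l (φ.dir e) : ℝ) < 0 := by
      simp only [PlaneMap.gdir, Bool.false_eq_true, if_false, det₂_neg_right] at hd
      exact_mod_cast (neg_pos.1 hd)
    have hlt : ∀ᶠ x in 𝓝[>] c, φ.tm l x e < φ.tm l c e := by
      filter_upwards [self_mem_nhdsWithin] with x hx
      exact div_lt_div_of_neg_of_lt hneg (sub_lt_sub_right hx _)
    simp only [Bool.false_eq_true, if_false]
    by_cases h0 : 0 < φ.tm l c e
    · by_cases h1 : ENNReal.ofReal (φ.tm l c e) ≤ Γ.length e
      · filter_upwards [hlt, hc.eventually_const_lt h0] with x hx hx0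
        simp only [h0, h1, hx0, true_and, iff_true]
        exact ((ENNReal.ofReal_lt_ofReal_iff h0).2 hx).trans_le h1
      · filter_upwards [hc'.eventually_const_lt (not_le.1 h1)] with x hx
        simp only [h1, and_false, iff_false, not_and, not_lt]
        exact fun _ => hx.le
    · filter_upwards [hlt] with x hx
      simp only [h0, false_and, iff_false, not_and]
      intro h1
      linarith
  · have hpos : (0 : ℝ) < det₂ l (φ.dir e) := by
      simp only [PlaneMap.gdir, if_true] at hd
      exact_mod_cast hd
    have hlt : ∀ᶠ x in 𝓝[>] c, φ.tm l c e < φ.tm l x e := by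
      filter_upwards [self_mem_nhdsWithin] with x hx
      exact div_lt_div_of_pos_right (sub_lt_sub_right hx _) hpos
    simp only [if_true]
    by_cases h0 : 0 ≤ φ.tm l c e
    · by_cases h1 : ENNReal.ofReal (φ.tm l c e) < Γ.length e
      · filter_upwards [hlt, hc'.eventually_lt_const h1] with x hx hx1
        simp only [h0, h1, true_and, iff_true]
        exact ⟨h0.trans_lt hx, hx1⟩
      · filter_upwards [hlt] with x hx
        simp only [h1, and_false, iff_false, not_and, not_lt]
        exact fun _ => (not_lt.1 h1).trans (ENNReal.ofReal_le_ofReal hx.le)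
    · filter_upwards [hc.eventually_lt_const (not_le.1 h0)] with x hx
      simp only [h0, false_and, iff_false, not_and]
      intro h1
      linarith

/-- The heights at which two edges cross the line of level `x` differ by an affine function. -/
theorem PlaneMap.hgt_sub {e f : Γ.E} (he : (det₂ l (φ.dir e) : ℝ) ≠ 0)
    (hf : (det₂ l (φ.dir f) : ℝ) ≠ 0) (c x : ℝ) :
    hgt l (φ.xp l x f) - hgt l (φ.xp l x e) = hgt l (φ.xp l c f) - hgt l (φ.xp l c e) +
      (x - c) * ((l 0 ^ 2 + l 1 ^ 2) * det₂ (φ.dir e) (φ.dir f) /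
        (det₂ l (φ.dir e) * det₂ l (φ.dir f))) := by
  have key : ((l 0 : ℝ) ^ 2 + l 1 ^ 2) * det₂ (φ.dir e) (φ.dir f) =
      hgt l (toReal (φ.dir f)) * det₂ l (φ.dir e) - hgt l (toReal (φ.dir e)) * det₂ l (φ.dir f) := by
    simp only [hgt, toReal_apply, det₂]; push_cast; ring
  rw [key]
  simp only [PlaneMap.xp, PlaneMap.pt, hgt_add_smul, PlaneMap.tm]
  field_simp
  ring

/-- The speed at which two upward half-edges drift apart along the line is a positive multiple of
the determinant of their directions, so after a common point their signed determinant is an absolute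
value. -/
theorem PlaneMap.sgn_mul_det {g g' : Γ.E × Bool} (hg : 0 < det₂ l (φ.gdir g))
    (hg' : 0 < det₂ l (φ.gdir g')) :
    sgn ((l 0 ^ 2 + l 1 ^ 2) * det₂ (φ.dir g.1) (φ.dir g'.1) /
      (det₂ l (φ.dir g.1) * det₂ l (φ.dir g'.1))) * det₂ (φ.gdir g) (φ.gdir g') =
      |det₂ (φ.gdir g) (φ.gdir g')| := by
  have hl : l ≠ 0 := by
    rintro rfl
    simp [det₂] at hg
  have h1 : ((l 0 ^ 2 + l 1 ^ 2) * det₂ (φ.dir g.1) (φ.dir g'.1) /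
      (det₂ l (φ.dir g.1) * det₂ l (φ.dir g'.1)) : ℝ) =
      ((l 0 ^ 2 + l 1 ^ 2) / (det₂ l (φ.gdir g) * det₂ l (φ.gdir g'))) *
        (det₂ (φ.gdir g) (φ.gdir g') : ℤ) := by
    have d1 := φ.det_ne_zero hg
    have d2 := φ.det_ne_zero hg'
    obtain ⟨e, σ⟩ := g
    obtain ⟨e', σ'⟩ := g'
    cases σ <;> cases σ' <;>
      simp only [PlaneMap.gdir, Bool.false_eq_true, if_false, if_true, det₂_neg_left,
        det₂_neg_right, Int.cast_neg] <;> field_simp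
  rw [h1, sgn_mul_of_pos, sgn_intCast_mul]
  have h2 : (0 : ℝ) < det₂ l (φ.gdir g) := by exact_mod_cast hg
  have h3 : (0 : ℝ) < det₂ l (φ.gdir g') := by exact_mod_cast hg'
  have := sq_add_sq_pos hl
  positivity

-- Half-edges leaving a common point fan out in the order of their slopes and contribute the
-- absolute determinant; at different points of the line the order persists by continuity.
open Classical in
theorem PlaneMap.eventually_term {g g' : Γ.E × Bool} (hg : 0 < det₂ l (φ.gdir g))
    (hg' : 0 < det₂ l (φ.gdir g')) (c : ℝ) :
    ∀ᶠ x in 𝓝[>] c, φ.term l x g g' =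
      (if φ.xp l c g.1 = φ.xp l c g'.1 then |det₂ (φ.gdir g) (φ.gdir g')| else 0) +
        φ.term l c g g' := by
  have d1 := φ.det_ne_zero hg
  have d2 := φ.det_ne_zero hg'
  have hl : l ≠ 0 := by
    rintro rfl
    simp [det₂] at hg
  unfold PlaneMap.term
  split_ifs with h
  · filter_upwards [self_mem_nhdsWithin] with x hx
    rw [φ.hgt_sub d1 d2 c x, h, sub_self, zero_add, sgn_mul_of_pos (sub_pos.2 hx),
      φ.sgn_mul_det hg hg', sgn_zero, zero_mul, add_zero]
  · have hne : hgt l (φ.xp l c g'.1) - hgt l (φ.xp l c g.1) ≠ 0 := fun h0 =>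
      h (eq_of_lev_hgt hl (by rw [φ.lev_xp d1, φ.lev_xp d2]) (by linarith))
    have hcont : ContinuousAt (fun x => hgt l (φ.xp l x g'.1) - hgt l (φ.xp l x g.1)) c := by
      rw [show (fun x => hgt l (φ.xp l x g'.1) - hgt l (φ.xp l x g.1)) = _ from
        funext fun x => φ.hgt_sub d1 d2 c x]
      fun_prop
    filter_upwards [(eventually_sgn_eq hcont hne).filter_mono nhdsWithin_le_nhds] with x hx
    rw [hx, zero_add]

end

/-! ### The sweep sum, its limits and its jumps -/

section
variable {C : Set Plane} {Γ : TropicalCurve} (φ : PlaneMap Γ) {l : Fin 2 → ℤ}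

/-- The half-edges at `P` that point upwards. -/
noncomputable def PlaneMap.upGerms (l : Fin 2 → ℤ) (P : Plane) : Finset (Γ.E × Bool) :=
  (φ.germs P).filter fun g => 0 < det₂ l (φ.gdir g)

/-- The local contribution of a point to the area of the dual polygon. -/
noncomputable def PlaneMap.jump (l : Fin 2 → ℤ) (P : Plane) : ℤ :=
  ∑ g ∈ φ.germs P, ∑ g' ∈ φ.germs P,
    if 0 < det₂ l (φ.gdir g) * det₂ l (φ.gdir g') then |det₂ (φ.gdir g) (φ.gdir g')| else 0

theorem sum_if_mul_pos {ι : Type*} (s : Finset ι) (a : ι → ℤ) (f : ι → ι → ℤ) :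
    ∑ i ∈ s, ∑ j ∈ s, (if 0 < a i * a j then f i j else 0) =
      (∑ i ∈ s with 0 < a i, ∑ j ∈ s with 0 < a j, f i j) +
        ∑ i ∈ s with a i < 0, ∑ j ∈ s with a j < 0, f i j := by
  simp only [Finset.sum_filter]
  rw [← Finset.sum_add_distrib]
  refine Finset.sum_congr rfl fun i _ => ?_
  rcases lt_trichotomy (a i) 0 with h | h | h
  · rw [if_neg h.le.not_gt, if_pos h, zero_add]
    exact Finset.sum_congr rfl fun j _ => by simp only [mul_pos_iff, h, h.le.not_gt, false_and,
      true_and, false_or]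
  · simp [h]
  · rw [if_pos h, if_neg h.le.not_gt, add_zero]
    exact Finset.sum_congr rfl fun j _ => by simp only [mul_pos_iff, h, h.le.not_gt, false_and,
      true_and, or_false]

theorem PlaneMap.jump_eq (P : Plane) : φ.jump l P =
    (∑ g ∈ φ.upGerms l P, ∑ g' ∈ φ.upGerms l P, |det₂ (φ.gdir g) (φ.gdir g')|) +
      ∑ g ∈ φ.upGerms (-l) P, ∑ g' ∈ φ.upGerms (-l) P, |det₂ (φ.gdir g) (φ.gdir g')| := by
  rw [PlaneMap.jump, sum_if_mul_pos _ fun g => det₂ l (φ.gdir g)]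
  simp only [PlaneMap.upGerms, det₂_neg_left, neg_pos]

theorem PlaneMap.det_gdir_ne_zero (hl : ∀ e, det₂ l (φ.dir e) ≠ 0) (g : Γ.E × Bool) :
    det₂ l (φ.gdir g) ≠ 0 := by
  unfold PlaneMap.gdir
  split_ifs
  · exact hl _
  · rw [det₂_neg_right]
    exact neg_ne_zero.2 (hl _)

/-- Balancing as the sweep sees it: since no edge is parallel to `l`, the half-edges at `P` split
into upward and downward ones, with opposite sums. -/
theorem PlaneMap.sum_upGerms_neg (hl : ∀ e, det₂ l (φ.dir e) ≠ 0) {P : Plane}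
    (hb : ∑ g ∈ φ.germs P, φ.gdir g = 0) :
    ∑ g ∈ φ.upGerms (-l) P, φ.gdir g = -∑ g ∈ φ.upGerms l P, φ.gdir g := by
  rw [eq_neg_iff_add_eq_zero, add_comm, ← hb,
    ← Finset.sum_filter_add_sum_filter_not (φ.germs P) fun g => 0 < det₂ l (φ.gdir g)]
  congr 1
  refine Finset.sum_congr (Finset.filter_congr fun g _ => ?_) fun _ _ => rfl
  have := φ.det_gdir_ne_zero hl g
  rw [det₂_neg_left]
  omega

variable [Fintype Γ.E]

open Classical in
/-- The sweep sum of the line of level `c`. -/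
noncomputable def PlaneMap.sweep (l : Fin 2 → ℤ) (c : ℝ) : ℤ :=
  ∑ g, ∑ g', if φ.Active l c g ∧ φ.Active l c g' then φ.term l c g g' else 0

open Classical in
/-- The right limit of the sweep sum. -/
noncomputable def PlaneMap.sweepRight (l : Fin 2 → ℤ) (c : ℝ) : ℤ :=
  ∑ g with φ.RightActive l c g, ∑ g' with φ.RightActive l c g',
    ((if φ.xp l c g.1 = φ.xp l c g'.1 then |det₂ (φ.gdir g) (φ.gdir g')| else 0) +
        φ.term l c g g')

open Classical in
/-- The contribution of the rays that point upwards. -/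
noncomputable def PlaneMap.rayArea (l : Fin 2 → ℤ) : ℤ :=
  ∑ e with Γ.length e = ⊤ ∧ 0 < det₂ l (φ.dir e),
    ∑ f with Γ.length f = ⊤ ∧ 0 < det₂ l (φ.dir f), |det₂ (φ.dir e) (φ.dir f)|

theorem PlaneMap.eventually_sweep (c : ℝ) :
    ∀ᶠ x in 𝓝[>] c, φ.sweep l x = φ.sweepRight l c := by
  classical
  have h1 : ∀ᶠ x in 𝓝[>] c, ∀ g g',
      (if φ.Active l x g ∧ φ.Active l x g' then φ.term l x g g' else 0) =
      if φ.RightActive l c g ∧ φ.RightActive l c g' then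
        ((if φ.xp l c g.1 = φ.xp l c g'.1 then |det₂ (φ.gdir g) (φ.gdir g')| else 0) +
        φ.term l c g g') else 0 := by
    simp only [eventually_all]
    intro g g'
    by_cases h : φ.RightActive l c g ∧ φ.RightActive l c g'
    · filter_upwards [φ.eventually_active c g, φ.eventually_active c g',
        φ.eventually_term h.1.1 h.2.1 c] with x hx hx' ht
      rw [hx, hx', if_pos h, if_pos h, ht]
    · filter_upwards [φ.eventually_active c g, φ.eventually_active c g'] with x hx hx'
      rw [hx, hx', if_neg h, if_neg h]
  filter_upwards [h1] with x hx
  simp only [PlaneMap.sweep, PlaneMap.sweepRight, hx, Finset.sum_filter, ite_and]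
  refine Finset.sum_congr rfl fun g _ => ?_
  split_ifs <;> simp

theorem PlaneMap.sweep_neg (l : Fin 2 → ℤ) (c : ℝ) : φ.sweep (-l) (-c) = -φ.sweep l c := by
  classical
  let r : Γ.E × Bool ≃ Γ.E × Bool :=
    ⟨rev, rev, fun g => by simp [rev], fun g => by simp [rev]⟩
  unfold PlaneMap.sweep
  rw [← r.sum_comp, ← Finset.sum_neg_distrib]
  refine Finset.sum_congr rfl fun g _ => ?_
  rw [← r.sum_comp, ← Finset.sum_neg_distrib]
  refine Finset.sum_congr rfl fun g' _ => ?_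
  change (if φ.Active (-l) (-c) (rev g) ∧ φ.Active (-l) (-c) (rev g') then
    φ.term (-l) (-c) (rev g) (rev g') else 0) = _
  rw [φ.active_neg, φ.active_neg, φ.term_neg]
  split_ifs <;> simp

theorem PlaneMap.eventually_sweep_left (c : ℝ) :
    ∀ᶠ x in 𝓝[<] c, φ.sweep l x = -φ.sweepRight (-l) (-c) := by
  have h : Tendsto (fun x : ℝ => -x) (𝓝[<] c) (𝓝[>] (-c)) := by
    refine tendsto_nhdsWithin_iff.2 ⟨(continuous_neg.tendsto c).mono_left nhdsWithin_le_nhds, ?_⟩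
    filter_upwards [self_mem_nhdsWithin] with x hx
    exact neg_lt_neg (Set.mem_Iio.1 hx)
  filter_upwards [h.eventually (φ.eventually_sweep (l := -l) (-c))] with x hx
  rw [← hx, φ.sweep_neg, neg_neg]

/-- Far up, only the rays pointing upwards are crossed, and they are ordered by slope. Parallel rays
never change their order, but their determinant vanishes. -/
theorem PlaneMap.eventually_sweep_atTop :
    ∀ᶠ x in atTop, φ.sweep l x = φ.rayArea l := by
  classical
  have htop : ∀ e, 0 < det₂ l (φ.dir e) → Tendsto (fun x => φ.tm l x e) atTop atTop := fun e he =>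
    (tendsto_atTop_add_const_right _ _ tendsto_id).atTop_div_const (by exact_mod_cast he)
  have hact : ∀ g : Γ.E × Bool, ∀ᶠ x in atTop, φ.Active l x g ↔
      g.2 = true ∧ Γ.length g.1 = ⊤ ∧ 0 < det₂ l (φ.dir g.1) := by
    rintro ⟨e, σ⟩
    unfold PlaneMap.Active
    cases σ
    · by_cases hd : 0 < det₂ l (φ.gdir (e, false))
      · have hneg : (det₂ l (φ.dir e) : ℝ) < 0 := by
          simp only [PlaneMap.gdir, Bool.false_eq_true, if_false, det₂_neg_right] at hd
          exact_mod_cast (neg_pos.1 hd)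
        filter_upwards [eventually_gt_atTop (lev l (φ.pos (φ.base e)))] with x hx
        have h1 : φ.tm l x e < 0 := div_neg_of_pos_of_neg (sub_pos.2 hx) hneg
        simp [h1.le.not_gt]
      · simp [hd]
    · have hg : φ.gdir (e, true) = φ.dir e := rfl
      simp only [hg, true_and]
      by_cases hd : 0 < det₂ l (φ.dir e)
      · simp only [hd, true_and, and_true]
        by_cases hlen : Γ.length e = ⊤
        · filter_upwards [(htop e hd).eventually_gt_atTop 0] with x hx
          simp [hlen, hx]
        · filter_upwards [(htop e hd).eventually_gt_atTop (Γ.length e).toReal] with x hx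
          simp only [hlen, iff_false, not_and, not_lt]
          intro _
          rw [← ENNReal.ofReal_toReal hlen]
          exact ENNReal.ofReal_le_ofReal hx.le
      · simp [hd]
  have hterm : ∀ e f : Γ.E, 0 < det₂ l (φ.dir e) → 0 < det₂ l (φ.dir f) →
      ∀ᶠ x in atTop, φ.term l x (e, true) (f, true) = |det₂ (φ.dir e) (φ.dir f)| := by
    intro e f he hf
    have d1 := φ.det_ne_zero (g := (e, true)) he
    have d2 := φ.det_ne_zero (g := (f, true)) hf
    by_cases h0 : det₂ (φ.dir e) (φ.dir f) = 0
    · refine Eventually.of_forall fun x => ?_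
      simp [PlaneMap.term, PlaneMap.gdir, h0]
    · set κ : ℝ := (l 0 ^ 2 + l 1 ^ 2) * det₂ (φ.dir e) (φ.dir f) /
        (det₂ l (φ.dir e) * det₂ l (φ.dir f))
      have hs : sgn κ * det₂ (φ.dir e) (φ.dir f) = |det₂ (φ.dir e) (φ.dir f)| :=
        φ.sgn_mul_det (g := (e, true)) (g' := (f, true)) he hf
      have hh : ∀ x, hgt l (φ.xp l x f) - hgt l (φ.xp l x e) =
          hgt l (φ.xp l 0 f) - hgt l (φ.xp l 0 e) + x * κ := fun x => by
        rw [φ.hgt_sub d1 d2 0 x, sub_zero]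
      have hκ0 : κ ≠ 0 := by
        intro hk
        rw [hk, sgn_zero, zero_mul] at hs
        exact h0 (abs_eq_zero.1 hs.symm)
      have hev : ∀ᶠ x in atTop, sgn (hgt l (φ.xp l x f) - hgt l (φ.xp l x e)) = sgn κ := by
        rcases hκ0.lt_or_gt with hk | hk
        · have := tendsto_atBot_add_const_left atTop (hgt l (φ.xp l 0 f) - hgt l (φ.xp l 0 e))
            (tendsto_id.atTop_mul_const_of_neg hk)
          filter_upwards [this.eventually_lt_atBot 0] with x hx
          rw [sgn_neg hk, hh]
          exact sgn_neg hx
        · have := tendsto_atTop_add_const_left atTop (hgt l (φ.xp l 0 f) - hgt l (φ.xp l 0 e))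
            (tendsto_id.atTop_mul_const hk)
          filter_upwards [this.eventually_gt_atTop 0] with x hx
          rw [sgn_pos hk, hh]
          exact sgn_pos hx
      filter_upwards [hev] with x hx
      rw [PlaneMap.term, hx]
      exact hs
  have hall : ∀ᶠ x in atTop, ∀ g, φ.Active l x g ↔
      g.2 = true ∧ Γ.length g.1 = ⊤ ∧ 0 < det₂ l (φ.dir g.1) := eventually_all.2 hact
  have hall2 : ∀ᶠ x in atTop, ∀ e f : Γ.E, 0 < det₂ l (φ.dir e) → 0 < det₂ l (φ.dir f) →
      φ.term l x (e, true) (f, true) = |det₂ (φ.dir e) (φ.dir f)| := by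
    simp only [eventually_all]
    exact hterm
  filter_upwards [hall, hall2] with x hx hx2
  simp only [PlaneMap.sweep, PlaneMap.rayArea, hx, Fintype.sum_prod_type, Fintype.sum_bool,
    Bool.false_eq_true, false_and, if_false, true_and, and_false, add_zero,
    Finset.sum_filter, Finset.sum_const_zero]
  refine Finset.sum_congr rfl fun e _ => ?_
  by_cases h1 : Γ.length e = ⊤ ∧ 0 < det₂ l (φ.dir e)
  · simp only [h1, if_true, true_and]
    refine Finset.sum_congr rfl fun f _ => ?_
    split_ifs with h2
    · exact hx2 e f h1.2 h2.2
    · rfl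
  · simp only [h1, if_false, false_and, Finset.sum_const_zero]

theorem PlaneMap.eventually_sweep_atBot :
    ∀ᶠ x in atBot, φ.sweep l x = -φ.rayArea (-l) := by
  have h := tendsto_neg_atBot_atTop.eventually (φ.eventually_sweep_atTop (l := -l))
  filter_upwards [h] with x hx
  rw [← hx, φ.sweep_neg, neg_neg]

open Classical in
/-- The right limit of the sweep sum, with its terms grouped by the points of the line. -/
theorem PlaneMap.sweepRight_eq (hl : ∀ e, det₂ l (φ.dir e) ≠ 0) (c : ℝ) (Z : Finset Plane)
    (hZ : ∀ P ∈ Z, lev l P = c) (hxZ : ∀ e, φ.xp l c e ∈ Z) :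
    φ.sweepRight l c =
      (∑ P ∈ Z, ∑ g ∈ φ.upGerms l P, ∑ g' ∈ φ.upGerms l P, |det₂ (φ.gdir g) (φ.gdir g')|) +
      ∑ P ∈ Z, ∑ P' ∈ Z, sgn (hgt l P' - hgt l P) *
        det₂ (∑ g ∈ φ.upGerms l P, φ.gdir g) (∑ g ∈ φ.upGerms l P', φ.gdir g) := by
  have hfib : ∀ P ∈ Z, (Finset.univ.filter (φ.RightActive l c)).filter
      (fun g => φ.xp l c g.1 = P) = φ.upGerms l P := by
    intro P hP
    ext g
    simp only [Finset.mem_filter, Finset.mem_univ, true_and, PlaneMap.RightActive,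
      PlaneMap.upGerms, PlaneMap.mem_germs]
    constructor
    · rintro ⟨⟨h1, h2⟩, rfl⟩
      exact ⟨h2, h1⟩
    · rintro ⟨h1, h2⟩
      obtain ⟨t, ht, -⟩ := id h1
      have hx : φ.xp l c g.1 = P := by
        rw [← hZ P hP]
        exact φ.xp_of_pt (Int.cast_ne_zero.2 (hl _)) ht
      rw [hx]
      exact ⟨⟨h2, h1⟩, rfl⟩
  have hsum : ∀ f : Γ.E × Bool → ℤ, ∑ g with φ.RightActive l c g, f g =
      ∑ P ∈ Z, ∑ g ∈ φ.upGerms l P, f g := by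
    intro f
    rw [← Finset.sum_fiberwise_of_maps_to (g := fun g : Γ.E × Bool => φ.xp l c g.1)
      (t := Z) (fun g _ => hxZ g.1)]
    exact Finset.sum_congr rfl fun P hP => by rw [hfib P hP]
  have hxp : ∀ P ∈ Z, ∀ g ∈ φ.upGerms l P, φ.xp l c g.1 = P := by
    intro P hP g hg
    rw [← hfib P hP] at hg
    exact (Finset.mem_filter.1 hg).2
  unfold PlaneMap.sweepRight
  rw [hsum]
  simp_rw [hsum]
  rw [← Finset.sum_add_distrib]
  refine Finset.sum_congr rfl fun P hP => ?_
  rw [Finset.sum_comm, ← Finset.sum_ite_eq_of_mem Z P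
    (fun _ => ∑ g ∈ φ.upGerms l P, ∑ g' ∈ φ.upGerms l P, |det₂ (φ.gdir g) (φ.gdir g')|) hP,
    ← Finset.sum_add_distrib]
  refine Finset.sum_congr rfl fun P' hP' => ?_
  have h1 : ∀ g ∈ φ.upGerms l P, ∀ g' ∈ φ.upGerms l P',
      ((if φ.xp l c g.1 = φ.xp l c g'.1 then |det₂ (φ.gdir g) (φ.gdir g')| else 0) +
        φ.term l c g g') = (if P = P' then |det₂ (φ.gdir g) (φ.gdir g')| else 0) +
        sgn (hgt l P' - hgt l P) * det₂ (φ.gdir g) (φ.gdir g') := by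
    intro g hg g' hg'
    rw [PlaneMap.term, hxp P hP g hg, hxp P' hP' g' hg']
  rw [Finset.sum_congr rfl fun g hg => Finset.sum_congr rfl (h1 g hg)]
  simp only [Finset.sum_add_distrib, ← Finset.mul_sum, ← det₂_sum_right, ← det₂_sum_left]
  congr 1
  split_ifs with h
  · rw [h]
  · simp

-- The left limit is minus the second summand, so the left-hand side is the jump at level `c`. By
-- balancing, the total direction leaving a point upwards equals the one arriving from below; hence
-- the terms between different points cancel and only the pairs at a common point remain.
open Classical in
theorem PlaneMap.sweepRight_add (hl : ∀ e, det₂ l (φ.dir e) ≠ 0)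
    (hb : ∀ P, ∑ g ∈ φ.germs P, φ.gdir g = 0) (c : ℝ) (Q : Finset Plane)
    (hQ : ∀ P, P ∉ Q → φ.jump l P = 0) :
    φ.sweepRight l c + φ.sweepRight (-l) (-c) = ∑ P ∈ Q with lev l P = c, φ.jump l P := by
  -- `Z` also contains crossings of the line with prolongations of edges. This is harmless: points
  -- outside `Q` have jump zero.
  set Z : Finset Plane := Finset.univ.image (φ.xp l c) ∪ Q.filter fun P => lev l P = c with hZdef
  have hZ : ∀ P ∈ Z, lev l P = c := by
    intro P hP
    rcases Finset.mem_union.1 hP with h | h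
    · obtain ⟨e, -, rfl⟩ := Finset.mem_image.1 h
      exact φ.lev_xp (Int.cast_ne_zero.2 (hl e)) c
    · exact (Finset.mem_filter.1 h).2
  have hxZ : ∀ e, φ.xp l c e ∈ Z := fun e =>
    Finset.mem_union_left _ (Finset.mem_image_of_mem _ (Finset.mem_univ e))
  rw [φ.sweepRight_eq hl c Z hZ hxZ, φ.sweepRight_eq
    (fun e => by rw [det₂_neg_left]; exact neg_ne_zero.2 (hl e)) (-c) Z
    (fun P hP => by rw [lev_neg, hZ P hP]) (fun e => by rw [φ.xp_neg]; exact hxZ e)]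
  have h1 : ∑ P ∈ Q with lev l P = c, φ.jump l P = ∑ P ∈ Z, φ.jump l P := by
    refine Finset.sum_subset Finset.subset_union_right fun P hP hPQ => hQ P fun h => hPQ ?_
    exact Finset.mem_filter.2 ⟨h, hZ P hP⟩
  rw [h1]
  simp only [φ.sum_upGerms_neg hl (hb _), hgt_neg, ← neg_sub', sgn_neg_eq, det₂_neg_left,
    det₂_neg_right, neg_neg, neg_mul, Finset.sum_neg_distrib, φ.jump_eq, Finset.sum_add_distrib]
  ring

/-- The area of the dual polygon is the sum of the local contributions. -/
theorem PlaneMap.sum_jump (hl : ∀ e, det₂ l (φ.dir e) ≠ 0)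
    (hb : ∀ P, ∑ g ∈ φ.germs P, φ.gdir g = 0) (Q : Finset Plane)
    (hQ : ∀ P, P ∉ Q → φ.jump l P = 0) :
    ∑ P ∈ Q, φ.jump l P = φ.rayArea l + φ.rayArea (-l) := by
  classical
  -- With the jumps already passed subtracted, the sweep sum has equal left and right limits
  -- everywhere.
  let F : ℝ → ℤ := fun x => φ.sweep l x - ∑ P ∈ Q with lev l P < x, φ.jump l P
  have hF : ∀ c, ∃ k, ∀ᶠ x in 𝓝[≠] c, F x = k := by
    intro c
    have hall : ∀ᶠ x in 𝓝[>] c, ∀ P ∈ Q, (lev l P < x ↔ lev l P ≤ c) := by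
      rw [Filter.eventually_all_finset]
      intro P _
      rcases le_or_gt (lev l P) c with h | h
      · filter_upwards [self_mem_nhdsWithin] with x hx
        exact iff_of_true (h.trans_lt hx) h
      · filter_upwards [(eventually_lt_nhds h).filter_mono nhdsWithin_le_nhds] with x hx
        exact iff_of_false hx.not_gt h.not_ge
    have hall' : ∀ᶠ x in 𝓝[<] c, ∀ P ∈ Q, (lev l P < x ↔ lev l P < c) := by
      rw [Filter.eventually_all_finset]
      intro P _
      rcases lt_or_ge (lev l P) c with h | h
      · filter_upwards [(eventually_gt_nhds h).filter_mono nhdsWithin_le_nhds] with x hx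
        exact iff_of_true hx h
      · filter_upwards [self_mem_nhdsWithin] with x hx
        exact iff_of_false ((Set.mem_Iio.1 hx).le.trans h).not_gt h.not_gt
    have hjump := φ.sweepRight_add hl hb c Q hQ
    refine ⟨φ.sweepRight l c - ∑ P ∈ Q with lev l P ≤ c, φ.jump l P, ?_⟩
    rw [← nhdsLT_sup_nhdsGT, eventually_sup]
    constructor
    · filter_upwards [hall', φ.eventually_sweep_left c] with x hx hs
      change φ.sweep l x - _ = _
      rw [hs, Finset.filter_congr hx]
      have h2 : ∑ P ∈ Q with lev l P ≤ c, φ.jump l P = ∑ P ∈ Q with lev l P < c, φ.jump l P +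
          ∑ P ∈ Q with lev l P = c, φ.jump l P := by
        rw [← Finset.sum_union]
        · refine Finset.sum_congr ?_ fun _ _ => rfl
          ext P
          simp only [Finset.mem_filter, Finset.mem_union, le_iff_lt_or_eq]
          tauto
        · refine Finset.disjoint_filter.2 fun P _ h1 h2 => h1.ne h2
      rw [h2]
      linarith
    · filter_upwards [hall, φ.eventually_sweep c] with x hx hs
      change φ.sweep l x - _ = _
      rw [hs, Finset.filter_congr hx]
  have hA : ∀ᶠ x in atTop, F x = φ.rayArea l - ∑ P ∈ Q, φ.jump l P := by
    have : ∀ᶠ x in atTop, ∀ P ∈ Q, lev l P < x :=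
      (Filter.eventually_all_finset Q).2 fun P _ => eventually_gt_atTop _
    filter_upwards [this, φ.eventually_sweep_atTop] with x hx hs
    change φ.sweep l x - _ = _
    rw [hs, Finset.filter_true_of_mem hx]
  have hB : ∀ᶠ x in atBot, F x = -φ.rayArea (-l) := by
    have : ∀ᶠ x in atBot, ∀ P ∈ Q, ¬ lev l P < x :=
      (Filter.eventually_all_finset Q).2 fun P _ =>
        (eventually_le_atBot (lev l P)).mono fun x hx => not_lt.2 hx
    filter_upwards [this, φ.eventually_sweep_atBot] with x hx hs
    change φ.sweep l x - _ = _
    rw [hs, Finset.filter_false_of_mem hx, Finset.sum_empty, sub_zero]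
  have := eq_of_eventually_const hF hA hB
  linarith

end

/-! ### Local contributions and the area of the dual polygon -/

section
variable {C : Set Plane} {Γ : TropicalCurve} {φ : PlaneMap Γ} {l : Fin 2 → ℤ}

theorem IsResolution.germs_eq_empty (h : IsResolution C φ) {P : Plane} (hP : P ∉ C) :
    φ.germs P = ∅ := by
  refine Finset.eq_empty_of_forall_notMem fun g hg => hP ?_
  rw [← h.range_image]
  exact φ.closedEdge_subset _ (PlaneMap.mem_germs.1 hg).mem_closedEdge

theorem IsResolution.sum_germs_eq_zero (hC : IsNodalTropicalCurve C) (h : IsResolution C φ)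
    (P : Plane) : ∑ g ∈ φ.germs P, φ.gdir g = 0 := by
  by_cases hP : P ∈ C
  · rcases hC.cases hP with ⟨a, ha, hc⟩ | ⟨a, b, hab, hc⟩ | ⟨v, u, hvu⟩
    · rw [h.sum_germs hc (primitive_of_mem_pair ha) fun d => d, sum_pair_neg _ ha, add_neg_cancel]
    · rw [h.sum_germs hc (primitive_of_mem_triple hab) fun d => d, sum_triple _ hab,
        add_neg_cancel]
    · rw [h.sum_germs hvu.localCone (primitive_of_mem_cross hvu.1 hvu.2.1) fun d => d,
        sum_cross _ hvu.1 hvu.2.1 hvu.2.2.1]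
      abel
  · rw [h.germs_eq_empty hP, Finset.sum_empty]

/-- The determinant of two vectors on the same side of the line spanned by `l`. -/
def sideArea (l d d' : Fin 2 → ℤ) : ℤ :=
  if 0 < det₂ l d * det₂ l d' then |det₂ d d'| else 0

theorem IsResolution.jump_eq_sum (h : IsResolution C φ) {P : Plane} {D : Finset (Fin 2 → ℤ)}
    (hc : LocalCone C P D) (hD : ∀ d ∈ D, IsPrimitive d) :
    φ.jump l P = ∑ d ∈ D, ∑ d' ∈ D, sideArea l d d' := by
  rw [← h.sum_germs hc hD fun d => ∑ d' ∈ D, sideArea l d d']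
  exact Finset.sum_congr rfl fun g _ => h.sum_germs hc hD (sideArea l (φ.gdir g))

theorem IsResolution.det_ne_zero (h : IsResolution C φ) (hl : ∀ e, det₂ l (φ.dir e) ≠ 0)
    {P : Plane} {D : Finset (Fin 2 → ℤ)} (hc : LocalCone C P D) (hD : ∀ d ∈ D, IsPrimitive d) :
    ∀ d ∈ D, det₂ l d ≠ 0 := by
  intro d hd
  rw [← h.image_germs hc hD] at hd
  obtain ⟨g, -, rfl⟩ := Finset.mem_image.1 hd
  exact φ.det_gdir_ne_zero hl g

theorem IsResolution.jump_of_isStraight (h : IsResolution C φ) {P : Plane}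
    (hP : IsStraight C P) : φ.jump l P = 0 := by
  obtain ⟨a, ha, hc⟩ := hP
  rw [h.jump_eq_sum hc (primitive_of_mem_pair ha)]
  simp only [sum_pair_neg _ ha, sideArea, det₂_neg_left, det₂_neg_right, det₂_self]
  simp

/-- Three nonzero numbers with sum zero split into two of one sign and one of the other. So exactly
one pair of directions lies on a common side of `l`; its determinant is ±1 and it is counted in both
orders. -/
theorem IsResolution.jump_of_isTri (h : IsResolution C φ) (hl : ∀ e, det₂ l (φ.dir e) ≠ 0)
    {P : Plane} (hP : IsTri C P) : φ.jump l P = 2 := by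
  obtain ⟨a, b, hab, hc⟩ := hP
  have hne := h.det_ne_zero hl hc (primitive_of_mem_triple hab)
  rw [h.jump_eq_sum hc (primitive_of_mem_triple hab)]
  have h1 := hne a (by simp)
  have h2 := hne b (by simp)
  have h3 := hne (-(a + b)) (by simp)
  have habs : |det₂ a b| = 1 := by rcases hab with h | h <;> simp [h]
  have habs' : |det₂ b a| = 1 := by rw [det₂_swap, abs_neg, habs]
  simp only [sum_triple _ hab, sideArea, det₂_neg_left, det₂_neg_right, det₂_add_left,
    det₂_add_right, det₂_self, add_zero, zero_add, abs_neg, abs_zero, habs, habs',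
    ite_self, mul_neg, neg_mul, neg_neg] at h1 h2 h3 ⊢
  generalize det₂ l a = α at *
  generalize det₂ l b = β at *
  rw [show -det₂ b a + -det₂ a b = 0 by rw [det₂_swap a b]; ring, abs_zero, ite_self, add_zero]
  have n1 : α + β ≠ 0 := fun h0 => h3 (by rw [h0, neg_zero])
  clear hne h3
  rcases h1.lt_or_gt with h1 | h1 <;> rcases h2.lt_or_gt with h2 | h2 <;>
    rcases n1.lt_or_gt with h3 | h3 <;>
    first
    | omega
    | simp [mul_pos_iff, mul_neg_iff, h1, h1.not_gt, h2, h2.not_gt, h3, h3.not_gt,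
        -neg_add_rev, -Left.neg_pos_iff]

/-- Each side of `l` contains one of `v`, `-v` and one of `u`, `-u`. This gives two pairs, each
counted in both orders. -/
theorem IsResolution.jump_of_isNode (h : IsResolution C φ) (hl : ∀ e, det₂ l (φ.dir e) ≠ 0)
    {P : Plane} (hP : IsNode C P) : φ.jump l P = 4 * nodeMultiplicity C P := by
  obtain ⟨v, u, hvu⟩ := hP
  have hne := h.det_ne_zero hl hvu.localCone (primitive_of_mem_cross hvu.1 hvu.2.1)
  rw [h.jump_eq_sum hvu.localCone (primitive_of_mem_cross hvu.1 hvu.2.1), hvu.nodeMultiplicity_eq,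
    Int.natCast_natAbs]
  have h1 := hne v (by simp)
  have h2 := hne u (by simp)
  have habs : |det₂ u v| = |det₂ v u| := by rw [det₂_swap, abs_neg]
  simp only [sum_cross _ hvu.1 hvu.2.1 hvu.2.2.1, sideArea, det₂_neg_left, det₂_neg_right,
    det₂_self, abs_neg, neg_zero, abs_zero, habs, ite_self, mul_neg, neg_mul, neg_neg]
  generalize det₂ l v = α at *
  generalize det₂ l u = β at *
  simp only [neg_pos, mul_pos_iff, mul_neg_iff]
  split_ifs <;> omega

theorem IsNode.exists_edges (h : IsResolution C φ) {P : Plane} (hP : IsNode C P) :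
    ∃ e f, det₂ (φ.dir e) (φ.dir f) ≠ 0 ∧ P ∈ φ.closedEdge e ∧ P ∈ φ.closedEdge f := by
  rw [← h.range_image] at hP
  obtain ⟨e, -, he⟩ := hP.exists_transversal (v := ![1, 0]) (by simp [IsPrimitive])
  obtain ⟨f, hd, hf⟩ := hP.exists_transversal (φ.primitive e)
  exact ⟨e, f, hd, he, hf⟩

theorem PlaneMap.inter_subsingleton (φ : PlaneMap Γ) {e f : Γ.E}
    (hd : det₂ (φ.dir e) (φ.dir f) ≠ 0) : (φ.closedEdge e ∩ φ.closedEdge f).Subsingleton := by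
  rintro P ⟨⟨t, -, -, ht⟩, s, -, -, hs⟩ Q ⟨⟨t', -, -, ht'⟩, s', -, -, hs'⟩
  have h1 : Q - P = (t' - t) • toReal (φ.dir e) := by
    rw [← ht, ← ht', PlaneMap.pt, PlaneMap.pt, add_sub_add_left_eq_sub, sub_smul]
  have h2 : Q - P = (s' - s) • toReal (φ.dir f) := by
    rw [← hs, ← hs', PlaneMap.pt, PlaneMap.pt, add_sub_add_left_eq_sub, sub_smul]
  by_cases h0 : s' - s = 0
  · rw [h0, zero_smul, sub_eq_zero] at h2
    exact h2.symm
  · exact absurd (det_zero_of_smul h0 (h2.symm.trans h1)) hd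

/-- Every node lies on two transversal edges, and two transversal edges meet at most once. -/
theorem IsResolution.finite_nodes (h : IsResolution C φ) : {P | IsNode C P}.Finite := by
  have := Γ.finiteE
  refine Set.Finite.subset (s := ⋃ e, ⋃ f, ⋃ _ : det₂ (φ.dir e) (φ.dir f) ≠ 0,
    φ.closedEdge e ∩ φ.closedEdge f) ?_ ?_
  · exact Set.finite_iUnion fun e => Set.finite_iUnion fun f => Set.finite_iUnion fun hd =>
      (φ.inter_subsingleton hd).finite
  · intro P hP
    obtain ⟨e, f, hd, he, hf⟩ := IsNode.exists_edges h hP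
    simp only [Set.mem_iUnion]
    exact ⟨e, f, hd, he, hf⟩

variable [Fintype Γ.E] [Fintype Γ.V]

open Classical in
/-- Twice the area of the dual polygon, computed from the rays, is the number of rays plus twice
the number of nodes. -/
theorem IsResolution.rayArea_add (hC : IsNodalTropicalCurve C) (h : IsResolution C φ)
    (hEV : Fintype.card Γ.E = Fintype.card Γ.V) : ∃ δ : ℕ, (δ : ℕ∞) ≤ nodeCount C ∧
      ∀ l, (∀ e, det₂ l (φ.dir e) ≠ 0) → φ.rayArea l + φ.rayArea (-l) =
        2 * (Finset.univ.filter fun w => Γ.IsInfinite w).card + 4 * δ := by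
  obtain ⟨T, hT, hcard⟩ := h.exists_tri_finset hC hEV
  set N : Finset Plane := h.finite_nodes.toFinset with hN
  have hmem : ∀ P, P ∈ N ↔ IsNode C P := fun P => by simp [hN]
  refine ⟨∑ P ∈ N, nodeMultiplicity C P, ?_, fun l hl => ?_⟩
  · push_cast
    exact le_iSup (fun s : Finset Plane => ∑ p ∈ s, (nodeMultiplicity C p : ℕ∞)) N
  · have hdisj : Disjoint T N := Finset.disjoint_left.2 fun P h1 h2 =>
      h.not_isTri_of_isNode ((hmem P).1 h2) ((hT P).1 h1)
    rw [← φ.sum_jump hl (h.sum_germs_eq_zero hC) (T ∪ N) fun P hP => ?_,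
      Finset.sum_union hdisj, Finset.sum_congr rfl fun P hP => h.jump_of_isTri hl ((hT P).1 hP),
      Finset.sum_congr rfl fun P hP => h.jump_of_isNode hl ((hmem P).1 hP), Finset.sum_const,
      hcard, ← Finset.mul_sum]
    · simp only [nsmul_eq_mul]
      push_cast
      ring
    · simp only [Finset.mem_union, hT, hmem, not_or] at hP
      by_cases hPC : P ∈ C
      · rcases hC.cases hPC with h1 | h1 | h1
        · exact h.jump_of_isStraight h1
        · exact absurd h1 hP.1
        · exact absurd h1 hP.2
      · rw [PlaneMap.jump, h.germs_eq_empty hPC, Finset.sum_empty]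

end

/-! ### Scott's inequality for balanced collections of primitive vectors -/

section
variable {ι : Type*} (s : Finset ι) (u : ι → Fin 2 → ℤ)

/-- The width of the dual polygon in the direction `w`. -/
def width (w : Fin 2 → ℤ) : ℤ := ∑ i ∈ s with 0 < det₂ w (u i), det₂ w (u i)

/-- The sum of the determinants of all pairs of vectors on the positive side of `l`. -/
def upArea (l : Fin 2 → ℤ) : ℤ :=
  ∑ i ∈ s with 0 < det₂ l (u i), ∑ j ∈ s with 0 < det₂ l (u j), |det₂ (u i) (u j)|

/-- The sum of the vectors on the positive side of `l`. -/
def upSum (l : Fin 2 → ℤ) : Fin 2 → ℤ := ∑ i ∈ s with 0 < det₂ l (u i), u i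

theorem abs_det₂_swap (v w : Fin 2 → ℤ) : |det₂ v w| = |det₂ w v| := by
  rw [det₂_swap, abs_neg]

/-- A functional close to `det₂ w` that does not vanish on a given finite set of vectors. -/
theorem exists_perturbation {w z : Fin 2 → ℤ} (hwz : det₂ w z ≠ 0) (U : Finset (Fin 2 → ℤ))
    (hU : 0 ∉ U) : ∃ l, ∀ v ∈ U, det₂ l v ≠ 0 ∧
      (0 < det₂ l v ↔ 0 < det₂ w v ∨ det₂ w v = 0 ∧ 0 < det₂ z v) := by
  obtain ⟨N, hN⟩ : ∃ N : ℤ, ∀ v ∈ U, |det₂ z v| < N := by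
    refine ⟨∑ v ∈ U, |det₂ z v| + 1, fun v hv => ?_⟩
    have : |det₂ z v| ≤ ∑ v ∈ U, |det₂ z v| :=
      Finset.single_le_sum (f := fun v => |det₂ z v|) (fun v _ => abs_nonneg _) hv
    omega
  -- `N` exceeds every `|det₂ z v|`, so the sign is decided by `w` wherever `det₂ w v` is nonzero,
  -- and `z` only breaks ties.
  refine ⟨N • w + z, fun v hv => ?_⟩
  have h1 : det₂ (N • w + z) v = N * det₂ w v + det₂ z v := by
    simp only [det₂, Pi.add_apply, Pi.smul_apply, smul_eq_mul]; ring
  have h2 := abs_lt.1 (hN v hv)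
  rw [h1]
  rcases lt_trichotomy (det₂ w v) 0 with h | h | h
  · have : N * det₂ w v + det₂ z v < 0 := by nlinarith
    exact ⟨this.ne, iff_of_false this.not_gt (by omega)⟩
  · have hz : det₂ z v ≠ 0 := by
      intro h0
      apply hU
      have : v = 0 := by
        unfold det₂ at h h0 hwz
        funext i
        fin_cases i
        · refine mul_left_cancel₀ hwz ?_
          simp only [Fin.zero_eta, Pi.zero_apply]
          linear_combination z 0 * h - w 0 * h0
        · refine mul_left_cancel₀ hwz ?_
          simp only [Fin.mk_one, Pi.zero_apply]
          linear_combination z 1 * h - w 1 * h0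
      rwa [this] at hv
    simp [h, hz]
  · have : 0 < N * det₂ w v + det₂ z v := by nlinarith
    exact ⟨this.ne', iff_of_true this (Or.inl h)⟩

theorem sum_sum_split (X : Finset ι) (p : ι → Prop) [DecidablePred p] (f : ι → ι → ℤ)
    (hf : ∀ i j, f i j = f j i) : ∑ i ∈ X, ∑ j ∈ X, f i j =
      (∑ i ∈ X with p i, ∑ j ∈ X with p j, f i j) +
      (∑ i ∈ X with ¬ p i, ∑ j ∈ X with ¬ p j, f i j) +
      2 * ∑ i ∈ X with p i, ∑ j ∈ X with ¬ p j, f i j := by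
  have h1 : ∀ i, ∑ j ∈ X, f i j = (∑ j ∈ X with p j, f i j) + ∑ j ∈ X with ¬ p j, f i j :=
    fun i => (Finset.sum_filter_add_sum_filter_not X p _).symm
  simp_rw [h1]
  rw [← Finset.sum_filter_add_sum_filter_not X p]
  simp only [Finset.sum_add_distrib]
  rw [Finset.sum_comm (s := X.filter fun i => ¬ p i) (t := X.filter p)]
  simp_rw [hf]
  ring

/-- Pairs with one member in each class occur in both orders; the triangle inequality does the rest.
For a convex chain this compares a triangle on its chord with the region cut off by the chord. -/
theorem two_mul_abs_det_le (X : Finset ι) (p : ι → Prop) [DecidablePred p] :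
    2 * |det₂ (∑ i ∈ X with p i, u i) (∑ i ∈ X with ¬ p i, u i)| ≤
      ∑ i ∈ X, ∑ j ∈ X, |det₂ (u i) (u j)| := by
  rw [sum_sum_split X p _ fun i j => abs_det₂_swap _ _, det₂_sum_left]
  simp_rw [det₂_sum_right]
  have h1 : 0 ≤ ∑ i ∈ X with p i, ∑ j ∈ X with p j, |det₂ (u i) (u j)| :=
    Finset.sum_nonneg fun _ _ => Finset.sum_nonneg fun _ _ => abs_nonneg _
  have h2 : 0 ≤ ∑ i ∈ X with ¬ p i, ∑ j ∈ X with ¬ p j, |det₂ (u i) (u j)| :=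
    Finset.sum_nonneg fun _ _ => Finset.sum_nonneg fun _ _ => abs_nonneg _
  have h3 : |∑ i ∈ X with p i, ∑ j ∈ X with ¬ p j, det₂ (u i) (u j)| ≤
      ∑ i ∈ X with p i, ∑ j ∈ X with ¬ p j, |det₂ (u i) (u j)| :=
    (Finset.abs_sum_le_sum_abs _ _).trans
      (Finset.sum_le_sum fun _ _ => Finset.abs_sum_le_sum_abs _ _)
  linarith

variable {s u}

theorem width_nonneg (w : Fin 2 → ℤ) : 0 ≤ width s u w :=
  Finset.sum_nonneg fun _ hi => (Finset.mem_filter.1 hi).2.le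

theorem width_neg (hsum : ∑ i ∈ s, u i = 0) (w : Fin 2 → ℤ) :
    width s u (-w) = width s u w := by
  have h1 : ∑ i ∈ s, det₂ w (u i) = 0 := by
    rw [← det₂_sum_right, hsum]; simp [det₂]
  have h2 : ∀ i, det₂ w (u i) = (if 0 < det₂ w (u i) then det₂ w (u i) else 0) -
      if 0 < -det₂ w (u i) then -det₂ w (u i) else 0 := fun i => by
    split_ifs <;> omega
  rw [Finset.sum_congr rfl fun i _ => h2 i, Finset.sum_sub_distrib] at h1
  simp only [width, Finset.sum_filter, det₂_neg_left]
  linarith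

theorem sum_det_le_width (w : Fin 2 → ℤ) {t : Finset ι} (ht : t ⊆ s) :
    ∑ i ∈ t, det₂ w (u i) ≤ width s u w := by
  rw [width, Finset.sum_filter]
  have h1 : ∑ i ∈ t, det₂ w (u i) ≤ ∑ i ∈ t, if 0 < det₂ w (u i) then det₂ w (u i) else 0 :=
    Finset.sum_le_sum fun i _ => by split_ifs <;> omega
  exact h1.trans (Finset.sum_le_sum_of_subset_of_nonneg ht fun i _ _ => by split_ifs <;> omega)

theorem card_pos_le_width (w : Fin 2 → ℤ) :
    ((s.filter fun i => 0 < det₂ w (u i)).card : ℤ) ≤ width s u w := by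
  rw [Finset.card_eq_sum_ones, Nat.cast_sum, width]
  exact Finset.sum_le_sum fun i hi => by
    have := (Finset.mem_filter.1 hi).2
    push_cast
    omega

theorem eq_or_neg_of_det_zero (hprim : ∀ i ∈ s, IsPrimitive (u i)) {w : Fin 2 → ℤ}
    (hw : IsPrimitive w) {i : ι} (hi : i ∈ s) (h : det₂ w (u i) = 0) : u i = w ∨ u i = -w :=
  eq_or_neg_of_det hw (hprim i hi) h

/-- A vector not parallel to `w` contributes at least one to the width on its side, and by balancing
both sides have the same total. -/
theorem card_le_width (hprim : ∀ i ∈ s, IsPrimitive (u i)) (hsum : ∑ i ∈ s, u i = 0)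
    {w : Fin 2 → ℤ} (hw : IsPrimitive w) :
    (s.card : ℤ) ≤ (s.filter fun i => u i = w).card + (s.filter fun i => u i = -w).card +
      2 * width s u w := by
  classical
  have h1 := card_pos_le_width (s := s) (u := u) w
  have h2 := card_pos_le_width (s := s) (u := u) (-w)
  rw [width_neg hsum] at h2
  have h3 : s ⊆ (s.filter fun i => u i = w) ∪ (s.filter fun i => u i = -w) ∪
      (s.filter fun i => 0 < det₂ w (u i)) ∪ s.filter fun i => 0 < det₂ (-w) (u i) := by
    intro i hi
    simp only [Finset.mem_union, Finset.mem_filter, hi, true_and, det₂_neg_left]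
    rcases lt_trichotomy (det₂ w (u i)) 0 with h | h | h
    · right; omega
    · have := eq_or_neg_of_det_zero hprim hw hi h
      tauto
    · left; right; exact h
  have h4 := Finset.card_le_card h3
  have h5 := Finset.card_union_le ((s.filter fun i => u i = w) ∪ (s.filter fun i => u i = -w) ∪
      (s.filter fun i => 0 < det₂ w (u i))) (s.filter fun i => 0 < det₂ (-w) (u i))
  have h6 := Finset.card_union_le ((s.filter fun i => u i = w) ∪ (s.filter fun i => u i = -w))
      (s.filter fun i => 0 < det₂ w (u i))
  have h7 := Finset.card_union_le (s.filter fun i => u i = w) (s.filter fun i => u i = -w)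
  omega

/-- The area on the positive side of a small perturbation of `det₂ w`. -/
theorem upArea_perturbation (hprim : ∀ i ∈ s, IsPrimitive (u i)) {w z l : Fin 2 → ℤ}
    (hw : IsPrimitive w) (hzw : 0 < det₂ z w)
    (hl : ∀ i ∈ s, (0 < det₂ l (u i) ↔ 0 < det₂ w (u i) ∨ det₂ w (u i) = 0 ∧ 0 < det₂ z (u i))) :
    upArea s u l = (∑ i ∈ s with 0 < det₂ w (u i), ∑ j ∈ s with 0 < det₂ w (u j),
      |det₂ (u i) (u j)|) + 2 * (width s u w * (s.filter fun i => u i = w).card) := by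
  have h1 : (s.filter fun i => 0 < det₂ l (u i)).filter (fun i => 0 < det₂ w (u i)) =
      s.filter fun i => 0 < det₂ w (u i) := by
    ext i
    simp only [Finset.mem_filter]
    exact ⟨fun h => ⟨h.1.1, h.2⟩, fun h => ⟨⟨h.1, (hl i h.1).2 (Or.inl h.2)⟩, h.2⟩⟩
  have h2 : (s.filter fun i => 0 < det₂ l (u i)).filter (fun i => ¬ 0 < det₂ w (u i)) =
      s.filter fun i => u i = w := by
    ext i
    simp only [Finset.mem_filter]
    constructor
    · rintro ⟨⟨hi, h3⟩, h4⟩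
      rcases (hl i hi).1 h3 with h5 | ⟨h5, h6⟩
      · exact absurd h5 h4
      · rcases eq_or_neg_of_det_zero hprim hw hi h5 with h7 | h7
        · exact ⟨hi, h7⟩
        · rw [h7, det₂_neg_right] at h6
          omega
    · rintro ⟨hi, h3⟩
      have h4 : det₂ w (u i) = 0 := by rw [h3, det₂_self]
      exact ⟨⟨hi, (hl i hi).2 (Or.inr ⟨h4, by rwa [h3]⟩)⟩, by omega⟩
  rw [upArea, sum_sum_split _ (fun i => 0 < det₂ w (u i)) _ fun i j => abs_det₂_swap _ _, h1, h2]
  have h3 : ∑ i ∈ s with u i = w, ∑ j ∈ s with u j = w, |det₂ (u i) (u j)| = 0 :=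
    Finset.sum_eq_zero fun i hi => Finset.sum_eq_zero fun j hj => by
      rw [(Finset.mem_filter.1 hi).2, (Finset.mem_filter.1 hj).2, det₂_self, abs_zero]
  have h4 : ∑ i ∈ s with 0 < det₂ w (u i), ∑ j ∈ s with u j = w, |det₂ (u i) (u j)| =
      width s u w * (s.filter fun i => u i = w).card := by
    rw [width, Finset.sum_mul]
    refine Finset.sum_congr rfl fun i hi => ?_
    rw [Finset.sum_congr rfl fun j hj => by
      rw [(Finset.mem_filter.1 hj).2, abs_det₂_swap, abs_of_pos (Finset.mem_filter.1 hi).2],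
      Finset.sum_const, nsmul_eq_mul, mul_comm]
  rw [h3, h4, add_zero]

/-- `upSum` is a chord joining two opposite extreme vertices of the dual polygon. If the polygon has
edges parallel to `w`, the tie-breaker `z` chooses among their ends, which adds all the edge vectors
equal to `v`. -/
theorem upSum_perturbation (hprim : ∀ i ∈ s, IsPrimitive (u i)) {w z l v : Fin 2 → ℤ}
    (hw : IsPrimitive w) (hv : v = w ∨ v = -w) (hzv : 0 < det₂ z v)
    (hl : ∀ i ∈ s, (0 < det₂ l (u i) ↔ 0 < det₂ w (u i) ∨ det₂ w (u i) = 0 ∧ 0 < det₂ z (u i))) :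
    upSum s u l = upSum s u w + ((s.filter fun i => u i = v).card : ℤ) • v := by
  have h0 : ∑ i ∈ s with u i = v, u i = ((s.filter fun i => u i = v).card : ℤ) • v := by
    rw [Finset.sum_congr rfl fun i hi => (Finset.mem_filter.1 hi).2, Finset.sum_const,
      natCast_zsmul]
  have hwv : det₂ w v = 0 := by
    rcases hv with rfl | rfl
    · exact det₂_self v
    · rw [det₂_neg_right, det₂_self, neg_zero]
  rw [← h0, upSum, upSum, Finset.sum_filter, Finset.sum_filter, Finset.sum_filter,
    ← Finset.sum_add_distrib]
  refine Finset.sum_congr rfl fun i hi => ?_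
  by_cases h1 : 0 < det₂ w (u i)
  · have h2 : u i ≠ v := fun h => by rw [h, hwv] at h1; omega
    rw [if_pos ((hl i hi).2 (Or.inl h1)), if_pos h1, if_neg h2, add_zero]
  · rw [if_neg h1, zero_add]
    by_cases h2 : u i = v
    · rw [if_pos h2, if_pos ((hl i hi).2 (Or.inr ⟨by rw [h2, hwv], by rwa [h2]⟩))]
    · rw [if_neg h2, if_neg]
      intro h3
      rcases (hl i hi).1 h3 with h5 | ⟨h5, h6⟩
      · exact h1 h5
      · have h7 : u i = -v := by
          have := eq_or_neg_of_det_zero hprim hw hi h5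
          rcases hv with rfl | rfl
          · tauto
          · rw [neg_neg]; tauto
        rw [h7, det₂_neg_right] at h6
        omega

/-- The determinant of two chords is twice the signed area of the quadrilateral having them as
diagonals, which is inscribed in the polygon. In the proof `a`, `b`, `c`, `d` are its sides; the
chord of `l` is `a + b`, that of `m` is `a + c`, and the chord of `l` cuts the quadrilateral into
two triangles, one on each side. -/
theorem det_upSum_le (hsum : ∑ i ∈ s, u i = 0) {l m : Fin 2 → ℤ}
    (hl : ∀ i ∈ s, det₂ l (u i) ≠ 0) :
    2 * det₂ (upSum s u l) (upSum s u m) ≤ upArea s u l + upArea s u (-l) := by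
  have h1 := two_mul_abs_det_le u (s.filter fun i => 0 < det₂ l (u i))
    (fun i => 0 < det₂ m (u i))
  have h2 := two_mul_abs_det_le u (s.filter fun i => 0 < det₂ (-l) (u i))
    (fun i => 0 < det₂ m (u i))
  set a := ∑ i ∈ s.filter (fun i => 0 < det₂ l (u i)) with 0 < det₂ m (u i), u i
  set b := ∑ i ∈ s.filter (fun i => 0 < det₂ l (u i)) with ¬ 0 < det₂ m (u i), u i
  set c := ∑ i ∈ s.filter (fun i => 0 < det₂ (-l) (u i)) with 0 < det₂ m (u i), u i
  set d := ∑ i ∈ s.filter (fun i => 0 < det₂ (-l) (u i)) with ¬ 0 < det₂ m (u i), u i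
  have hneg : s.filter (fun i => 0 < det₂ (-l) (u i)) = s.filter fun i => ¬ 0 < det₂ l (u i) :=
    Finset.filter_congr fun i hi => by
      have := hl i hi
      rw [det₂_neg_left]
      omega
  have hab : upSum s u l = a + b := (Finset.sum_filter_add_sum_filter_not _ _ _).symm
  have hcd : c + d = -(a + b) := by
    rw [eq_neg_iff_add_eq_zero, ← hab, add_comm, ← hsum,
      ← Finset.sum_filter_add_sum_filter_not s fun i => 0 < det₂ l (u i), ← hneg]
    congr 1
    exact Finset.sum_filter_add_sum_filter_not _ _ _
  have hac : upSum s u m = a + c := by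
    rw [upSum, ← Finset.sum_filter_add_sum_filter_not _ fun i => 0 < det₂ l (u i),
      Finset.filter_comm, Finset.filter_comm (fun i => 0 < det₂ m (u i)), ← hneg]
  have hd : d = -(a + b) - c := by rw [← hcd]; abel
  have key : det₂ (a + b) (a + c) = -det₂ a b + det₂ c d := by
    rw [hd]
    simp only [det₂, Pi.add_apply, Pi.sub_apply, Pi.neg_apply]
    ring
  rw [hab, hac, key]
  have h3 := neg_le_abs (det₂ a b)
  have h4 := le_abs_self (det₂ c d)
  unfold upArea
  linarith

/-- Scott's inequality. -/
theorem scott_inequality (hprim : ∀ i ∈ s, IsPrimitive (u i)) (hsum : ∑ i ∈ s, u i = 0)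
    (U : Finset (Fin 2 → ℤ)) (hU : 0 ∉ U) (hsU : ∀ i ∈ s, u i ∈ U) {W : ℤ}
    (hW : ∀ l, (∀ v ∈ U, det₂ l v ≠ 0) → upArea s u l + upArea s u (-l) = 2 * W)
    (hcard : 10 ≤ s.card) (hWcard : (s.card : ℤ) ≤ W) : 2 * (s.card : ℤ) ≤ W + 8 := by
  -- Here `w` is a direction of minimal lattice width `p`; below, `q` and `q'` are the lattice
  -- lengths of the two sides of the polygon parallel to it.
  obtain ⟨w, hw, hmin⟩ : ∃ w, IsPrimitive w ∧
      ∀ z, IsPrimitive z → width s u w ≤ width s u z := by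
    have hne : {n : ℕ | ∃ w, IsPrimitive w ∧ (n : ℤ) = width s u w}.Nonempty :=
      ⟨(width s u ![1, 0]).toNat, ![1, 0], by simp [IsPrimitive],
        Int.toNat_of_nonneg (width_nonneg _)⟩
    obtain ⟨w, hw, he⟩ := Nat.sInf_mem hne
    refine ⟨w, hw, fun z hz => ?_⟩
    rw [← he, ← Int.toNat_of_nonneg (width_nonneg (s := s) (u := u) z), Nat.cast_le]
    exact Nat.sInf_le ⟨z, hz, Int.toNat_of_nonneg (width_nonneg _)⟩
  obtain ⟨z₀, hz₀⟩ := exists_det_eq_one hw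
  set p := width s u w with hp
  set q : ℤ := ((s.filter fun i => u i = w).card : ℤ) with hq
  set q' : ℤ := ((s.filter fun i => u i = -w).card : ℤ) with hq'
  have hp0 : 0 ≤ p := width_nonneg w
  have hq0 : 0 ≤ q := Nat.cast_nonneg _
  have hq0' : 0 ≤ q' := Nat.cast_nonneg _
  have hr : (s.card : ℤ) ≤ q + q' + 2 * p := card_le_width hprim hsum hw
  -- the area in terms of the width
  obtain ⟨l₁, hl₁⟩ := exists_perturbation (w := w) (z := -z₀)
    (by rw [det₂_neg_right, hz₀]; norm_num) U hU
  obtain ⟨l₂, hl₂⟩ := exists_perturbation (w := w) (z := z₀) (by rw [hz₀]; norm_num) U hU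
  have hl₁' := fun i hi => (hl₁ (u i) (hsU i hi)).2
  have hl₂' := fun i hi => (hl₂ (u i) (hsU i hi)).2
  have hz₀' : det₂ z₀ w = -1 := by rw [det₂_swap, hz₀]
  have hzw : 0 < det₂ (-z₀) w := by rw [det₂_neg_left, hz₀']; norm_num
  have hzw' : 0 < det₂ z₀ (-w) := by rw [det₂_neg_right, hz₀']; norm_num
  have hA₁ := upArea_perturbation hprim hw hzw hl₁'
  have hA₂ := upArea_perturbation (w := -w) (z := z₀) (l := -l₁) hprim hw.neg hzw' fun i hi => by
    have h1 := hl₁ (u i) (hsU i hi)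
    simp only [det₂_neg_left] at h1 ⊢
    have h2 := h1.1
    have h3 := h1.2
    have h4 : det₂ w (u i) = 0 → det₂ z₀ (u i) ≠ 0 := by
      intro h5 h6
      rcases eq_or_neg_of_det_zero hprim hw hi h5 with h7 | h7 <;> rw [h7] at h6
      · omega
      · rw [det₂_neg_right] at h6
        omega
    omega
  rw [width_neg hsum] at hA₂
  have hWA := hW l₁ fun v hv => (hl₁ v hv).1
  rw [hA₁, hA₂, ← hp, ← hq, ← hq'] at hWA
  set I₁ := ∑ i ∈ s with 0 < det₂ w (u i), ∑ j ∈ s with 0 < det₂ w (u j), |det₂ (u i) (u j)|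
    with hI₁
  set I₂ := ∑ i ∈ s with 0 < det₂ (-w) (u i), ∑ j ∈ s with 0 < det₂ (-w) (u j),
    |det₂ (u i) (u j)| with hI₂
  have hI₁0 : 0 ≤ I₁ := Finset.sum_nonneg fun _ _ => Finset.sum_nonneg fun _ _ => abs_nonneg _
  have hI₂0 : 0 ≤ I₂ := Finset.sum_nonneg fun _ _ => Finset.sum_nonneg fun _ _ => abs_nonneg _
  -- The left-hand side is twice the area of the trapezoid spanned by the two sides parallel to `w`.
  have hWpH : p * (q + q') ≤ W := by linarith
  have hcard' : (10 : ℤ) ≤ s.card := by exact_mod_cast hcard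
  -- the width is at least two
  have hp2 : 2 ≤ p := by
    by_contra hlt
    have hsmall : ∀ w', width s u w' = p →
        ∑ i ∈ s with 0 < det₂ w' (u i), ∑ j ∈ s with 0 < det₂ w' (u j), |det₂ (u i) (u j)| = 0 := by
      intro w' hw'
      have h1 := card_pos_le_width (s := s) (u := u) w'
      have h2 : (s.filter fun i => 0 < det₂ w' (u i)).card ≤ 1 := by
        rw [hw'] at h1
        omega
      rw [Finset.card_le_one] at h2
      exact Finset.sum_eq_zero fun i hi => Finset.sum_eq_zero fun j hj => by
        rw [h2 i hi j hj, det₂_self, abs_zero]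
    have h1 : I₁ = 0 := hsmall w rfl
    have h2 : I₂ = 0 := hsmall (-w) (width_neg hsum w)
    rw [h1, h2] at hWA
    -- No pair off the line of `w` contributes any more, so `W = p (q + q')`. For `p = 0` this is
    -- smaller than the number of vectors; for `p = 1` the assumption that `W` is at least that
    -- number forces all vectors to be `±w`, and then the width is zero.
    obtain h3 | h3 : p = 0 ∨ p = 1 := by omega
    · rw [h3] at hWA
      omega
    · rw [h3] at hWA
      have hdisj : Disjoint (s.filter fun i => u i = w) (s.filter fun i => u i = -w) :=
        Finset.disjoint_filter.2 fun i _ h4 h5 => hw.ne_neg (h4.symm.trans h5)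
      classical
      have hsub : (s.filter fun i => u i = w) ∪ (s.filter fun i => u i = -w) ⊆ s :=
        Finset.union_subset (Finset.filter_subset _ _) (Finset.filter_subset _ _)
      have hss := Finset.eq_of_subset_of_card_le hsub (by
        rw [Finset.card_union_of_disjoint hdisj]
        have : ((s.card : ℕ) : ℤ) ≤ q + q' := by linarith
        rw [hq, hq'] at this
        exact_mod_cast this)
      have : p = 0 := by
        rw [hp, width]
        refine Finset.sum_eq_zero fun i hi => ?_
        obtain ⟨hi, h5⟩ := Finset.mem_filter.1 hi
        rw [← hss, Finset.mem_union, Finset.mem_filter, Finset.mem_filter] at hi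
        rcases hi with ⟨-, h4⟩ | ⟨-, h4⟩ <;> rw [h4] at h5 ⊢ <;>
          simp [det₂_neg_right, det₂_self]
      omega
  -- For `p = 2` and `p = 3` the trapezoid suffices. The case `p = 3` needs at least ten vectors:
  -- the triangle of side three has width 3, nine boundary points and `W = 9`.
  obtain h | h | h : p = 2 ∨ p = 3 ∨ 4 ≤ p := by omega
  · rw [h] at hWpH hr
    linarith
  · rw [h] at hWpH hr
    linarith
  by_cases hH : 4 ≤ q + q'
  -- From `(p - 2)(q + q' - 4) ≥ 0` one gets `W ≥ p (q + q') ≥ 2(q + q' + 2p) - 8`.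
  · linarith [mul_nonneg (sub_nonneg.2 hp2) (sub_nonneg.2 hH)]
  -- a second direction
  set k := (2 * det₂ (upSum s u w) z₀ + q - q' + p) / (2 * p) with hk
  set z := z₀ + k • w with hz
  have hwz : det₂ w z = 1 := by
    rw [← hz₀, hz]
    simp only [det₂, Pi.add_apply, Pi.smul_apply, smul_eq_mul]
    ring
  have hzprim : IsPrimitive z := isPrimitive_of_det_eq (b := w) (by
    rw [det₂_swap, hwz]; right; rfl)
  obtain ⟨m, hm⟩ := exists_perturbation (w := z) (z := w)
    (by rw [det₂_swap, hwz]; norm_num) U hU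
  have hp' := hmin z hzprim
  have hwR : det₂ w (upSum s u w) = p := by rw [upSum, det₂_sum_right]; rfl
  have hzm : det₂ z (upSum s u m) = width s u z := by
    rw [upSum, det₂_sum_right, width, Finset.sum_filter, Finset.sum_filter]
    refine Finset.sum_congr rfl fun i hi => ?_
    have h1 := (hm (u i) (hsU i hi)).2
    split_ifs <;> omega
  have hh : det₂ w (upSum s u m) ≤ p := by
    rw [upSum, det₂_sum_right]
    exact sum_det_le_width w (Finset.filter_subset _ _)
  have hh' : -det₂ w (upSum s u m) ≤ p := by
    rw [upSum, det₂_sum_right, hp, ← width_neg hsum w, ← Finset.sum_neg_distrib]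
    simp_rw [← det₂_neg_left]
    exact sum_det_le_width (-w) (Finset.filter_subset _ _)
  set x := det₂ w (upSum s u m) with hx
  have plucker : ∀ R S : Fin 2 → ℤ, det₂ R S * det₂ w z =
      det₂ R z * det₂ w S + det₂ w R * det₂ z S := fun R S => by
    simp only [det₂]; ring
  have hRz : det₂ (upSum s u w) z = det₂ (upSum s u w) z₀ - k * p := by
    rw [← hwR, hz]
    simp only [det₂, Pi.add_apply, Pi.smul_apply, smul_eq_mul]
    ring
  have hup₁ := upSum_perturbation hprim hw (Or.inl rfl) hzw hl₁'
  have hup₂ : upSum s u l₂ = upSum s u w + (-q') • w := by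
    rw [upSum_perturbation hprim hw (Or.inr rfl) hzw' hl₂', neg_smul, ← smul_neg]
  have hWm : ∀ l, (∀ v ∈ U, det₂ l v ≠ 0) → det₂ (upSum s u l) (upSum s u m) ≤ W := by
    intro l hl
    have h1 := det_upSum_le (m := m) hsum fun i hi => hl _ (hsU i hi)
    rw [hW l hl] at h1
    linarith
  have hW₁ := hWm l₁ fun v hv => (hl₁ v hv).1
  have hW₂ := hWm l₂ fun v hv => (hl₂ v hv).1
  -- The values `t = q` and `t = -q'` give two chords between the sides parallel to `w`. Each is
  -- paired with a chord realizing the width in the direction `z`, which is at least `p` by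
  -- minimality.
  have e : ∀ t : ℤ, det₂ (upSum s u w + t • w) (upSum s u m) =
      (det₂ (upSum s u w) z + t) * x + p * width s u z := by
    intro t
    have h1 := plucker (upSum s u w + t • w) (upSum s u m)
    have h2 : det₂ (upSum s u w + t • w) z = det₂ (upSum s u w) z + t * det₂ w z := by
      simp only [det₂, Pi.add_apply, Pi.smul_apply, smul_eq_mul]; ring
    have h3 : det₂ w (upSum s u w + t • w) = det₂ w (upSum s u w) := by
      simp only [det₂, Pi.add_apply, Pi.smul_apply, smul_eq_mul]; ring
    rw [h2, h3, hwz, hwR, hzm] at h1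
    linarith
  rw [hup₁, e] at hW₁
  rw [hup₂, e] at hW₂
  rw [hRz] at hW₁ hW₂
  -- Replacing `z₀` by `z₀ + k • w` shears the polygon; `k` is the rounded quotient for which `2μ +
  -- q - q'` lies in `[-p, p)`, so that the two sides parallel to `w` are nearly centred on each
  -- other.
  have hdiv := Int.emod_add_mul_ediv (2 * det₂ (upSum s u w) z₀ + q - q' + p) (2 * p)
  have hmod0 := Int.emod_nonneg (2 * det₂ (upSum s u w) z₀ + q - q' + p)
    (show 2 * p ≠ 0 by omega)
  have hmod1 := Int.emod_lt_of_pos (2 * det₂ (upSum s u w) z₀ + q - q' + p)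
    (show 0 < 2 * p by omega)
  rw [← hk] at hdiv
  set μ := det₂ (upSum s u w) z₀ - k * p with hμ
  have hM1 : -p ≤ 2 * μ + q - q' := by linarith
  have hM2 : 2 * μ + q - q' ≤ p := by linarith
  -- The sign of `x` decides which of the two chords gives the larger quadrilateral. The estimate
  -- then uses `|x| ≤ p` and `q + q' ≤ p`.
  have key : p * p + p * (q + q') ≤ 2 * W := by
    rcases le_total 0 x with hx0 | hx0
    · linarith [mul_le_mul_of_nonneg_left hp' hp0, mul_nonneg (sub_nonneg.2 hM1) hx0,
        mul_nonneg (show 0 ≤ p - (q + q') by omega) (sub_nonneg.2 hh)]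
    · linarith [mul_le_mul_of_nonneg_left hp' hp0,
        mul_nonneg (sub_nonneg.2 hM2) (neg_nonneg.2 hx0),
        mul_nonneg (show 0 ≤ p - (q + q') by omega) (sub_nonneg.2 hh')]
  -- What remains is `(p - 4)² + (q + q')(p - 4) ≥ 0`.
  linarith [sq_nonneg (p - 4), mul_nonneg (show 0 ≤ q + q' by omega) (sub_nonneg.2 h)]

end

/-! ### Invariants of modifications and the lower bound -/

theorem IsSubdivision.card_eq {Γ Γ' : TropicalCurve} (h : IsSubdivision Γ Γ') :
    Nat.card Γ'.E = Nat.card Γ.E + 1 ∧ Nat.card Γ'.V = Nat.card Γ.V + 1 ∧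
      {v | Γ'.IsInfinite v}.ncard = {v | Γ.IsInfinite v}.ncard := by
  have := Γ.finiteE
  have := Γ.finiteV
  obtain ⟨e₀, u, w, f, g, -, -, -, -, -, hinf, hnone⟩ := h
  refine ⟨by rw [← Nat.card_congr g, Finite.card_option], by
    rw [← Nat.card_congr f, Finite.card_option], ?_⟩
  rw [← Set.ncard_image_of_injective {v | Γ.IsInfinite v}
    (f.injective.comp (Option.some_injective _))]
  congr 1
  ext v
  obtain ⟨_ | v, rfl⟩ := f.surjective v
  · simp [hnone]
  · simp [hinf]

theorem IsElementaryModification.card_eq {Γ Γ' : TropicalCurve}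
    (h : IsElementaryModification Γ Γ') :
    Nat.card Γ'.E = Nat.card Γ.E + 1 ∧ Nat.card Γ'.V = Nat.card Γ.V + 1 ∧
      {v | Γ.IsInfinite v}.ncard ≤ {v | Γ'.IsInfinite v}.ncard := by
  have := Γ.finiteE
  have := Γ.finiteV
  have := Γ'.finiteV
  obtain ⟨u, f, g, -, -, -, -, hinf, -⟩ := h
  refine ⟨by rw [← Nat.card_congr g, Finite.card_option], by
    rw [← Nat.card_congr f, Finite.card_option], ?_⟩
  rw [← Set.ncard_image_of_injective {v | Γ.IsInfinite v}
    (f.injective.comp (Option.some_injective _))]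
  refine Set.ncard_le_ncard ?_
  rintro _ ⟨v, hv, rfl⟩
  exact (hinf v).2 hv

/-- Every elementary step changes the numbers of edges and of vertices by the same amount. A
subdivision adds a finite vertex, so its reverse removes no infinite one. -/
theorem IsModification.card {Γ Γ' : TropicalCurve} (h : IsModification Γ Γ')
    (hEV : Nat.card Γ.E = Nat.card Γ.V) : Nat.card Γ'.E = Nat.card Γ'.V ∧
      {v | Γ.IsInfinite v}.ncard ≤ {v | Γ'.IsInfinite v}.ncard := by
  induction h with
  | refl => exact ⟨hEV, le_rfl⟩
  | tail _ hstep ih =>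
    rcases hstep with h | h | h
    · obtain ⟨h1, h2, h3⟩ := h.card_eq
      exact ⟨by omega, ih.2.trans h3⟩
    · obtain ⟨h1, h2, h3⟩ := h.card_eq
      exact ⟨by omega, ih.2.trans h3.ge⟩
    · obtain ⟨h1, h2, h3⟩ := h.card_eq
      exact ⟨by omega, ih.2.trans h3.le⟩

theorem IsSun.card {n : ℕ} {Γ : TropicalCurve} (h : IsSun n Γ) :
    Nat.card Γ.E = Nat.card Γ.V ∧ n ≤ {v | Γ.IsInfinite v}.ncard := by
  have := Γ.finiteV
  have := Γ.finiteE
  obtain ⟨c, d, h⟩ := h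
  refine ⟨by rw [← Nat.card_congr c, ← Nat.card_congr d], ?_⟩
  have hfin : ∀ i, ¬ Γ.IsInfinite (c (.inl i)) := by
    intro i hi
    have h1 := Γ.infinite_degree _ hi
    have h2 : ({d (.inl i), d (.inr i)} : Set Γ.E) ⊆ {e | c (.inl i) ∈ Γ.ends e} := by
      rintro e (rfl | rfl)
      · simp [(h i).1]
      · simp [(h i).2.1]
    have h3 := Set.ncard_le_ncard h2
    rw [Set.ncard_pair (by simp)] at h3
    unfold Multigraph.degree at h1
    omega
  have hinf : ∀ i, Γ.IsInfinite (c (.inr i)) := by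
    intro i
    obtain ⟨v, hv, hi⟩ := (Γ.length_eq_top_iff _).1 (h i).2.2
    rw [(h i).2.1, Sym2.mem_iff] at hv
    rcases hv with rfl | rfl
    · exact absurd hi (hfin i)
    · exact hi
  have h1 : Set.range (c ∘ Sum.inr) ⊆ {v | Γ.IsInfinite v} := by
    rintro _ ⟨i, rfl⟩
    exact hinf i
  refine le_trans ?_ (Set.ncard_le_ncard h1)
  rw [← Set.image_univ, Set.ncard_image_of_injective _ (c.injective.comp Sum.inr_injective),
    Set.ncard_univ, Nat.card_zmod]

/-- A nodal tropical curve that is an immersion of a curve of genus one with at least `10` rays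
has at least `n / 2 - 4` nodes. -/
theorem IsResolution.le_nodeCount {C : Set Plane} {Γ : TropicalCurve} {φ : PlaneMap Γ}
    (hC : IsNodalTropicalCurve C) (h : IsResolution C φ) (hEV : Nat.card Γ.E = Nat.card Γ.V)
    {n : ℕ} (hn : 9 < n) (hr : n ≤ {v | Γ.IsInfinite v}.ncard) :
    ∃ δ : ℕ, (δ : ℕ∞) ≤ nodeCount C ∧ n ≤ 2 * δ + 8 := by
  classical
  have := Γ.finiteV
  have := Γ.finiteE
  have := Fintype.ofFinite Γ.V
  have := Fintype.ofFinite Γ.E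
  rw [Nat.card_eq_fintype_card, Nat.card_eq_fintype_card] at hEV
  obtain ⟨δ, hδ, harea⟩ := h.rayArea_add hC hEV
  refine ⟨δ, hδ, ?_⟩
  set s : Finset Γ.E := Finset.univ.filter fun e => Γ.length e = ⊤ with hs
  have hcard : {v | Γ.IsInfinite v}.ncard = s.card := by
    rw [hs, φ.card_infinite_edges, ← Set.ncard_coe_finset]
    congr 1
    ext v
    simp
  have hup : ∀ l, upArea s φ.dir l = φ.rayArea l := by
    intro l
    unfold upArea PlaneMap.rayArea
    simp only [hs, Finset.filter_filter]
  -- The finite set consists of the directions of all edges, not only of the rays, since the area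
  -- formula requires `l` to be transversal to every edge of the curve.
  have hscott := scott_inequality (s := s) (u := φ.dir) (fun i _ => φ.primitive i) (h.sum_rays hC)
    (Finset.univ.image φ.dir) (by
      intro h0
      obtain ⟨e, -, he⟩ := Finset.mem_image.1 h0
      exact (φ.primitive e).ne_zero he)
    (fun i _ => Finset.mem_image_of_mem _ (Finset.mem_univ i)) (W := s.card + 2 * δ)
    (fun l hl => by
      rw [hup, hup, harea l fun e => hl _ (Finset.mem_image_of_mem _ (Finset.mem_univ e)), hs,
        φ.card_infinite_edges]
      ring)
    (by omega) (by omega)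
  omega

theorem IsSun.le_crossingNumber {n : ℕ} (hn : 9 < n) {Γ : TropicalCurve} (h : IsSun n Γ) {m : ℕ}
    (hm : ∀ δ, n ≤ 2 * δ + 8 → m ≤ δ) : (m : ℕ∞) ≤ crossingNumber Γ := by
  refine le_iInf₂ fun C hC => ?_
  obtain ⟨hC, Γ', hmod, φ, hres⟩ := hC
  obtain ⟨h1, h2⟩ := h.card
  obtain ⟨h3, h4⟩ := hmod.card h1
  obtain ⟨δ, hδ, hle⟩ := hres.le_nodeCount hC h3 hn (h2.trans h4)
  exact le_trans (by exact_mod_cast hm δ hle) hδ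

theorem ceil_half (n : ℕ) : ⌈(n : ℝ) / 2⌉₊ = (n + 1) / 2 := by
  refine eq_of_forall_ge_iff fun k => ?_
  rw [Nat.ceil_le, div_le_iff₀ two_pos]
  have : ((n : ℝ) ≤ k * 2) ↔ n ≤ k * 2 := by exact_mod_cast Iff.rfl
  rw [this]
  omega

/-! ### Plane maps with a single crossing -/

section
variable {Γ : TropicalCurve} {φ : PlaneMap Γ}

theorem PlaneMap.closedEdge_of_finite (φ : PlaneMap Γ) {e : Γ.E} (h : Γ.length e ≠ ⊤) :
    φ.closedEdge e = segment ℝ (φ.pos (φ.base e)) (φ.pos (φ.tip e)) := by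
  have hl : 0 < (Γ.length e).toReal := ENNReal.toReal_pos (Γ.length_pos e).ne' h
  rw [segment_eq_image', φ.pos_tip e h, add_sub_cancel_left]
  ext q
  simp only [PlaneMap.closedEdge, PlaneMap.pt, Set.mem_ofPred_eq, Set.mem_image, Set.mem_Icc]
  constructor
  · rintro ⟨t, h0, h1, rfl⟩
    rw [ENNReal.ofReal_le_iff_le_toReal h] at h1
    refine ⟨t / (Γ.length e).toReal, ⟨by positivity, (div_le_one hl).2 h1⟩, ?_⟩
    rw [smul_smul, div_mul_cancel₀ _ hl.ne']
  · rintro ⟨t, ⟨h0, h1⟩, rfl⟩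
    refine ⟨t * (Γ.length e).toReal, by positivity, ?_, by rw [smul_smul]⟩
    rw [ENNReal.ofReal_le_iff_le_toReal h]
    exact mul_le_of_le_one_left hl.le h1

theorem PlaneMap.closedEdge_of_infinite (φ : PlaneMap Γ) {e : Γ.E} (h : Γ.length e = ⊤) :
    φ.closedEdge e = ray (φ.pos (φ.base e)) (toReal (φ.dir e)) := by
  ext q
  simp only [PlaneMap.closedEdge, PlaneMap.pt, ray, Set.mem_ofPred_eq, h, le_top, true_and,
    eq_comm]

theorem PlaneMap.range_eq (hv : ∀ w, ¬ Γ.IsInfinite w → ∃ g, φ.src g = w) :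
    Set.range φ.image = ⋃ e, φ.closedEdge e := by
  refine (Set.iUnion_subset φ.closedEdge_subset).antisymm' ?_
  rintro _ ⟨x, rfl⟩
  cases x with
  | vertex w hw =>
    obtain ⟨g, hg⟩ := hv w hw
    exact Set.mem_iUnion.2 ⟨g.1, (PlaneMap.germ_of_src hw hg).mem_closedEdge⟩
  | edge e t ht hte => exact Set.mem_iUnion.2 ⟨e, t, ht.le, hte.le, rfl⟩

theorem PlaneMap.exists_segments_rays (hv : ∀ w, ¬ Γ.IsInfinite w → ∃ g, φ.src g = w) :
    ∃ S R : Finset (Plane × Plane),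
      Set.range φ.image = (⋃ s ∈ S, segment ℝ s.1 s.2) ∪ ⋃ r ∈ R, ray r.1 r.2 := by
  classical
  have := Γ.finiteE
  have := Fintype.ofFinite Γ.E
  refine ⟨(Finset.univ.filter fun e => Γ.length e ≠ ⊤).image
      fun e => (φ.pos (φ.base e), φ.pos (φ.tip e)),
    (Finset.univ.filter fun e => Γ.length e = ⊤).image
      fun e => (φ.pos (φ.base e), toReal (φ.dir e)), ?_⟩
  rw [PlaneMap.range_eq hv]
  ext q
  simp only [Set.mem_union, Set.mem_iUnion, Finset.mem_image, Finset.mem_filter, Finset.mem_univ,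
    true_and, exists_prop]
  constructor
  · rintro ⟨e, he⟩
    by_cases h : Γ.length e = ⊤
    · exact Or.inr ⟨_, ⟨e, h, rfl⟩, by rwa [← φ.closedEdge_of_infinite h]⟩
    · exact Or.inl ⟨_, ⟨e, h, rfl⟩, by rwa [← φ.closedEdge_of_finite h]⟩
  · rintro (⟨_, ⟨e, h, rfl⟩, hq⟩ | ⟨_, ⟨e, h, rfl⟩, hq⟩)
    · exact ⟨e, by rwa [φ.closedEdge_of_finite h]⟩
    · exact ⟨e, by rwa [φ.closedEdge_of_infinite h]⟩

theorem PlaneMap.eventually_ray_subset {P : Plane} {g : Γ.E × Bool} (hg : φ.Germ P g) :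
    ∀ᶠ x in 𝓝 P, x ∈ ray P (toReal (φ.gdir g)) → x ∈ Set.range φ.image := by
  obtain ⟨δ, hδ, h⟩ := hg.eventually
  have hv : 0 < ‖toReal (φ.gdir g)‖ := norm_pos_iff.2 (φ.primitive_gdir g).toReal_ne_zero
  filter_upwards [Metric.ball_mem_nhds P (mul_pos hδ hv)]
  rintro _ hx ⟨s, hs, rfl⟩
  rcases hs.eq_or_lt with rfl | hs
  · rw [zero_smul, add_zero]
    exact φ.closedEdge_subset _ hg.mem_closedEdge
  · rw [Metric.mem_ball, dist_self_add_left, norm_smul, Real.norm_of_nonneg hs.le] at hx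
    obtain ⟨t, ht, hte, hp⟩ := h s hs (lt_of_mul_lt_mul_right hx hv.le)
    exact ⟨.edge _ t ht hte, hp⟩

/-- Near each of its points, the image of a plane map is the union of the rays spanned by the
half-edges at this point. -/
theorem PlaneMap.localCone (hv : ∀ w, ¬ Γ.IsInfinite w → ∃ g, φ.src g = w) (P : Plane) :
    LocalCone (Set.range φ.image) P ((φ.germs P).image φ.gdir) := by
  have := Γ.finiteE
  have h1 : ∀ᶠ x in 𝓝 P, ∀ e, x ∈ φ.closedEdge e → P ∈ φ.closedEdge e := by
    rw [eventually_all]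
    intro e
    by_cases hP : P ∈ φ.closedEdge e
    · exact Eventually.of_forall fun _ _ => hP
    · filter_upwards [(φ.isClosed_closedEdge e).isOpen_compl.mem_nhds hP] with x hx hx'
      exact absurd hx' hx
  have h2 : ∀ᶠ x in 𝓝 P, ∀ g, φ.Germ P g → x ∈ ray P (toReal (φ.gdir g)) →
      x ∈ Set.range φ.image := by
    rw [eventually_all]
    intro g
    by_cases hg : φ.Germ P g
    · filter_upwards [φ.eventually_ray_subset hg] with x hx _
      exact hx
    · exact Eventually.of_forall fun _ h => absurd h hg
  filter_upwards [h1, h2] with x hx1 hx2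
  constructor
  · intro hx
    rw [PlaneMap.range_eq hv] at hx
    obtain ⟨e, he⟩ := Set.mem_iUnion.1 hx
    obtain ⟨t₀, h0, hl, rfl⟩ := hx1 e he
    obtain ⟨t, h0', hl', rfl⟩ := he
    have fwd : ∀ s, t₀ < s → ENNReal.ofReal s ≤ Γ.length e → φ.Germ (φ.pt e t₀) (e, true) :=
      fun s hs hsl => ⟨t₀, rfl, h0,
        ((ENNReal.ofReal_lt_ofReal_iff (h0.trans_lt hs)).2 hs).trans_le hsl⟩
    have bwd : 0 < t₀ → φ.Germ (φ.pt e t₀) (e, false) := fun hs => ⟨t₀, rfl, hs, hl⟩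
    have hmem : ∀ g, φ.Germ (φ.pt e t₀) g →
        φ.gdir g ∈ (φ.germs (φ.pt e t₀)).image φ.gdir := fun g hg =>
      Finset.mem_image_of_mem _ (PlaneMap.mem_germs.2 hg)
    rcases lt_trichotomy t₀ t with hlt | rfl | hlt
    · refine ⟨_, hmem _ (fwd t hlt hl'), t - t₀, by linarith, ?_⟩
      rw [show φ.gdir (e, true) = φ.dir e from rfl, ← φ.pt_add, add_sub_cancel]
    · rcases h0.eq_or_lt with rfl | hpos
      · refine ⟨_, hmem (e, true) ⟨0, rfl, le_rfl, by simpa using Γ.length_pos e⟩, 0, le_rfl, ?_⟩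
        simp
      · exact ⟨_, hmem _ (bwd hpos), 0, le_rfl, by simp⟩
    · refine ⟨_, hmem _ (bwd (h0'.trans_lt hlt)), t₀ - t, by linarith, ?_⟩
      rw [show φ.gdir (e, false) = -φ.dir e from rfl, toReal_neg, smul_neg, ← neg_smul, ← φ.pt_add]
      congr 1; ring
  · rintro ⟨d, hd, hx⟩
    obtain ⟨g, hg, rfl⟩ := Finset.mem_image.1 hd
    exact hx2 g (PlaneMap.mem_germs.1 hg) hx

theorem PlaneMap.germ_iff {P : Plane} {g : Γ.E × Bool} : φ.Germ P g ↔
    (∃ w, ¬ Γ.IsInfinite w ∧ φ.pos w = P ∧ φ.src g = w) ∨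
      ∃ t ht hte, φ.image (.edge g.1 t ht hte) = P := by
  refine ⟨PlaneMap.Germ.cases, ?_⟩
  rintro (⟨w, hw, rfl, hs⟩ | ⟨t, ht, hte, rfl⟩)
  · exact PlaneMap.germ_of_src hw hs
  · refine ⟨t, rfl, ?_⟩
    split_ifs
    exacts [⟨ht.le, hte⟩, ⟨ht, hte.le⟩]

theorem PlaneMap.germs_vertex {w : Γ.V} (hw : ¬ Γ.IsInfinite w)
    (h : ∀ y, φ.image y = φ.pos w → y = .vertex w hw) : φ.germs (φ.pos w) = φ.halfEdges w := by
  ext g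
  rw [PlaneMap.mem_germs, PlaneMap.mem_halfEdges]
  refine ⟨fun hg => ?_, PlaneMap.germ_of_src hw⟩
  rcases hg.cases with ⟨w', hw', hp, hs⟩ | ⟨t, ht, hte, hp⟩
  · have := h (.vertex w' hw') hp
    rw [hs]
    simpa using this
  · exact absurd (h _ hp) (by simp)

theorem PlaneMap.image_germs_edge {e : Γ.E} {t : ℝ} (ht : 0 < t)
    (hte : ENNReal.ofReal t < Γ.length e)
    (h : ∀ y, φ.image y = φ.image (.edge e t ht hte) → y = .edge e t ht hte) :
    (φ.germs (φ.image (.edge e t ht hte))).image φ.gdir = {φ.dir e, -φ.dir e} := by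
  ext d
  simp only [Finset.mem_image, PlaneMap.mem_germs, Finset.mem_insert, Finset.mem_singleton]
  constructor
  · rintro ⟨g, hg, rfl⟩
    rcases hg.cases with ⟨w', hw', hp, -⟩ | ⟨s, hs, hse, hp⟩
    · exact absurd (h (.vertex w' hw') hp) (by simp)
    · have h1 := h _ hp
      simp only [TropicalCurve.Point.edge.injEq] at h1
      rw [← h1.1]
      exact φ.gdir_eq_or (Or.inl rfl)
  · rintro (rfl | rfl)
    · exact ⟨(e, true), PlaneMap.germ_iff.2 (Or.inr ⟨t, ht, hte, rfl⟩), rfl⟩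
    · exact ⟨(e, false), PlaneMap.germ_iff.2 (Or.inr ⟨t, ht, hte, rfl⟩), rfl⟩

theorem PlaneMap.image_germs_crossing {e f : Γ.E} {t s : ℝ} (ht : 0 < t)
    (hte : ENNReal.ofReal t < Γ.length e) (hs : 0 < s) (hsf : ENNReal.ofReal s < Γ.length f)
    (hcross : φ.image (.edge f s hs hsf) = φ.image (.edge e t ht hte))
    (h : ∀ y, φ.image y = φ.image (.edge e t ht hte) →
      y = .edge e t ht hte ∨ y = .edge f s hs hsf) :
    (φ.germs (φ.image (.edge e t ht hte))).image φ.gdir =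
      {φ.dir e, -φ.dir e, φ.dir f, -φ.dir f} := by
  ext d
  simp only [Finset.mem_image, PlaneMap.mem_germs, Finset.mem_insert, Finset.mem_singleton]
  constructor
  · rintro ⟨g, hg, rfl⟩
    rcases hg.cases with ⟨w', hw', hp, -⟩ | ⟨s, hs, hse, hp⟩
    · exact absurd (h (.vertex w' hw') hp) (by simp)
    · rcases h _ hp with h1 | h1 <;> simp only [TropicalCurve.Point.edge.injEq] at h1
      · rw [← h1.1]
        have := φ.gdir_eq_or (g := g) (Or.inl rfl)
        tauto
      · rw [← h1.1]
        have := φ.gdir_eq_or (g := g) (Or.inl rfl)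
        tauto
  · rintro (rfl | rfl | rfl | rfl)
    · exact ⟨(e, true), PlaneMap.germ_iff.2 (Or.inr ⟨t, ht, hte, rfl⟩), rfl⟩
    · exact ⟨(e, false), PlaneMap.germ_iff.2 (Or.inr ⟨t, ht, hte, rfl⟩), rfl⟩
    · exact ⟨(f, true), PlaneMap.germ_iff.2 (Or.inr ⟨s, hs, hsf, hcross⟩), rfl⟩
    · exact ⟨(f, false), PlaneMap.germ_iff.2 (Or.inr ⟨s, hs, hsf, hcross⟩), rfl⟩

/-- A plane map all of whose finite vertices are trivalent and smooth, and which is injective but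
for one transversal crossing of two edges, is an immersion; its only node is the crossing. -/
theorem PlaneMap.isImmersion_of_crossing (φ : PlaneMap Γ)
    (htri : ∀ w, ¬ Γ.IsInfinite w → ∃ a b, (det₂ a b = 1 ∨ det₂ a b = -1) ∧
      (φ.halfEdges w).image φ.gdir = {a, b, -(a + b)})
    {e f : Γ.E} {t s : ℝ} (ht : 0 < t) (hte : ENNReal.ofReal t < Γ.length e)
    (hs : 0 < s) (hsf : ENNReal.ofReal s < Γ.length f) (hd : det₂ (φ.dir e) (φ.dir f) ≠ 0)
    (hcross : φ.image (.edge f s hs hsf) = φ.image (.edge e t ht hte))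
    (hinj : ∀ x y, φ.image x = φ.image y → x = y ∨ φ.image x = φ.image (.edge e t ht hte))
    (hfib : ∀ y, φ.image y = φ.image (.edge e t ht hte) →
      y = .edge e t ht hte ∨ y = .edge f s hs hsf) :
    IsImmersion Γ (Set.range φ.image) ∧
      nodeCount (Set.range φ.image) ≤ (det₂ (φ.dir e) (φ.dir f)).natAbs := by
  set p₀ := φ.image (.edge e t ht hte) with hp₀
  have hne : (TropicalCurve.Point.edge e t ht hte : Γ.Point) ≠ .edge f s hs hsf := by
    intro h0
    simp only [TropicalCurve.Point.edge.injEq] at h0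
    rw [h0.1, det₂_self] at hd
    exact hd rfl
  have hv : ∀ w, ¬ Γ.IsInfinite w → ∃ g, φ.src g = w := by
    intro w hw
    obtain ⟨a, b, -, h⟩ := htri w hw
    have : a ∈ (φ.halfEdges w).image φ.gdir := by rw [h]; simp
    obtain ⟨g, hg, -⟩ := Finset.mem_image.1 this
    exact ⟨g, PlaneMap.mem_halfEdges.1 hg⟩
  have hcone := φ.localCone hv
  have hnode : IsNodeWith (Set.range φ.image) p₀ (φ.dir e) (φ.dir f) := by
    refine isNodeWith_of_localCone (φ.primitive e) (φ.primitive f) hd ?_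
    rw [← φ.image_germs_crossing ht hte hs hsf hcross hfib]
    exact hcone p₀
  have hcases : ∀ p ∈ Set.range φ.image, p ≠ p₀ →
      (∃ a, IsPrimitive a ∧ LocalCone (Set.range φ.image) p {a, -a}) ∨
      ∃ a b, (det₂ a b = 1 ∨ det₂ a b = -1) ∧
        LocalCone (Set.range φ.image) p {a, b, -(a + b)} := by
    rintro _ ⟨x, rfl⟩ hpne
    have hx : ∀ y, φ.image y = φ.image x → y = x := fun y hy =>
      (hinj x y hy.symm).elim Eq.symm fun h => absurd h hpne
    have hc := hcone (φ.image x)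
    cases x with
    | vertex w hw =>
      obtain ⟨a, b, hab, h⟩ := htri w hw
      refine Or.inr ⟨a, b, hab, ?_⟩
      rw [← h, ← PlaneMap.germs_vertex hw hx]
      exact hc
    | edge e' t' ht' hte' =>
      refine Or.inl ⟨_, φ.primitive e', ?_⟩
      rw [← φ.image_germs_edge ht' hte' hx]
      exact hc
  have huniq : ∀ p v u, IsNodeWith (Set.range φ.image) p v u → p = p₀ := by
    intro p v u hvu
    by_contra hpne
    have hp : p ∈ Set.range φ.image := hvu.2.2.2.self_of_nhds.2 ⟨0, Or.inl (by simp)⟩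
    -- Local directions are determined by the set, so a node has exactly four of them whatever the
    -- presentation; a straight point has two and a trivalent point three.
    have key : ∀ D : Finset (Fin 2 → ℤ), (∀ d ∈ D, IsPrimitive d) →
        LocalCone (Set.range φ.image) p D → D.card = 4 := by
      intro D hD hDc
      have hDe : D = {v, -v, u, -u} := by
        have hprim := primitive_of_mem_cross hvu.1 hvu.2.1
        ext d
        constructor
        · intro h
          rw [hvu.localCone.mem_iff hprim (hD d h)]
          exact (hDc.mem_iff hD (hD d h)).1 h
        · intro h
          rw [hDc.mem_iff hD (hprim d h)]
          exact (hvu.localCone.mem_iff hprim (hprim d h)).1 h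
      rw [hDe, Finset.card_eq_sum_ones, sum_cross _ hvu.1 hvu.2.1 hvu.2.2.1]
    rcases hcases p hp hpne with ⟨a, ha, hc⟩ | ⟨a, b, hab, hc⟩
    · have := key _ (primitive_of_mem_pair ha) hc
      rw [Finset.card_eq_sum_ones, sum_pair_neg _ ha] at this
      omega
    · have := key _ (primitive_of_mem_triple hab) hc
      rw [Finset.card_eq_sum_ones, sum_triple _ hab] at this
      omega
  refine ⟨⟨⟨PlaneMap.exists_segments_rays hv, fun p hp => ?_⟩, Γ, Relation.ReflTransGen.refl, φ,
    rfl, fun x y hxy => ?_, fun p v u hvu => ?_⟩, ?_⟩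
  · by_cases hpe : p = p₀
    · exact Or.inr ⟨_, _, hpe ▸ hnode⟩
    · rcases hcases p hp hpe with ⟨a, ha, hc⟩ | ⟨a, b, hab, hc⟩
      · exact Or.inl (isSmoothAt_of_localCone_two ha hc)
      · exact Or.inl (isSmoothAt_of_localCone_three hab hc)
  · rcases hinj x y hxy with h | h
    · exact Or.inl h
    · exact Or.inr ⟨_, _, h ▸ hnode⟩
  · obtain rfl := huniq p v u hvu
    have hpre : φ.image ⁻¹' {p₀} = {.edge e t ht hte, .edge f s hs hsf} := by
      ext y
      constructor
      · exact fun hy => hfib y hy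
      · rintro (rfl | rfl)
        · exact hp₀.symm
        · exact hcross
    have flip : ∀ {a b : Fin 2 → ℤ}, a = b ∨ a = -b → b = a ∨ b = -a := by
      rintro a b (rfl | rfl) <;> simp
    rcases hvu.direction hnode with h1 | h1
    · rcases hvu.direction hnode.swap with h2 | h2
      · exfalso
        apply hd
        rcases h1 with h1 | h1 <;> rcases h2 with h2 | h2 <;>
          rw [h1, h2] <;> simp [det₂_neg_left, det₂_neg_right, det₂_self]
      · exact ⟨_, _, hne, hpre, h1, h2⟩
    · rcases hvu.direction hnode.swap with h2 | h2
      · exact ⟨_, _, hne.symm, by rw [hpre, Set.pair_comm], h2, h1⟩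
      · exfalso
        apply hd
        rcases h1 with h1 | h1 <;> rcases h2 with h2 | h2 <;>
          rw [h1, h2] <;> simp [det₂_neg_left, det₂_neg_right, det₂_self]
  · refine iSup_le fun S => ?_
    have h0 : ∀ p, p ≠ p₀ → nodeMultiplicity (Set.range φ.image) p = 0 := fun p hp =>
      nodeMultiplicity_eq_zero fun ⟨v, u, h⟩ => hp (huniq p v u h)
    have h1 : ∑ p ∈ S, (nodeMultiplicity (Set.range φ.image) p : ℕ∞) ≤
        ∑ p ∈ {p₀}, (nodeMultiplicity (Set.range φ.image) p : ℕ∞) :=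
      Finset.sum_le_sum_of_ne_zero fun p _ hp => by
        rw [Finset.mem_singleton]
        by_contra hpe
        exact hp (by rw [h0 p hpe, Nat.cast_zero])
    rwa [Finset.sum_singleton, hnode.nodeMultiplicity_eq] at h1

end

/-! ### Sun curves from closed polygons -/

section
variable (n : ℕ)

/-- The endpoints of the edges of a sun curve. -/
def sunEnds : ZMod n ⊕ ZMod n → Sym2 (ZMod n ⊕ ZMod n) :=
  Sum.elim (fun i => s(.inl i, .inl (i + 1))) fun i => s(.inl i, .inr i)

theorem inr_mem_sunEnds (i : ZMod n) (e : ZMod n ⊕ ZMod n) :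
    .inr i ∈ sunEnds n e ↔ e = .inr i := by
  rcases e with j | j
  · simp [sunEnds]
  · simp [sunEnds, eq_comm]

variable [Fact (1 < n)]

/-- The underlying graph of a sun curve. -/
def sunGraph : Multigraph where
  V := ZMod n ⊕ ZMod n
  E := ZMod n ⊕ ZMod n
  finiteV := inferInstance
  finiteE := inferInstance
  ends := sunEnds n
  connected := by
    set G := SimpleGraph.fromEdgeSet (Set.range (sunEnds n)) with hG
    have h1 : ∀ i : ZMod n, G.Reachable (.inl i) (.inl (i + 1)) := fun i => by
      refine SimpleGraph.Adj.reachable ?_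
      rw [hG, SimpleGraph.fromEdgeSet_adj]
      exact ⟨⟨.inl i, rfl⟩, fun h => by simpa using Sum.inl_injective h⟩
    have h2 : ∀ i : ZMod n, G.Reachable (.inl i) (.inr i) := fun i => by
      refine SimpleGraph.Adj.reachable ?_
      rw [hG, SimpleGraph.fromEdgeSet_adj]
      exact ⟨⟨.inr i, rfl⟩, Sum.inl_ne_inr⟩
    have h3 : ∀ k : ℕ, G.Reachable (.inl (0 : ZMod n)) (.inl (k : ZMod n)) := by
      intro k
      induction k with
      | zero => simp
      | succ k ih => exact ih.trans (by simpa using h1 k)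
    have h4 : ∀ i : ZMod n, G.Reachable (.inl (0 : ZMod n)) (.inl i) := fun i => by
      have := h3 i.val
      rwa [ZMod.natCast_zmod_val] at this
    rw [SimpleGraph.connected_iff_exists_forall_reachable]
    refine ⟨.inl 0, ?_⟩
    rintro (i | i)
    · exact h4 i
    · exact (h4 i).trans (h2 i)

/-- The sun curve with given lengths of the edges of its cycle. -/
noncomputable def sunCurve (len : ℕ → ℝ) (hlen : ∀ j < n, 0 < len j) : TropicalCurve where
  toMultigraph := sunGraph n
  length := Sum.elim (fun i => ENNReal.ofReal (len i.val)) fun _ => ⊤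
  length_pos := by
    rintro (i | i)
    · exact ENNReal.ofReal_pos.2 (hlen _ (ZMod.val_lt i))
    · exact ENNReal.zero_lt_top
  IsInfinite := Sum.elim (fun _ => False) fun _ => True
  infinite_degree := by
    rintro (i | i) hi
    · exact absurd hi id
    have h1 : {e | .inr i ∈ sunEnds n e} = {.inr i} := Set.ext fun e => inr_mem_sunEnds n i e
    have h2 : {e | sunEnds n e = s(.inr i, .inr i)} = ∅ := by
      refine Set.eq_empty_of_forall_notMem fun e he => ?_
      have h3 : .inr i ∈ sunEnds n e := by
        rw [show sunEnds n e = _ from he]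
        exact Sym2.mem_mk_left _ _
      rw [inr_mem_sunEnds] at h3
      subst h3
      simp [sunEnds] at he
    change Set.ncard {e | .inr i ∈ sunEnds n e} +
      Set.ncard {e | sunEnds n e = s(.inr i, .inr i)} = 1
    rw [h1, h2, Set.ncard_singleton, Set.ncard_empty]
  length_eq_top_iff := by
    rintro (i | i)
    · refine iff_of_false ENNReal.ofReal_ne_top ?_
      rintro ⟨v | v, hv, hi⟩
      · exact hi
      · exact absurd ((inr_mem_sunEnds n v (.inl i)).1 hv) Sum.inl_ne_inr
    · exact iff_of_true rfl ⟨.inr i, Sym2.mem_mk_right _ _, trivial⟩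

theorem isSun_sunCurve (len : ℕ → ℝ) (hlen : ∀ j < n, 0 < len j) :
    IsSun n (sunCurve n len hlen) :=
  ⟨Equiv.refl _, Equiv.refl _, fun _ => ⟨rfl, rfl, rfl⟩⟩

/-- The cyclic successor of a number below `n`. -/
def cyclicSucc (j : ℕ) : ℕ := if j + 1 = n then 0 else j + 1

variable {n}

theorem val_add_one (i : ZMod n) : (i + 1).val = cyclicSucc n i.val := by
  have h1 := ZMod.val_lt i
  rw [ZMod.val_add, ZMod.val_one, cyclicSucc]
  split_ifs with h
  · rw [h, Nat.mod_self]
  · exact Nat.mod_eq_of_lt (by omega)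

/-- A closed polygon with smooth corners, from which the remaining direction at each corner leaves
as a ray. -/
structure RayPolygon (n : ℕ) where
  pos : ℕ → Plane
  dir : ℕ → Fin 2 → ℤ
  ray : ℕ → Fin 2 → ℤ
  len : ℕ → ℝ
  len_pos : ∀ j < n, 0 < len j
  pos_succ : ∀ j < n, pos (cyclicSucc n j) = pos j + len j • toReal (dir j)
  det_dir : ∀ j < n, det₂ (dir j) (dir (cyclicSucc n j)) = 1 ∨
    det₂ (dir j) (dir (cyclicSucc n j)) = -1
  ray_succ : ∀ j < n, ray (cyclicSucc n j) = dir j - dir (cyclicSucc n j)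

theorem det_sub_self (a b : Fin 2 → ℤ) : det₂ (a - b) a = det₂ a b := by
  simp only [det₂, Pi.sub_apply]; ring

/-- The plane map of a closed polygon with rays. -/
noncomputable def RayPolygon.planeMap (Q : RayPolygon n) :
    PlaneMap (sunCurve n Q.len Q.len_pos) where
  pos := Sum.elim (fun i => Q.pos i.val) fun _ => 0
  base := Sum.elim .inl .inl
  tip := Sum.elim (fun i => .inl (i + 1)) .inr
  dir := Sum.elim (fun i => Q.dir i.val) fun i => Q.ray i.val
  ends_eq := by
    rintro (i | i) <;> rfl
  base_finite := by
    rintro (i | i) <;> exact id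
  primitive := by
    rintro (i | i)
    · exact isPrimitive_of_det_eq (Q.det_dir i.val (ZMod.val_lt i))
    · have h : i.val = cyclicSucc n (i - 1).val := by rw [← val_add_one, sub_add_cancel]
      change IsPrimitive (Q.ray i.val)
      rw [h, Q.ray_succ _ (ZMod.val_lt _)]
      refine isPrimitive_of_det_eq (b := Q.dir (i - 1).val) ?_
      rw [det_sub_self]
      exact Q.det_dir _ (ZMod.val_lt _)
  pos_tip := by
    rintro (i | i) h
    · change Q.pos (i + 1).val = Q.pos i.val + (ENNReal.ofReal (Q.len i.val)).toReal • _
      rw [ENNReal.toReal_ofReal (Q.len_pos _ (ZMod.val_lt i)).le, val_add_one,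
        Q.pos_succ _ (ZMod.val_lt i)]
      rfl
    · exact absurd rfl h

theorem RayPolygon.image_halfEdges (Q : RayPolygon n) (w : (sunCurve n Q.len Q.len_pos).V)
    (hw : ¬ (sunCurve n Q.len Q.len_pos).IsInfinite w) :
    ∃ a b, (det₂ a b = 1 ∨ det₂ a b = -1) ∧
      (Q.planeMap.halfEdges w).image Q.planeMap.gdir = {a, b, -(a + b)} := by
  obtain ⟨i, rfl⟩ : ∃ i : ZMod n, w = Sum.inl i := by
    rcases w with i | i
    · exact ⟨i, rfl⟩
    · exact absurd trivial hw
  have h : i.val = cyclicSucc n (i - 1).val := by rw [← val_add_one, sub_add_cancel]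
  have hdet := Q.det_dir _ (ZMod.val_lt (i - 1))
  have hray := Q.ray_succ _ (ZMod.val_lt (i - 1))
  rw [← h] at hdet hray
  refine ⟨Q.dir i.val, -Q.dir (i - 1).val, ?_, ?_⟩
  · rw [det₂_neg_right, det₂_swap, neg_neg]
    exact hdet
  ext d
  have hr : -(Q.dir i.val + -Q.dir (i - 1).val) = Q.ray i.val := by rw [hray]; abel
  rw [hr]
  simp only [Finset.mem_image, Finset.mem_insert, Finset.mem_singleton]
  constructor
  · rintro ⟨⟨j | j, σ⟩, hs, rfl⟩ <;> cases σ <;> replace hs := PlaneMap.mem_halfEdges.1 hs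
    · obtain rfl : j = i - 1 := eq_sub_of_add_eq (Sum.inl_injective hs)
      exact Or.inr (Or.inl rfl)
    · obtain rfl : j = i := Sum.inl_injective hs
      exact Or.inl rfl
    · exact absurd hs Sum.inr_ne_inl
    · obtain rfl : j = i := Sum.inl_injective hs
      exact Or.inr (Or.inr rfl)
  · rintro (rfl | rfl | rfl)
    · exact ⟨(.inl i, true), PlaneMap.mem_halfEdges.2 rfl, rfl⟩
    · exact ⟨(.inl (i - 1), false), PlaneMap.mem_halfEdges.2
        (congrArg Sum.inl (sub_add_cancel i 1)), rfl⟩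
    · exact ⟨(.inr i, true), PlaneMap.mem_halfEdges.2 rfl, rfl⟩

end

/-! ### A figure eight with one node -/

section lobe
variable (m k : ℕ)

/-- The height of a corner of the lobe. -/
noncomputable def lobeHeight (j : ℕ) : ℝ := 4 * m + j * (m - 1) - j * (j - 1) / 2

/-- The corners of the lobe: the first `k + 1` of them lie on a concave graph, the last one is
below the one before it, on the horizontal axis. -/
noncomputable def lobePos (j : ℕ) : Plane := if j ≤ k then ![j + 4, lobeHeight m j] else ![k + 4, 0]

/-- The direction of the edge of the lobe from a corner to the next one. -/
def lobeDir (j : ℕ) : Fin 2 → ℤ := if j < k then ![1, m - 1 - j] else ![0, -1]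

/-- The length of the edge of the lobe from a corner to the next one. -/
noncomputable def lobeLen (j : ℕ) : ℝ := if j < k then 1 else lobeHeight m k

/-- The direction of the ray at a corner of the lobe. -/
def lobeRay (j : ℕ) : Fin 2 → ℤ :=
  if j < k then ![0, 1] else if j = k then ![1, m - k + 1] else ![1, -1]

/-- The stratum of the lobe that contains a given point: a corner (`0`), an edge (`1`), a ray (`2`),
or the edge from the origin to the first corner (`3`). -/
noncomputable def lobeLabel (q : Plane) : ℕ × ℕ :=
  if k + 4 < q 0 then if q 1 = -(q 0 - k - 4) then (2, k + 1) else (2, k)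
  else if q 1 = 0 then if q 0 < k + 4 then (1, k + 1) else (0, k + 1)
  else if q 0 = k + 4 then if q 1 < lobeHeight m k then (1, k) else (0, k)
  else if q 0 < 4 then (3, 0)
  else if q 0 = ⌊q 0⌋₊ then
    if q 1 = lobeHeight m (⌊q 0⌋₊ - 4) then (0, ⌊q 0⌋₊ - 4) else (2, ⌊q 0⌋₊ - 4)
  else (1, ⌊q 0⌋₊ - 4)

variable {m k}

theorem lobeHeight_succ (j : ℕ) : lobeHeight m (j + 1) = lobeHeight m j + (m - 1 - j) := by
  unfold lobeHeight
  push_cast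
  ring

/-- The heights are concave in `j`, so only `j = 0` and `j = m + 2` matter. The lobe starts at `(4,
4m)` on the diagonal: starting at abscissa `s` would give height `s - 3` for `m = 1`, `j = 3`, and 4
is the least integer making this positive. -/
theorem lobeHeight_pos (hm : 1 ≤ m) {j : ℕ} (hj : j ≤ m + 2) : 0 < lobeHeight m j := by
  have hj' : (j : ℝ) ≤ m + 2 := by exact_mod_cast hj
  have hj0 : (0 : ℝ) ≤ j := Nat.cast_nonneg j
  have hm' : (1 : ℝ) ≤ m := by exact_mod_cast hm
  unfold lobeHeight
  have h : (m : ℝ) = 1 ∨ (m : ℝ) = 2 ∨ (3 : ℝ) ≤ m := by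
    obtain h | h | h : m = 1 ∨ m = 2 ∨ 3 ≤ m := by omega
    · left; exact_mod_cast h
    · right; left; exact_mod_cast h
    · right; right; exact_mod_cast h
  rcases h with h | h | h
  · rw [h] at hj' ⊢
    nlinarith [mul_nonneg hj0 (sub_nonneg.2 hj')]
  · rw [h] at hj' ⊢
    nlinarith [mul_nonneg hj0 (sub_nonneg.2 hj')]
  · nlinarith [mul_nonneg hj0 (sub_nonneg.2 hj'), mul_nonneg hj0 (sub_nonneg.2 h)]

theorem lobePos_succ {i : ℕ} (hi : i ≤ k) :
    lobePos m k (i + 1) = lobePos m k i + lobeLen m k i • toReal (lobeDir m k i) := by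
  rcases hi.eq_or_lt with rfl | hi'
  · funext x
    fin_cases x <;> simp [lobePos, lobeLen, lobeDir]
  · have h1 : i + 1 ≤ k := hi'
    funext x
    fin_cases x
    · simp [lobePos, lobeLen, lobeDir, hi, hi', h1]; ring
    · simp [lobePos, lobeLen, lobeDir, hi, hi', h1, lobeHeight_succ]

theorem lobeLen_pos (hm : 1 ≤ m) (hk : k ≤ m + 2) (i : ℕ) : 0 < lobeLen m k i := by
  unfold lobeLen
  split_ifs
  · exact one_pos
  · exact lobeHeight_pos hm hk

theorem det_lobeDir {i : ℕ} (hi : i < k) : det₂ (lobeDir m k i) (lobeDir m k (i + 1)) = -1 := by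
  unfold lobeDir det₂
  by_cases h : i + 1 < k
  · simp [hi, h]
  · simp [hi, h]

theorem lobeDir_sub {i : ℕ} (hi : i < k) :
    lobeDir m k i - lobeDir m k (i + 1) = lobeRay m k (i + 1) := by
  unfold lobeDir lobeRay
  by_cases h : i + 1 < k
  · funext x
    fin_cases x <;> simp [hi, h]
  · obtain rfl : k = i + 1 := by omega
    funext x
    fin_cases x
    · simp
    · simp; ring

/-- Over each unit interval of abscissae, away from the axis, there is one edge, together with a
corner and a vertical ray above the left end; the integral part tells which. -/
theorem lobeLabel_floor {q : Plane} {j : ℕ} (hj : j < k) (h0 : (j : ℝ) + 4 ≤ q 0)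
    (h1 : q 0 < j + 5) (h2 : q 1 ≠ 0) : lobeLabel m k q =
      if q 0 = j + 4 then if q 1 = lobeHeight m j then (0, j) else (2, j) else (1, j) := by
  have hj' : (j : ℝ) + 1 ≤ k := by exact_mod_cast hj
  have hj0 : (0 : ℝ) ≤ j := Nat.cast_nonneg j
  have hfl : ⌊q 0⌋₊ = j + 4 := by
    rw [Nat.floor_eq_iff (by linarith)]
    push_cast
    constructor <;> linarith
  unfold lobeLabel
  rw [if_neg (by linarith), if_neg h2, if_neg (by linarith), if_neg (by linarith), hfl]
  push_cast
  rfl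

theorem lobePos_zero_pos (j : ℕ) : 0 < lobePos m k j 0 := by
  unfold lobePos
  split_ifs <;> simp <;> positivity

theorem lobeLabel_pos (hm : 1 ≤ m) (hk : k ≤ m + 2) {j : ℕ} (hj : j ≤ k + 1) :
    lobeLabel m k (lobePos m k j) = (0, j) := by
  obtain h | rfl | rfl : j < k ∨ j = k ∨ j = k + 1 := by omega
  · have hp := lobeHeight_pos hm (show j ≤ m + 2 by omega)
    rw [lobeLabel_floor h] <;> simp [lobePos, h.le, hp.ne']
    norm_num
  · have hp := lobeHeight_pos hm hk
    simp [lobePos, lobeLabel, hp.ne']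
  · simp [lobePos, lobeLabel]

theorem lobeLabel_edge (hm : 1 ≤ m) (hk : k ≤ m + 2) {j : ℕ} (hj : j ≤ k) {t : ℝ} (ht : 0 < t)
    (hl : t < lobeLen m k j) :
    0 < (lobePos m k j + t • toReal (lobeDir m k j)) 0 ∧
      lobeLabel m k (lobePos m k j + t • toReal (lobeDir m k j)) = (1, j) := by
  have hj0 : (0 : ℝ) ≤ j := Nat.cast_nonneg j
  rcases hj.eq_or_lt with rfl | h
  · simp only [lobeLen, lt_irrefl, if_false] at hl
    have e0 : (lobePos m j j + t • toReal (lobeDir m j j)) 0 = j + 4 := by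
      simp [lobePos, lobeDir]
    have e1 : (lobePos m j j + t • toReal (lobeDir m j j)) 1 = lobeHeight m j - t := by
      simp [lobePos, lobeDir, sub_eq_add_neg]
    refine ⟨by rw [e0]; positivity, ?_⟩
    unfold lobeLabel
    rw [e0, e1, if_neg (lt_irrefl _), if_neg (by linarith), if_pos rfl, if_pos (by linarith)]
  · simp only [lobeLen, h, if_true] at hl
    have e0 : (lobePos m k j + t • toReal (lobeDir m k j)) 0 = j + 4 + t := by
      simp [lobePos, lobeDir, h, hj]
    have e1 : (lobePos m k j + t • toReal (lobeDir m k j)) 1 =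
        (1 - t) * lobeHeight m j + t * lobeHeight m (j + 1) := by
      simp [lobePos, lobeDir, h, hj, lobeHeight_succ]
      ring
    have hp := lobeHeight_pos hm (show j ≤ m + 2 by omega)
    have hp' := lobeHeight_pos hm (show j + 1 ≤ m + 2 by omega)
    have hy : 0 < (lobePos m k j + t • toReal (lobeDir m k j)) 1 := by
      rw [e1]
      have : 0 < 1 - t := by linarith
      positivity
    refine ⟨by rw [e0]; positivity, ?_⟩
    rw [lobeLabel_floor h (by rw [e0]; linarith) (by rw [e0]; linarith) hy.ne', e0,
      if_neg (by linarith)]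

/-- The rays at the corners `j < k` are vertical, above distinct abscissae. The last two start on a
common vertical line with slopes `m - k + 1` and `-1`, the first one higher up; they stay disjoint
because `k ≤ m + 2`. -/
theorem lobeLabel_ray (hm : 1 ≤ m) (hk : k ≤ m + 2) {j : ℕ} (hj : j ≤ k + 1) {t : ℝ} (ht : 0 < t) :
    0 < (lobePos m k j + t • toReal (lobeRay m k j)) 0 ∧
      lobeLabel m k (lobePos m k j + t • toReal (lobeRay m k j)) = (2, j) := by
  have hj0 : (0 : ℝ) ≤ j := Nat.cast_nonneg j
  obtain h | rfl | rfl : j < k ∨ j = k ∨ j = k + 1 := by omega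
  · have e0 : (lobePos m k j + t • toReal (lobeRay m k j)) 0 = j + 4 := by
      simp [lobePos, lobeRay, h, h.le]
    have e1 : (lobePos m k j + t • toReal (lobeRay m k j)) 1 = lobeHeight m j + t := by
      simp [lobePos, lobeRay, h, h.le]
    have hp := lobeHeight_pos hm (show j ≤ m + 2 by omega)
    refine ⟨by rw [e0]; positivity, ?_⟩
    rw [lobeLabel_floor h (by rw [e0]) (by rw [e0]; linarith) (by rw [e1]; positivity), e0, e1,
      if_pos rfl, if_neg (by linarith)]
  · have e0 : (lobePos m j j + t • toReal (lobeRay m j j)) 0 = j + 4 + t := by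
      simp [lobePos, lobeRay]
    have e1 : (lobePos m j j + t • toReal (lobeRay m j j)) 1 =
        lobeHeight m j + t * (m - j + 1) := by
      simp [lobePos, lobeRay]
    have hp := lobeHeight_pos hm hk
    have hk' : (j : ℝ) ≤ m + 2 := by exact_mod_cast hk
    refine ⟨by rw [e0]; positivity, ?_⟩
    unfold lobeLabel
    rw [e0, e1, if_pos (by linarith), if_neg]
    intro h0
    nlinarith [mul_nonneg ht.le (sub_nonneg.2 hk')]
  · have e0 : (lobePos m k (k + 1) + t • toReal (lobeRay m k (k + 1))) 0 = k + 4 + t := by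
      simp [lobePos, lobeRay]
    have e1 : (lobePos m k (k + 1) + t • toReal (lobeRay m k (k + 1))) 1 = -t := by
      simp [lobePos, lobeRay]
    refine ⟨by rw [e0]; positivity, ?_⟩
    unfold lobeLabel
    rw [e0, e1, if_pos (by linarith), if_pos (by ring)]

theorem lobeLabel_bottom {x : ℝ} (hx : x < k + 4) : lobeLabel m k ![x, 0] = (1, k + 1) := by
  simp [lobeLabel, hx, hx.le]

theorem lobeLabel_diag (hm : 1 ≤ m) {x : ℝ} (h0 : 0 < x) (hx : x < 4) :
    lobeLabel m k ![x, m * x] = (3, 0) := by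
  have hm' : (m : ℝ) ≠ 0 := by positivity
  have hk : (0 : ℝ) ≤ k := Nat.cast_nonneg k
  have h1 : ¬ (k : ℝ) + 4 < x := by linarith
  have h2 : x ≠ k + 4 := by linarith
  simp [lobeLabel, h0.ne', hx, hm', h1, h2]

end lobe

/-! ### Gluing two lobes at the origin -/

section
variable {m k k' : ℕ}

theorem cyclicSucc_of_lt {n j : ℕ} (h : j + 1 < n) : cyclicSucc n j = j + 1 :=
  if_neg (by omega)

variable (m k k') in
/-- The corners of the figure eight, which consists of a lobe and a second lobe, reflected at the
origin. -/
noncomputable def eightPos (j : ℕ) : Plane :=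
  if j ≤ k + 1 then lobePos m k j else -lobePos m k' (k + k' + 3 - j)

variable (m k k') in
/-- The directions of the edges of the figure eight. -/
def eightDir (j : ℕ) : Fin 2 → ℤ :=
  if j ≤ k then lobeDir m k j else if j = k + 1 then ![-1, 0]
  else if j ≤ k + k' + 2 then lobeDir m k' (k + k' + 2 - j) else ![1, m]

variable (m k k') in
/-- The directions of the rays of the figure eight. -/
def eightRay (j : ℕ) : Fin 2 → ℤ :=
  if j ≤ k + 1 then lobeRay m k j else -lobeRay m k' (k + k' + 3 - j)

variable (m k k') in
/-- The lengths of the edges of the figure eight. -/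
noncomputable def eightLen (j : ℕ) : ℝ :=
  if j ≤ k then lobeLen m k j else if j = k + 1 then k + k' + 8
  else if j ≤ k + k' + 2 then lobeLen m k' (k + k' + 2 - j) else 8

/-- The cycle follows the right lobe, crosses the origin on the horizontal axis, runs through the
reflected lobe against its own numbering, and returns through the origin on the diagonal. Hence the
subtracted index on the left. -/
theorem eight_cases {j : ℕ} (hj : j < k + k' + 4) :
    j ≤ k ∨ j = k + 1 ∨ (∃ i ≤ k', j = k + k' + 2 - i ∧ k + 1 < j) ∨ j = k + k' + 3 := by
  obtain h | h | h | h : j ≤ k ∨ j = k + 1 ∨ (k + 2 ≤ j ∧ j ≤ k + k' + 2) ∨ j = k + k' + 3 := by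
    omega
  · exact Or.inl h
  · exact Or.inr (Or.inl h)
  · exact Or.inr (Or.inr (Or.inl ⟨k + k' + 2 - j, by omega, by omega, by omega⟩))
  · exact Or.inr (Or.inr (Or.inr h))

theorem eightPos_left {i : ℕ} (hi : i ≤ k' + 1) :
    eightPos m k k' (k + k' + 3 - i) = -lobePos m k' i := by
  rw [eightPos, if_neg (by omega)]
  congr 2
  omega

theorem eightRay_left {i : ℕ} (hi : i ≤ k' + 1) :
    eightRay m k k' (k + k' + 3 - i) = -lobeRay m k' i := by
  rw [eightRay, if_neg (by omega)]
  congr 2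
  omega

theorem eightDir_left {i : ℕ} (hi : i ≤ k') :
    eightDir m k k' (k + k' + 2 - i) = lobeDir m k' i := by
  rw [eightDir, if_neg (by omega), if_neg (by omega), if_pos (by omega)]
  congr 1
  omega

theorem eightLen_left {i : ℕ} (hi : i ≤ k') :
    eightLen m k k' (k + k' + 2 - i) = lobeLen m k' i := by
  rw [eightLen, if_neg (by omega), if_neg (by omega), if_pos (by omega)]
  congr 1
  omega

theorem eightDir_right {j : ℕ} (hj : j ≤ k) : eightDir m k k' j = lobeDir m k j := if_pos hj

theorem eightDir_bottom : eightDir m k k' (k + 1) = ![-1, 0] := by simp [eightDir]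

theorem eightDir_diag : eightDir m k k' (k + k' + 3) = (![1, (m : ℤ)] : Fin 2 → ℤ) := by
  rw [eightDir, if_neg (by omega), if_neg (by omega), if_neg (by omega)]

theorem eightLen_right {j : ℕ} (hj : j ≤ k) : eightLen m k k' j = lobeLen m k j := if_pos hj

theorem eightLen_bottom : eightLen m k k' (k + 1) = k + k' + 8 := by simp [eightLen]

theorem eightLen_diag : eightLen m k k' (k + k' + 3) = 8 := by
  rw [eightLen, if_neg (by omega), if_neg (by omega), if_neg (by omega)]

theorem eightPos_right {j : ℕ} (hj : j ≤ k + 1) : eightPos m k k' j = lobePos m k j := if_pos hj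

theorem eightRay_right {j : ℕ} (hj : j ≤ k + 1) : eightRay m k k' j = lobeRay m k j := if_pos hj

theorem lobePos_bottom : lobePos m k (k + 1) = ![(k : ℝ) + 4, 0] := by simp [lobePos]

theorem lobePos_zero : lobePos m k 0 = ![4, (m : ℝ) * 4] := by
  simp [lobePos, lobeHeight, mul_comm]

/-- The figure eight with `k + k' + 4` rays. -/
noncomputable def eight (m k k' : ℕ) (hm : 1 ≤ m) (hk0 : 1 ≤ k) (hk : k ≤ m + 2) (hk0' : 1 ≤ k')
    (hk' : k' ≤ m + 2) : RayPolygon (k + k' + 4) where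
  pos := eightPos m k k'
  dir := eightDir m k k'
  ray := eightRay m k k'
  len := eightLen m k k'
  len_pos := by
    intro j hj
    rcases eight_cases hj with h | rfl | ⟨i, hi, rfl, -⟩ | rfl
    · rw [eightLen_right h]
      exact lobeLen_pos hm hk j
    · rw [eightLen_bottom]
      positivity
    · rw [eightLen_left hi]
      exact lobeLen_pos hm hk' i
    · rw [eightLen_diag]
      norm_num
  pos_succ := by
    intro j hj
    rcases eight_cases hj with h | rfl | ⟨i, hi, rfl, -⟩ | rfl
    · rw [cyclicSucc_of_lt (by omega), eightPos_right (by omega), eightPos_right (by omega),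
        eightLen_right h, eightDir_right h]
      exact lobePos_succ h
    · have e1 : k + 1 + 1 = k + k' + 3 - (k' + 1) := by omega
      rw [cyclicSucc_of_lt (by omega), e1, eightPos_left le_rfl, eightPos_right le_rfl,
        eightLen_bottom, eightDir_bottom, lobePos_bottom, lobePos_bottom]
      funext x
      fin_cases x
      · simp; ring
      · simp
    · have e1 : k + k' + 2 - i + 1 = k + k' + 3 - i := by omega
      have e2 : k + k' + 2 - i = k + k' + 3 - (i + 1) := by omega
      rw [cyclicSucc_of_lt (by omega), e1, eightPos_left (by omega), eightLen_left hi,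
        eightDir_left hi, e2, eightPos_left (by omega), lobePos_succ hi]
      abel
    · have e1 : cyclicSucc (k + k' + 4) (k + k' + 3) = 0 := if_pos rfl
      have e2 : k + k' + 3 = k + k' + 3 - 0 := rfl
      rw [e1, eightPos_right (by omega), eightLen_diag, eightDir_diag, e2,
        eightPos_left (by omega), lobePos_zero, lobePos_zero]
      funext x
      fin_cases x
      · simp; norm_num
      · simp; ring
  det_dir := by
    intro j hj
    rcases eight_cases hj with h | rfl | ⟨i, hi, rfl, -⟩ | rfl
    · rw [cyclicSucc_of_lt (by omega), eightDir_right h]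
      right
      rcases h.eq_or_lt with rfl | h'
      · rw [eightDir_bottom]
        simp [lobeDir, det₂]
      · rw [eightDir_right h', det_lobeDir h']
    · have e1 : k + 1 + 1 = k + k' + 2 - k' := by omega
      rw [cyclicSucc_of_lt (by omega), e1, eightDir_left le_rfl, eightDir_bottom]
      left
      simp [lobeDir, det₂]
    · rw [cyclicSucc_of_lt (by omega), eightDir_left hi]
      left
      rcases Nat.eq_zero_or_pos i with rfl | hi0
      · have e1 : k + k' + 2 - 0 + 1 = k + k' + 3 := by omega
        rw [e1, eightDir_diag]
        have h : 0 < k' := hk0'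
        simp [lobeDir, det₂, h]
      · obtain ⟨i, rfl⟩ : ∃ i', i = i' + 1 := ⟨i - 1, by omega⟩
        have e1 : k + k' + 2 - (i + 1) + 1 = k + k' + 2 - i := by omega
        rw [e1, eightDir_left (by omega), det₂_swap, det_lobeDir (by omega), neg_neg]
    · have e1 : cyclicSucc (k + k' + 4) (k + k' + 3) = 0 := if_pos rfl
      have h : 0 < k := hk0
      rw [e1, eightDir_diag, eightDir_right (by omega)]
      right
      simp [lobeDir, det₂, h]
  ray_succ := by
    intro j hj
    rcases eight_cases hj with h | rfl | ⟨i, hi, rfl, -⟩ | rfl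
    · rw [cyclicSucc_of_lt (by omega), eightDir_right h, eightRay_right (by omega)]
      rcases h.eq_or_lt with rfl | h'
      · rw [eightDir_bottom]
        funext x
        fin_cases x <;> simp [lobeDir, lobeRay]
      · rw [eightDir_right h', lobeDir_sub h']
    · have e1 : k + 1 + 1 = k + k' + 2 - k' := by omega
      have e2 : k + k' + 2 - k' = k + k' + 3 - (k' + 1) := by omega
      rw [cyclicSucc_of_lt (by omega), e1, eightDir_left le_rfl, eightDir_bottom, e2,
        eightRay_left le_rfl]
      funext x
      fin_cases x <;> simp [lobeDir, lobeRay]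
    · have e0 : k + k' + 2 - i + 1 = k + k' + 3 - i := by omega
      rw [cyclicSucc_of_lt (by omega), eightDir_left hi, e0, eightRay_left (by omega)]
      rcases Nat.eq_zero_or_pos i with rfl | hi0
      · rw [Nat.sub_zero, eightDir_diag]
        have h : 0 < k' := hk0'
        funext x
        fin_cases x <;> simp [lobeDir, lobeRay, h]
      · obtain ⟨i, rfl⟩ : ∃ i', i = i' + 1 := ⟨i - 1, by omega⟩
        have e1 : k + k' + 3 - (i + 1) = k + k' + 2 - i := by omega
        rw [e1, eightDir_left (by omega), ← lobeDir_sub (by omega), neg_sub]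
    · have e1 : cyclicSucc (k + k' + 4) (k + k' + 3) = 0 := if_pos rfl
      have h : 0 < k := hk0
      rw [e1, eightDir_diag, eightDir_right (by omega), eightRay_right (by omega)]
      funext x
      fin_cases x <;> simp [lobeDir, lobeRay, h]

variable (m k k') in
/-- The stratum of the figure eight that contains a given point other than the node. -/
noncomputable def eightLabel (q : Plane) : ℕ × ℕ :=
  if 0 < q 0 then lobeLabel m k q
  -- Edge `i` of the reflected lobe is traversed from its corner `i + 1` to its corner `i`, so the
  -- edge index is one less than the corner index. The diagonal meets both half-planes and carries
  -- the separate label `(3, 0)`.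
  else match lobeLabel m k' (-q) with
    | (0, j) => (0, k + k' + 3 - j)
    | (1, j) => (1, k + k' + 2 - j)
    | (2, j) => (2, k + k' + 3 - j)
    | _ => (3, 0)

theorem eightLabel_right {q : Plane} (h : 0 < q 0) : eightLabel m k k' q = lobeLabel m k q :=
  if_pos h

theorem eightLabel_left {q : Plane} (h : 0 < (-q) 0) : eightLabel m k k' q =
    match lobeLabel m k' (-q) with
    | (0, j) => (0, k + k' + 3 - j)
    | (1, j) => (1, k + k' + 2 - j)
    | (2, j) => (2, k + k' + 3 - j)
    | _ => (3, 0) :=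
  if_neg (by rw [Pi.neg_apply] at h; linarith)

theorem eightLabel_pos (hm : 1 ≤ m) (hk : k ≤ m + 2) (hk' : k' ≤ m + 2) {j : ℕ}
    (hj : j < k + k' + 4) : eightPos m k k' j 0 ≠ 0 ∧
      eightLabel m k k' (eightPos m k k' j) = (0, j) := by
  by_cases h : j ≤ k + 1
  · have h0 := lobePos_zero_pos (m := m) (k := k) j
    rw [eightPos_right h]
    exact ⟨h0.ne', by rw [eightLabel_right h0, lobeLabel_pos hm hk h]⟩
  · obtain ⟨i, hi, rfl⟩ : ∃ i ≤ k' + 1, j = k + k' + 3 - i :=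
      ⟨k + k' + 3 - j, by omega, by omega⟩
    have h0 := lobePos_zero_pos (m := m) (k := k') i
    rw [eightPos_left hi]
    refine ⟨by rw [Pi.neg_apply]; exact neg_ne_zero.2 h0.ne', ?_⟩
    rw [eightLabel_left (by rwa [neg_neg]), neg_neg, lobeLabel_pos hm hk' hi]
    rfl

theorem eightLabel_ray (hm : 1 ≤ m) (hk : k ≤ m + 2) (hk' : k' ≤ m + 2) {j : ℕ}
    (hj : j < k + k' + 4) {t : ℝ} (ht : 0 < t) :
    (eightPos m k k' j + t • toReal (eightRay m k k' j)) 0 ≠ 0 ∧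
      eightLabel m k k' (eightPos m k k' j + t • toReal (eightRay m k k' j)) = (2, j) := by
  by_cases h : j ≤ k + 1
  · obtain ⟨h0, hl⟩ := lobeLabel_ray hm hk h ht
    rw [eightPos_right h, eightRay_right h]
    exact ⟨h0.ne', by rw [eightLabel_right h0, hl]⟩
  · obtain ⟨i, hi, rfl⟩ : ∃ i ≤ k' + 1, j = k + k' + 3 - i :=
      ⟨k + k' + 3 - j, by omega, by omega⟩
    obtain ⟨h0, hl⟩ := lobeLabel_ray hm hk' hi ht
    have e : -lobePos m k' i + t • toReal (-lobeRay m k' i) =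
        -(lobePos m k' i + t • toReal (lobeRay m k' i)) := by
      rw [toReal_neg, smul_neg, neg_add]
    rw [eightPos_left hi, eightRay_left hi, e]
    refine ⟨by rw [Pi.neg_apply]; exact neg_ne_zero.2 h0.ne', ?_⟩
    rw [eightLabel_left (by rwa [neg_neg]), neg_neg, hl]
    rfl

/-- Only the horizontal and the diagonal edge reach the axis `q 0 = 0`, each at a single parameter,
and both do so at the origin. On the reflected lobe the parameter runs backwards. -/
theorem eightLabel_edge (hm : 1 ≤ m) (hk : k ≤ m + 2) (hk' : k' ≤ m + 2) {j : ℕ}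
    (hj : j < k + k' + 4) {t : ℝ} (ht : 0 < t) (htl : t < eightLen m k k' j) :
    ((eightPos m k k' j + t • toReal (eightDir m k k' j)) 0 ≠ 0 ∧
      eightLabel m k k' (eightPos m k k' j + t • toReal (eightDir m k k' j)) =
        if j = k + k' + 3 then (3, 0) else (1, j)) ∨
    ((j = k + 1 ∧ t = k + 4) ∨ (j = k + k' + 3 ∧ t = 4)) := by
  rcases eight_cases hj with h | rfl | ⟨i, hi, rfl, -⟩ | rfl
  · left
    rw [eightLen_right h] at htl
    obtain ⟨h0, hl⟩ := lobeLabel_edge hm hk h ht htl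
    rw [eightPos_right (by omega), eightDir_right h, if_neg (by omega)]
    exact ⟨h0.ne', by rw [eightLabel_right h0, hl]⟩
  · have e : eightPos m k k' (k + 1) + t • toReal (eightDir m k k' (k + 1)) =
        ![k + 4 - t, 0] := by
      rw [eightPos_right le_rfl, eightDir_bottom, lobePos_bottom]
      funext x
      fin_cases x <;> simp [sub_eq_add_neg]
    rw [eightLen_bottom] at htl
    rw [e, if_neg (by omega)]
    rcases lt_trichotomy t (k + 4) with h | h | h
    · left
      have h0 : (0 : ℝ) < k + 4 - t := by linarith
      refine ⟨h0.ne', ?_⟩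
      rw [eightLabel_right h0, lobeLabel_bottom (by linarith)]
    · exact Or.inr (Or.inl ⟨rfl, h⟩)
    · left
      have h0 : (0 : ℝ) < t - (k + 4) := by linarith
      have e2 : -![(k : ℝ) + 4 - t, 0] = ![t - (k + 4), 0] := by
        funext x
        fin_cases x <;> simp
      have h1 : 0 < (-![(k : ℝ) + 4 - t, 0]) 0 := by rw [e2]; exact h0
      refine ⟨by simp; linarith, ?_⟩
      rw [eightLabel_left h1, e2, lobeLabel_bottom (by linarith)]
      simp only [Prod.mk.injEq, true_and]
      omega
  · left
    rw [eightLen_left hi] at htl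
    obtain ⟨h0, hl⟩ := lobeLabel_edge hm hk' hi (t := lobeLen m k' i - t) (by linarith)
      (by linarith)
    have e2 : k + k' + 2 - i = k + k' + 3 - (i + 1) := by omega
    have e : eightPos m k k' (k + k' + 2 - i) + t • toReal (eightDir m k k' (k + k' + 2 - i)) =
        -(lobePos m k' i + (lobeLen m k' i - t) • toReal (lobeDir m k' i)) := by
      rw [eightDir_left hi, e2, eightPos_left (by omega), lobePos_succ hi, sub_smul]
      abel
    rw [e, if_neg (by omega)]
    refine ⟨by rw [Pi.neg_apply]; exact neg_ne_zero.2 h0.ne', ?_⟩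
    rw [eightLabel_left (by rwa [neg_neg]), neg_neg, hl]
    rfl
  · have e : eightPos m k k' (k + k' + 3) + t • toReal (eightDir m k k' (k + k' + 3)) =
        ![t - 4, m * (t - 4)] := by
      have e2 : k + k' + 3 = k + k' + 3 - 0 := rfl
      rw [eightDir_diag, e2, eightPos_left (by omega), lobePos_zero]
      funext x
      fin_cases x
      · simp; ring
      · simp; ring
    rw [eightLen_diag] at htl
    rw [e, if_pos rfl]
    rcases lt_trichotomy t 4 with h | h | h
    · left
      have e2 : -![t - 4, m * (t - 4)] = ![4 - t, m * (4 - t)] := by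
        funext x
        fin_cases x
        · simp
        · simp; ring
      have h1 : 0 < (-![t - 4, m * (t - 4)]) 0 := by rw [e2]; simpa using h
      refine ⟨by simp; linarith, ?_⟩
      rw [eightLabel_left h1, e2, lobeLabel_diag hm (by linarith) (by linarith)]
      rfl
    · exact Or.inr (Or.inr ⟨rfl, h⟩)
    · left
      have h0 : (0 : ℝ) < t - 4 := by linarith
      refine ⟨h0.ne', ?_⟩
      rw [eightLabel_right h0, lobeLabel_diag hm h0 (by linarith)]

end

/-! ### The immersed sun curve of the figure eight -/

section
variable {m k k' : ℕ}

theorem val_bottom : ((k + 1 : ℕ) : ZMod (k + k' + 4)).val = k + 1 :=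
  ZMod.val_natCast_of_lt (by omega)

theorem val_diag : ((k + k' + 3 : ℕ) : ZMod (k + k' + 4)).val = k + k' + 3 :=
  ZMod.val_natCast_of_lt (by omega)

variable [Fact (1 < k + k' + 4)]
variable (hm : 1 ≤ m) (hk0 : 1 ≤ k) (hk : k ≤ m + 2) (hk0' : 1 ≤ k') (hk' : k' ≤ m + 2)

/-- The sun curve whose cycle is mapped to the figure eight. -/
noncomputable def eightCurve : TropicalCurve :=
  sunCurve (k + k' + 4) (eight m k k' hm hk0 hk hk0' hk').len
    (eight m k k' hm hk0 hk hk0' hk').len_pos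

/-- The plane map of the figure eight. -/
noncomputable def eightMap : PlaneMap (eightCurve hm hk0 hk hk0' hk') :=
  (eight m k k' hm hk0 hk hk0' hk').planeMap

/-- The edge of the figure eight on the horizontal axis. -/
def bottomEdge : (eightCurve hm hk0 hk hk0' hk').E :=
  (Sum.inl ((k + 1 : ℕ) : ZMod (k + k' + 4)) : ZMod (k + k' + 4) ⊕ ZMod (k + k' + 4))

/-- The diagonal edge of the figure eight. -/
def diagEdge : (eightCurve hm hk0 hk hk0' hk').E :=
  (Sum.inl ((k + k' + 3 : ℕ) : ZMod (k + k' + 4)) : ZMod (k + k' + 4) ⊕ ZMod (k + k' + 4))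

/-- The edge or vertex that contains a point of the sun curve, encoded by a pair of numbers. -/
def eightCode : (eightCurve hm hk0 hk hk0' hk').Point → ℕ × ℕ
  -- Infinite vertices are not points of the curve, so the value `(0, 0)` assigned to them is never
  -- used.
  | .vertex w _ => Sum.elim (fun i : ZMod (k + k' + 4) => (0, i.val)) (fun _ => (0, 0)) w
  | .edge e _ _ _ => Sum.elim
      (fun i : ZMod (k + k' + 4) => if i.val = k + k' + 3 then (3, 0) else (1, i.val))
      (fun i : ZMod (k + k' + 4) => (2, i.val)) e

theorem ofReal_lt_bottomEdge :
    ENNReal.ofReal (k + 4) <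
      (eightCurve hm hk0 hk hk0' hk').length (bottomEdge hm hk0 hk hk0' hk') := by
  change _ < ENNReal.ofReal (eightLen m k k' ((k + 1 : ℕ) : ZMod (k + k' + 4)).val)
  rw [val_bottom, eightLen_bottom, ENNReal.ofReal_lt_ofReal_iff (by positivity)]
  linarith [(Nat.cast_nonneg k' : (0 : ℝ) ≤ k')]

theorem ofReal_lt_diagEdge :
    ENNReal.ofReal 4 < (eightCurve hm hk0 hk hk0' hk').length (diagEdge hm hk0 hk hk0' hk') := by
  change _ < ENNReal.ofReal (eightLen m k k' ((k + k' + 3 : ℕ) : ZMod (k + k' + 4)).val)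
  rw [val_diag, eightLen_diag, ENNReal.ofReal_lt_ofReal_iff (by norm_num)]
  norm_num

theorem dir_bottomEdge :
    (eightMap hm hk0 hk hk0' hk').dir (bottomEdge hm hk0 hk hk0' hk') = ![-1, 0] := by
  change eightDir m k k' ((k + 1 : ℕ) : ZMod (k + k' + 4)).val = _
  rw [val_bottom, eightDir_bottom]

theorem dir_diagEdge :
    (eightMap hm hk0 hk hk0' hk').dir (diagEdge hm hk0 hk hk0' hk') = ![1, (m : ℤ)] := by
  change eightDir m k k' ((k + k' + 3 : ℕ) : ZMod (k + k' + 4)).val = _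
  rw [val_diag, eightDir_diag]

theorem pt_bottomEdge :
    (eightMap hm hk0 hk hk0' hk').pt (bottomEdge hm hk0 hk hk0' hk') (k + 4) = 0 := by
  change eightPos m k k' ((k + 1 : ℕ) : ZMod (k + k' + 4)).val +
    ((k : ℝ) + 4) • toReal (eightDir m k k' ((k + 1 : ℕ) : ZMod (k + k' + 4)).val) = 0
  rw [val_bottom, eightDir_bottom, eightPos_right le_rfl, lobePos_bottom]
  funext x
  fin_cases x <;> simp

theorem pt_diagEdge :
    (eightMap hm hk0 hk hk0' hk').pt (diagEdge hm hk0 hk hk0' hk') 4 = 0 := by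
  change eightPos m k k' ((k + k' + 3 : ℕ) : ZMod (k + k' + 4)).val +
    (4 : ℝ) • toReal (eightDir m k k' ((k + k' + 3 : ℕ) : ZMod (k + k' + 4)).val) = 0
  have e : k + k' + 3 = k + k' + 3 - 0 := rfl
  rw [val_diag, eightDir_diag, e, eightPos_left (by omega), lobePos_zero]
  funext x
  fin_cases x
  · simp
  · simp; ring

/-- The label is computed from the position in the plane alone, so two points with the same image
off the node lie in the same stratum, where the parametrization is injective. The two exceptions are
the preimages of the node. -/
theorem eightLabel_image (y : (eightCurve hm hk0 hk hk0' hk').Point) :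
    ((eightMap hm hk0 hk hk0' hk').image y 0 ≠ 0 ∧
      eightLabel m k k' ((eightMap hm hk0 hk hk0' hk').image y) =
        eightCode hm hk0 hk hk0' hk' y) ∨
    y = .edge (diagEdge hm hk0 hk hk0' hk') 4 (by norm_num) (ofReal_lt_diagEdge ..) ∨
    y = .edge (bottomEdge hm hk0 hk hk0' hk') (k + 4) (by positivity)
      (ofReal_lt_bottomEdge ..) := by
  rcases y with ⟨i | i, hi⟩ | ⟨i | i, t, ht, htl⟩
  · exact Or.inl (eightLabel_pos hm hk hk' (ZMod.val_lt i))
  · exact absurd trivial hi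
  · have htl' : t < eightLen m k k' i.val := (ENNReal.ofReal_lt_ofReal_iff
      ((eight m k k' hm hk0 hk hk0' hk').len_pos _ (ZMod.val_lt i))).1 htl
    rcases eightLabel_edge hm hk hk' (ZMod.val_lt i) ht htl' with h | ⟨h, rfl⟩ | ⟨h, rfl⟩
    · exact Or.inl h
    · obtain rfl : i = ((k + 1 : ℕ) : ZMod (k + k' + 4)) :=
        ZMod.val_injective _ (h.trans val_bottom.symm)
      exact Or.inr (Or.inr rfl)
    · obtain rfl : i = ((k + k' + 3 : ℕ) : ZMod (k + k' + 4)) :=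
        ZMod.val_injective _ (h.trans val_diag.symm)
      exact Or.inr (Or.inl rfl)
  · exact Or.inl (eightLabel_ray hm hk hk' (ZMod.val_lt i) ht)

theorem eightMap_eq_of_code {x y : (eightCurve hm hk0 hk hk0' hk').Point}
    (hc : eightCode hm hk0 hk hk0' hk' x = eightCode hm hk0 hk hk0' hk' y)
    (h : (eightMap hm hk0 hk hk0' hk').image x = (eightMap hm hk0 hk hk0' hk').image y) :
    x = y := by
  have key : ∀ (e : (eightCurve hm hk0 hk hk0' hk').E) {s t : ℝ} (hs hs' ht ht'),
      (eightMap hm hk0 hk hk0' hk').image (.edge e s hs hs') =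
        (eightMap hm hk0 hk hk0' hk').image (.edge e t ht ht') →
      (.edge e s hs hs' : (eightCurve hm hk0 hk hk0' hk').Point) = .edge e t ht ht' := by
    intro e s t hs hs' ht ht' h
    obtain rfl : s = t := (eightMap hm hk0 hk hk0' hk').pt_injective e h
    rfl
  rcases x with ⟨i | i, hi⟩ | ⟨i | i, s, hs, hs'⟩
  on_goal 2 => exact absurd trivial hi
  all_goals
    rcases y with ⟨j | j, hj⟩ | ⟨j | j, t, ht, ht'⟩
    on_goal 2 => exact absurd trivial hj
    all_goals simp only [eightCode, Sum.elim_inl, Sum.elim_inr] at hc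
  · obtain rfl : i = j := ZMod.val_injective _ (Prod.ext_iff.1 hc).2
    rfl
  · split_ifs at hc <;> simp at hc
  · simp at hc
  · split_ifs at hc <;> simp at hc
  · obtain rfl : i = j := by
      split_ifs at hc with h1 h2 h2
      · exact ZMod.val_injective _ (h1.trans h2.symm)
      · simp at hc
      · simp at hc
      · exact ZMod.val_injective _ (Prod.ext_iff.1 hc).2
    exact key _ _ _ _ _ h
  · split_ifs at hc <;> simp at hc
  · simp at hc
  · split_ifs at hc <;> simp at hc
  · obtain rfl : i = j := ZMod.val_injective _ (Prod.ext_iff.1 hc).2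
    exact key _ _ _ _ _ h

theorem crossingNumber_eightCurve_le : crossingNumber (eightCurve hm hk0 hk hk0' hk') ≤ m := by
  have hp1 : (eightMap hm hk0 hk hk0' hk').image (.edge (bottomEdge hm hk0 hk hk0' hk') (k + 4)
      (by positivity) (ofReal_lt_bottomEdge ..)) = 0 := pt_bottomEdge hm hk0 hk hk0' hk'
  have hp2 : (eightMap hm hk0 hk hk0' hk').image (.edge (diagEdge hm hk0 hk hk0' hk') 4
      (by norm_num) (ofReal_lt_diagEdge ..)) = 0 := pt_diagEdge hm hk0 hk hk0' hk'
  have hd : det₂ ((eightMap hm hk0 hk hk0' hk').dir (diagEdge hm hk0 hk hk0' hk'))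
      ((eightMap hm hk0 hk hk0' hk').dir (bottomEdge hm hk0 hk hk0' hk')) = m := by
    rw [dir_bottomEdge, dir_diagEdge]
    simp [det₂]
  have hfib : ∀ y, (eightMap hm hk0 hk hk0' hk').image y = 0 →
      y = .edge (diagEdge hm hk0 hk hk0' hk') 4 (by norm_num) (ofReal_lt_diagEdge ..) ∨
      y = .edge (bottomEdge hm hk0 hk hk0' hk') (k + 4) (by positivity)
        (ofReal_lt_bottomEdge ..) := by
    intro y hy
    rcases eightLabel_image hm hk0 hk hk0' hk' y with h | h
    · exact absurd (by rw [hy]; rfl) h.1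
    · exact h
  have himm := (eightMap hm hk0 hk hk0' hk').isImmersion_of_crossing
    (RayPolygon.image_halfEdges (eight m k k' hm hk0 hk hk0' hk')) (by norm_num)
    (ofReal_lt_diagEdge hm hk0 hk hk0' hk') (by positivity)
    (ofReal_lt_bottomEdge hm hk0 hk hk0' hk')
    (by rw [hd]; exact_mod_cast (by omega : m ≠ 0)) (hp1.trans hp2.symm)
    (fun x y hxy => by
      rw [hp2]
      rcases eightLabel_image hm hk0 hk hk0' hk' x with hx | rfl | rfl
      · rcases eightLabel_image hm hk0 hk hk0' hk' y with hy | rfl | rfl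
        · exact Or.inl (eightMap_eq_of_code hm hk0 hk hk0' hk'
            (by rw [← hx.2, ← hy.2, hxy]) hxy)
        · exact Or.inr (hxy.trans hp2)
        · exact Or.inr (hxy.trans hp1)
      · exact Or.inr hp2
      · exact Or.inr hp1)
    (fun y hy => hfib y (hy.trans hp2))
  rw [hd, Int.natAbs_natCast] at himm
  exact (iInf₂_le _ himm.1).trans himm.2

end

/-- Two lobes of maximal size `m + 2` give `2m + 8` rays; shortening one of them by a corner gives
`2m + 7`. -/
theorem exists_isSun_crossingNumber_le {n m : ℕ} (hm : 1 ≤ m)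
    (hn : n = 2 * m + 7 ∨ n = 2 * m + 8) :
    ∃ Γ : TropicalCurve, IsSun n Γ ∧ crossingNumber Γ ≤ m := by
  obtain ⟨k, k', hk0, hk, hk0', hk', rfl⟩ : ∃ k k' : ℕ, 1 ≤ k ∧ k ≤ m + 2 ∧ 1 ≤ k' ∧ k' ≤ m + 2 ∧
      n = k + k' + 4 := by
    rcases hn with rfl | rfl
    · exact ⟨m + 1, m + 2, by omega, by omega, by omega, by omega, by omega⟩
    · exact ⟨m + 2, m + 2, by omega, by omega, by omega, by omega, by omega⟩
  have : Fact (1 < k + k' + 4) := ⟨by omega⟩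
  exact ⟨_, isSun_sunCurve _ _ _, crossingNumber_eightCurve_le hm hk0 hk hk0' hk'⟩

end Tropical

theorem mainTheorem9 (n : ℕ) (hn : 9 < n) :
    (∀ Γ : Tropical.TropicalCurve, Tropical.IsSun n Γ →
      ((⌈(n : ℝ) / 2⌉₊ - 4 : ℕ) : ℕ∞) ≤ Tropical.crossingNumber Γ) ∧
    ∃ Γ : Tropical.TropicalCurve, Tropical.IsSun n Γ ∧
      Tropical.crossingNumber Γ = ((⌈(n : ℝ) / 2⌉₊ - 4 : ℕ) : ℕ∞) := by
  have hceil := Tropical.ceil_half n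
  have hlow : ∀ Γ : Tropical.TropicalCurve, Tropical.IsSun n Γ →
      ((⌈(n : ℝ) / 2⌉₊ - 4 : ℕ) : ℕ∞) ≤ Tropical.crossingNumber Γ := fun Γ h =>
    h.le_crossingNumber hn fun δ hδ => by omega
  -- Since `n ≥ 10`, the subtraction of natural numbers is not truncated and `m ≥ 1`; the parity of
  -- `n` selects between `2m + 7` and `2m + 8`.
  obtain ⟨Γ, hΓ, hle⟩ := Tropical.exists_isSun_crossingNumber_le (n := n)
    (m := ⌈(n : ℝ) / 2⌉₊ - 4) (by omega) (by omega)
  exact ⟨hlow, Γ, hΓ, le_antisymm hle (hlow Γ hΓ)⟩
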